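/- Let $\sigma(t)=\max\{t,0\}$. A deep ReLU network $\Phi$ with input dimension $d$ and $L\ge 2$ layers is a sequence $((W^1,b^1),\dots,(W^L,b^L))$ with $W^\ell\in\mathbb R^{N_\ell\times N_{\ell-1}}$, $b^\ell\in\mathbb R^{N_\ell}$, $N_0=d$, $N_L=1$, $N_\ell\ge 1$; its output is $\mathcal N(\Phi,x)=z^L$, where $z^0=x$, $z^\ell=\sigma(W^\ell z^{\ell-1}+b^\ell)$ componentwise for $1\le\ell\le L-1$, and $z^L=W^Lz^{L-1}+b^L$. Its depth is $L$ and its width is $N_w=\max_{0\le\ell\le L}N_\ell$. An architecture $\mathbb A$ is such a sequence with all entries in $\{0,1\}$; $\Phi$ has architecture $\mathbb A$ if it has the same dimensions $N_0,\dots,N_L$ and every weight that is zero in $\mathbb A$ is zero in $\Phi$. For $0<\alpha\le 2$, let $\mathring U^\alpha_\infty$ be the set of continuous functions $f$ on $[0,1]^d$ that vanish on the boundary of the cube and satisfy $$\max_{u\subset\{1,\dots,d\}}\ \sup_{h}\ \prod_{i\in u}h_i^{-\alpha}\ \sup_{x}|\Delta_h^{2,u}f(x)|\le 1,$$ where $h_i>0$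 for $i\in u$, where $x$ runs through the points of $[0,1]^d$ with $x_i+2h_i\le 1$ for $i\in u$, and where $\Delta^{2,u}_h$ is the composition over $i\in u$ of the second differences $f\mapsto f(\cdot+2h_ie_i)-2f(\cdot+h_ie_i)+f$. For $1\le p\le\infty$, let $\mathring W^1_p$ be the space of functions in $L_p([0,1]^d)$ with weak partial derivatives in $L_p$ and with zero trace on the boundary, normed by $\|f\|_{\mathring W^1_p}=\big(\sum_{i=1}^d\|\partial_if\|_{L_p}^p\big)^{1/p}$ for $p<\infty$ and $\|f\|_{\mathring W^1_\infty}=\max_i\|\partial_if\|_{L_\infty}$. For $d\ge 2$, $1<\alpha\le 2$, $\beta>\alpha$ and $1\le p\le\infty$ put, with $(p+1)^{t/p}:=1$ for $p=\infty$, $$K_1=2(p+1)^{\frac1p}\max\Big\{\tfrac{2\beta}{\beta-1},\tfrac1{2^{\alpha-1}-1}\Big\},\qquad \varepsilon_0=\min\Big\{1,\ \frac{d}{2^{\alpha d}(1-2^{1-\alpha})},\ \frac{K_1d^2}{(p+1)^{d/p}\,2^{(\alpha+1)d}\big(1-2^{-\frac{\beta-\alpha}{\beta-1}}\big)^d}\Big\},$$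 $$B=B(d,\alpha,\beta,p)=\big(1-2^{-\frac1{\beta-1}}\big)\Big(\frac{(p+1)^{\frac1p}\,2^{\alpha+1}\big(1-2^{-\frac{\beta-\alpha}{\beta-1}}\big)}{d^{2\alpha/d}}\Big)^{\frac1{\alpha-1}}.$$ There is an absolute constant $K_4>0$, and for all $1<\alpha\le 2$, $\beta>\alpha$, $1\le p\le\infty$ there is a constant $K_5=K_5(\alpha,\beta,p)>0$, such that for every $d\ge 2$ and every $\varepsilon\in(0,\varepsilon_0)$ there is an architecture $\mathbb A^*_\varepsilon$ with input dimension $d$ such that $$N_w(\mathbb A^*_\varepsilon)\le K_4d,\qquad L(\mathbb A^*_\varepsilon)\le K_5\,B^{-d}\,(\varepsilon^{-1})^{\frac1{\alpha-1}}\max\{1,\log_2(\varepsilon^{-1})\},$$ and for every $f\in\mathring U^\alpha_\infty$ there is a deep ReLU network $\Phi_f^*$ with architecture $\mathbb A^*_\varepsilon$ for which $f-\mathcal N(\Phi_f^*,\cdot)\in\mathring W^1_p$ and $$\|f-\mathcal N(\Phi_f^*,\cdot)\|_{\mathring W^1_p}\le\varepsilon .$$ -/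

import Mathlib

open MeasureTheory
open scoped ENNReal ContDiff Matrix

noncomputable section

namespace DeepReLU

/-! ### Neural networks -/

/-- The dimensions `(N 0, …, N L)` of a network with input dimension `d`, scalar output and
`L = hidden + 1 ≥ 2` layers. Only the values `N ℓ` with `ℓ ≤ L` are relevant. -/
structure NetShape (d : ℕ) where
  hidden : ℕ
  one_le_hidden : 1 ≤ hidden
  N : ℕ → ℕ
  N_input : N 0 = d
  N_output : N (hidden + 1) = 1
  N_pos : ∀ ℓ, 1 ≤ ℓ → ℓ ≤ hidden → 1 ≤ N ℓ

/-- The depth `L`: the number of layers. -/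
def NetShape.depth {d : ℕ} (D : NetShape d) : ℕ := D.hidden + 1

/-- The width `max_{0 ≤ ℓ ≤ L} N ℓ`. -/
def NetShape.width {d : ℕ} (D : NetShape d) : ℕ :=
  (Finset.range (D.depth + 1)).sup D.N

/-- A neural network with dimensions `D`. The pair `(W ℓ, b ℓ)`, `0 ≤ ℓ < L`, holds the edge and
node weights leading from layer `ℓ` to layer `ℓ + 1`; the values at `ℓ ≥ L` are irrelevant. -/
structure Net {d : ℕ} (D : NetShape d) where
  W : (ℓ : ℕ) → Matrix (Fin (D.N (ℓ + 1))) (Fin (D.N ℓ)) ℝ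
  b : (ℓ : ℕ) → Fin (D.N (ℓ + 1)) → ℝ

/-- A network architecture is a network all of whose weights are `0` or `1`. -/
def Net.IsArchitecture {d : ℕ} {D : NetShape d} (A : Net D) : Prop :=
  ∀ ℓ < D.depth, (∀ i j, A.W ℓ i j = 0 ∨ A.W ℓ i j = 1) ∧ ∀ i, A.b ℓ i = 0 ∨ A.b ℓ i = 1

/-- `Φ` has architecture `A`: the dimensions agree (by typing), and every weight that vanishes
in `A` vanishes in `Φ`. -/
def Net.HasArchitecture {d : ℕ} {D : NetShape d} (Φ A : Net D) : Prop :=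
  ∀ ℓ < D.depth, (∀ i j, A.W ℓ i j = 0 → Φ.W ℓ i j = 0) ∧ ∀ i, A.b ℓ i = 0 → Φ.b ℓ i = 0

/-- The vector `z ^ ℓ` of the ReLU computation scheme; it is used for `ℓ < L` only. -/
def Net.layer {d : ℕ} {D : NetShape d} (Φ : Net D) (x : Fin d → ℝ) : (ℓ : ℕ) → Fin (D.N ℓ) → ℝ
  | 0 => fun i => x (Fin.cast D.N_input i)
  | ℓ + 1 => fun i => max ((Φ.W ℓ *ᵥ Φ.layer x ℓ) i + Φ.b ℓ i) 0

/-- The output of the ReLU network `Φ` at `x`: the last layer carries no activation. -/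
def Net.output {d : ℕ} {D : NetShape d} (Φ : Net D) (x : Fin d → ℝ) : ℝ :=
  (Φ.W D.hidden *ᵥ Φ.layer x D.hidden) (Fin.cast D.N_output.symm 0) +
    Φ.b D.hidden (Fin.cast D.N_output.symm 0)

/-! ### Hölder–Zygmund functions of mixed smoothness -/

/-- The closed unit cube. -/
def cube (d : ℕ) : Set (Fin d → ℝ) := Set.Icc 0 1

/-- The univariate second difference operator with step `h` acting in the `i`-th variable:
`f ↦ (x ↦ f (x + 2 h eᵢ) - 2 f (x + h eᵢ) + f x)`. -/
def secondDiff {d : ℕ} (i : Fin d) (h : ℝ) : Module.End ℝ ((Fin d → ℝ) → ℝ) where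
  toFun f x := f (x + Pi.single i (2 * h)) - 2 * f (x + Pi.single i h) + f x
  map_add' f g := by ext x; simp only [Pi.add_apply]; ring
  map_smul' c f := by ext x; simp only [Pi.smul_apply, smul_eq_mul, RingHom.id_apply]; ring

theorem secondDiff_commute {d : ℕ} (i j : Fin d) (h k : ℝ) :
    Commute (secondDiff i h) (secondDiff j k) := by
  refine LinearMap.ext fun f => funext fun x => ?_
  simp only [Module.End.mul_apply, secondDiff, LinearMap.coe_mk, AddHom.coe_mk]
  simp only [add_right_comm x (Pi.single j _) (Pi.single i _)]
  ring

/-- The mixed difference operator: the product over `i ∈ u` of the second differences with step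
`h i` in the `i`-th variable (the identity if `u = ∅`). -/
def mixedDiff {d : ℕ} (u : Finset (Fin d)) (h : Fin d → ℝ) : Module.End ℝ ((Fin d → ℝ) → ℝ) :=
  u.noncommProd (fun i => secondDiff i (h i)) fun _ _ _ _ _ => secondDiff_commute _ _ _ _

/-- The points `x` of the cube with `x i + 2 h i ∈ [0, 1]` for all `i ∈ u`. -/
def diffDomain {d : ℕ} (u : Finset (Fin d)) (h : Fin d → ℝ) : Set (Fin d → ℝ) :=
  {x | x ∈ cube d ∧ ∀ i ∈ u, x i + 2 * h i ∈ Set.Icc (0 : ℝ) 1}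

/-- The Hölder–Zygmund norm of mixed smoothness `α`, with values in `[0, ∞]`. -/
def holderNorm {d : ℕ} (α : ℝ) (f : (Fin d → ℝ) → ℝ) : ℝ≥0∞ :=
  ⨆ (u : Finset (Fin d)) (h : Fin d → ℝ) (_ : ∀ i ∈ u, 0 < h i) (x ∈ diffDomain u h),
    ENNReal.ofReal ((∏ i ∈ u, h i ^ (-α)) * |mixedDiff u h f x|)

/-- The closed unit ball of the Hölder–Zygmund space of mixed smoothness `α` on the cube with
homogeneous boundary condition. Only the values of `f` on the cube matter. -/
structure InUnitBall {d : ℕ} (α : ℝ) (f : (Fin d → ℝ) → ℝ) : Prop where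
  continuousOn : ContinuousOn f (cube d)
  boundary : ∀ x ∈ cube d, (∃ j, x j = 0 ∨ x j = 1) → f x = 0
  norm_le_one : holderNorm α f ≤ 1

/-! ### The Sobolev space with homogeneous boundary condition -/

/-- `g` is the weak partial derivative of `f` in the `i`-th variable on the open unit cube. -/
def IsWeakPartial {d : ℕ} (i : Fin d) (f g : (Fin d → ℝ) → ℝ) : Prop :=
  ∀ φ : (Fin d → ℝ) → ℝ, ContDiff ℝ ∞ φ → HasCompactSupport φ →
    tsupport φ ⊆ Set.univ.pi (fun _ => Set.Ioo (0 : ℝ) 1) →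
    ∫ x in cube d, f x * fderiv ℝ φ x (Pi.single i 1) = -∫ x in cube d, g x * φ x

/-- `f` has trace zero on the boundary of the cube, where `g` is the weak gradient of `f`: in
Green's formula `∫ f ∂ᵢφ + ∫ gᵢ φ = ∫_{∂} (tr f) φ νᵢ` the boundary term vanishes for all `i` and
all smooth `φ`, whether or not `φ` vanishes near the boundary. -/
def HasZeroTrace {d : ℕ} (f : (Fin d → ℝ) → ℝ) (g : Fin d → (Fin d → ℝ) → ℝ) : Prop :=
  ∀ (i : Fin d) (φ : (Fin d → ℝ) → ℝ), ContDiff ℝ ∞ φ → HasCompactSupport φ →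
    (∫ x in cube d, f x * fderiv ℝ φ x (Pi.single i 1)) + ∫ x in cube d, g i x * φ x = 0

/-- `f` belongs to the Sobolev space of order one and exponent `p` on the cube, with zero trace,
and `g` is its weak gradient. -/
structure IsW10Gradient {d : ℕ} (p : ℝ≥0∞) (f : (Fin d → ℝ) → ℝ)
    (g : Fin d → (Fin d → ℝ) → ℝ) : Prop where
  memLp : MemLp f p (volume.restrict (cube d))
  memLp_grad : ∀ i, MemLp (g i) p (volume.restrict (cube d))
  weak : ∀ i, IsWeakPartial i f (g i)
  trace : HasZeroTrace f g

/-- Membership in the Sobolev space with homogeneous boundary condition. -/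
def MemW10 {d : ℕ} (p : ℝ≥0∞) (f : (Fin d → ℝ) → ℝ) : Prop :=
  ∃ g : Fin d → (Fin d → ℝ) → ℝ, IsW10Gradient p f g

/-- The expression `(∑ᵢ ∫ |gᵢ|^p)^(1/p)`, resp. `maxᵢ ess sup |gᵢ|` for `p = ∞`. -/
def gradNorm {d : ℕ} (p : ℝ≥0∞) (g : Fin d → (Fin d → ℝ) → ℝ) : ℝ≥0∞ :=
  if p = ⊤ then ⨆ i, essSup (fun x => ‖g i x‖ₑ) (volume.restrict (cube d))
  else (∑ i, ∫⁻ x in cube d, ‖g i x‖ₑ ^ p.toReal) ^ (1 / p.toReal)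

/-- The norm of the Sobolev space with homogeneous boundary condition, i.e. the norm of the weak
gradient (which is unique up to null sets); it is `∞` for a function outside of the space. -/
def w10Norm {d : ℕ} (p : ℝ≥0∞) (f : (Fin d → ℝ) → ℝ) : ℝ≥0∞ :=
  ⨅ (g : Fin d → (Fin d → ℝ) → ℝ) (_ : IsW10Gradient p f g), gradNorm p g

/-! ### The constants -/

/-- `(p + 1)^(t / p)`, with its limit `1` at `p = ∞`. -/
def pPow (p : ℝ≥0∞) (t : ℝ) : ℝ :=
  if p = ⊤ then 1 else (p.toReal + 1) ^ (t / p.toReal)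

/-- `1 - 2^(-(β - α)/(β - 1))`. -/
def gap (α β : ℝ) : ℝ := 1 - (2 : ℝ) ^ (-((β - α) / (β - 1)))

def K₁ (α β : ℝ) (p : ℝ≥0∞) : ℝ :=
  2 * pPow p 1 * max (2 * β / (β - 1)) (1 / ((2 : ℝ) ^ (α - 1) - 1))

def ε₀ (d : ℕ) (α β : ℝ) (p : ℝ≥0∞) : ℝ :=
  min 1 (min (d / ((2 : ℝ) ^ (α * d) * (1 - (2 : ℝ) ^ (1 - α))))
    (K₁ α β p * d ^ 2 / (pPow p d * (2 : ℝ) ^ ((α + 1) * d) * gap α β ^ d)))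

def B (d : ℕ) (α β : ℝ) (p : ℝ≥0∞) : ℝ :=
  (1 - (2 : ℝ) ^ (-(1 / (β - 1)))) *
    (pPow p 1 * (2 : ℝ) ^ (α + 1) * gap α β / (d : ℝ) ^ (2 * α / d)) ^ (1 / (α - 1))

end DeepReLU

end

/-! The network computes a truncated Faber series. A function in the unit ball, extended by zero, is
the sum over levels k = (k_1, …, k_d) of tensor products of dyadic hat functions (`hasSum_level`),
whose coefficients are mixed second differences, hence at most 2^(-(α+1)d) 2^(-α|k|) with |k| = k_1
+ … + k_d (`InUnitBall.abs_coef_le`). Hats of one level have disjoint supports and slope 2^(k_i+1)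
in direction i. So the i-th derivative of level k is at most 2 · 2^(-(α+1)d) · 2^(k_i - α|k|) times
a product of d - 1 sawtooths, whose L_p norm is at most (p+1)^(-(d-1)/p).

Kept are the levels with β|k| - k_i ≤ (β-1)m for some i. With k_i singled out and the other indices
entering only through their sum, the discarded weights and the number of kept grid points become
products of geometric series (`tsum_split_le`): the former is of order 2^((1-α)m) gap^(-(d-1)), the
latter d 2^m (1 - 2^(-1/(β-1)))^(-(d-1)), up to factors independent of d and m.

Products of hats are replaced by ReLU products, obtained by polarization from t - t² = ∑
tent^j(t)/4^j. After M terms the error is Lipschitz in each variable with constant of order d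
2^(-M), so derivatives converge too (`abs_prodApprox_error_sub_le`). The approximate product is
exactly zero where a factor is, so supports and zero boundary values survive. The products are
evaluated one after another on d + 12 units, with about dM layers for each; only the output and
hidden weights depend on f, never the dimensions.

The error is globally Lipschitz and vanishes outside of the cube. It therefore has zero trace, and
its gradient is estimated by Minkowski's inequality over the levels (`memW10_and_w10Norm_le`).
Choosing 2^((α-1)m) and 2^M proportional to 1/ε makes both error contributions at most ε/2
(`exists_parameters`). -/

namespace DeepReLU

/-! ### Approximate multiplication -/

noncomputable section

/-- The tent map on `[0, 1]`, written with ReLU units. -/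
def tent (t : ℝ) : ℝ := 2 * t - 4 * max (t - 1 / 2) 0

theorem tent_mem {t : ℝ} (ht : t ∈ Set.Icc (0 : ℝ) 1) : tent t ∈ Set.Icc (0 : ℝ) 1 := by
  obtain ⟨h0, h1⟩ := ht
  unfold tent
  rcases max_cases (t - 1 / 2) 0 with h | h <;> constructor <;> linarith

theorem abs_tent_sub_le (s t : ℝ) : |tent s - tent t| ≤ 2 * |s - t| := by
  unfold tent
  rcases max_cases (t - 1 / 2) 0 with h | h <;> rcases max_cases (s - 1 / 2) 0 with h' | h' <;>
  rcases abs_cases (s - t) with h'' | h'' <;> rw [abs_le] <;> constructor <;> linarith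

/-- The ReLU approximation of `t ↦ t - t ^ 2` on `[0, 1]` by iterated tent maps. -/
def bump : ℕ → ℝ → ℝ
  | 0, _ => 0
  | M + 1, t => (bump M (tent t) + tent t) / 4

theorem tent_iterate_mem (M : ℕ) {t : ℝ} (ht : t ∈ Set.Icc (0 : ℝ) 1) :
    tent^[M] t ∈ Set.Icc (0 : ℝ) 1 := by
  induction M with
  | zero => exact ht
  | succ M ih => rw [Function.iterate_succ_apply']; exact tent_mem ih

/-- The definition peels off the first tent map. Appending the last one instead lets a network
update the sum while storing only the current iterate. -/
theorem bump_succ (M : ℕ) (t : ℝ) :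
    bump (M + 1) t = bump M t + tent^[M + 1] t / 4 ^ (M + 1) := by
  induction M generalizing t with
  | zero => simp [bump]
  | succ M ih =>
    rw [bump, ih, bump, Function.iterate_succ_apply (f := tent) (n := M + 1)]
    ring

theorem bump_zero_right (M : ℕ) : bump M 0 = 0 := by
  induction M with
  | zero => rfl
  | succ M ih =>
    have : tent 0 = 0 := by unfold tent; norm_num
    rw [bump, this, ih]; norm_num

theorem bump_one_right (M : ℕ) : bump M 1 = 0 := by
  cases M with
  | zero => rfl
  | succ M =>
    have : tent 1 = 0 := by unfold tent; norm_num
    rw [bump, this, bump_zero_right]; norm_num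

/-- Since `tent` has slope at most 2, a Lipschitz constant 1 is passed on as (2 + 2)/4 = 1. -/
theorem abs_bump_sub_le (M : ℕ) (s t : ℝ) : |bump M s - bump M t| ≤ |s - t| := by
  induction M generalizing s t with
  | zero => simp [bump]
  | succ M ih =>
    have h1 := ih (tent s) (tent t)
    have h2 := abs_tent_sub_le s t
    have : bump (M + 1) s - bump (M + 1) t
        = (bump M (tent s) - bump M (tent t)) / 4 + (tent s - tent t) / 4 := by
      rw [bump, bump]; ring
    rw [this]
    refine (abs_add_le _ _).trans ?_
    rw [abs_div, abs_div, abs_of_pos (show (0 : ℝ) < 4 by norm_num)]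
    linarith

/-- The parabola t - t² is a fixed point of the recursion that defines `bump`. -/
theorem sub_sq_eq_tent {t : ℝ} :
    t - t ^ 2 = (tent t - tent t ^ 2 + tent t) / 4 := by
  unfold tent
  rcases max_cases (t - 1 / 2) 0 with h | h <;> rw [h.1] <;> ring

/-- Each step composes the error with `tent`, which at most doubles distances, and divides by 4, so
the Lipschitz constant is halved. A Lipschitz bound is needed because the Sobolev norm measures
derivatives. -/
theorem abs_bump_error_sub_le (M : ℕ) {s t : ℝ} (hs : s ∈ Set.Icc (0 : ℝ) 1)
    (ht : t ∈ Set.Icc (0 : ℝ) 1) :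
    |(s - s ^ 2 - bump M s) - (t - t ^ 2 - bump M t)| ≤ (1 / 2) ^ M * |s - t| := by
  induction M generalizing s t with
  | zero =>
    have : (s - s ^ 2 - bump 0 s) - (t - t ^ 2 - bump 0 t) = (1 - s - t) * (s - t) := by
      simp only [bump]; ring
    rw [this, abs_mul, pow_zero]
    refine mul_le_mul_of_nonneg_right ?_ (abs_nonneg _)
    rw [abs_le]; constructor <;> linarith [hs.1, hs.2, ht.1, ht.2]
  | succ M ih =>
    have h1 := ih (tent_mem hs) (tent_mem ht)
    have h2 := abs_tent_sub_le s t
    have : (s - s ^ 2 - bump (M + 1) s) - (t - t ^ 2 - bump (M + 1) t)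
        = ((tent s - tent s ^ 2 - bump M (tent s))
          - (tent t - tent t ^ 2 - bump M (tent t))) / 4 := by
      rw [bump, bump, sub_sq_eq_tent (t := s), sub_sq_eq_tent (t := t)]; ring
    rw [this, abs_div, abs_of_pos (show (0 : ℝ) < 4 by norm_num), pow_succ (1 / 2 : ℝ) M]
    have : (1 / 2 : ℝ) ^ M * |tent s - tent t| ≤ (1 / 2) ^ M * (2 * |s - t|) := by gcongr
    linarith

/-- The ReLU approximation of the product of two numbers in `[0, 1]`. -/
def mulApprox (M : ℕ) (a b : ℝ) : ℝ :=
  min a b - bump M ((a + b) / 2) + bump M (|a - b| / 2)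

/-- With a zero factor both arguments of `bump` coincide. These exact zeros keep the supports of the
hat products and the zero boundary values. -/
theorem mulApprox_zero_left (M : ℕ) {b : ℝ} (hb : 0 ≤ b) : mulApprox M 0 b = 0 := by
  simp [mulApprox, min_eq_left hb, abs_of_nonneg hb]

theorem mulApprox_zero_right (M : ℕ) {a : ℝ} (ha : 0 ≤ a) : mulApprox M a 0 = 0 := by
  simp [mulApprox, min_eq_right ha, abs_of_nonneg ha]

theorem mulApprox_succ (M : ℕ) (a b : ℝ) :
    mulApprox (M + 1) a b = mulApprox M a b - tent^[M + 1] ((a + b) / 2) / 4 ^ (M + 1)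
      + tent^[M + 1] (|a - b| / 2) / 4 ^ (M + 1) := by
  simp only [mulApprox, bump_succ]; ring

theorem half_add_mem {a b : ℝ} (ha : a ∈ Set.Icc (0 : ℝ) 1) (hb : b ∈ Set.Icc (0 : ℝ) 1) :
    (a + b) / 2 ∈ Set.Icc (0 : ℝ) 1 :=
  ⟨by linarith [ha.1, hb.1], by linarith [ha.2, hb.2]⟩

theorem half_abs_sub_mem {a b : ℝ} (ha : a ∈ Set.Icc (0 : ℝ) 1) (hb : b ∈ Set.Icc (0 : ℝ) 1) :
    |a - b| / 2 ∈ Set.Icc (0 : ℝ) 1 := by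
  refine ⟨by positivity, ?_⟩
  have : |a - b| ≤ 1 := by rw [abs_le]; constructor <;> linarith [ha.1, hb.1, ha.2, hb.2]
  linarith

theorem min_eq_half (a b : ℝ) : min a b = (a + b) / 2 - |a - b| / 2 := by
  rcases le_total a b with h | h
  · rw [min_eq_left h, abs_of_nonpos (by linarith)]; ring
  · rw [min_eq_right h, abs_of_nonneg (by linarith)]; ring

/-- The lower bound is the Lipschitz bound between the two arguments of `bump`; the upper one
compares them with the zeros of `bump` at 1 and 0. Products can thus be iterated without leaving [0,
1]. -/
theorem mulApprox_mem (M : ℕ) {a b : ℝ} (ha : a ∈ Set.Icc (0 : ℝ) 1)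
    (hb : b ∈ Set.Icc (0 : ℝ) 1) : mulApprox M a b ∈ Set.Icc (0 : ℝ) 1 := by
  have hmin : 0 ≤ min a b := le_min ha.1 hb.1
  have e := min_eq_half a b
  have hs := half_add_mem ha hb
  have hd := half_abs_sub_mem ha hb
  have h1 := abs_bump_sub_le M ((a + b) / 2) (|a - b| / 2)
  have h2 := abs_bump_sub_le M 1 ((a + b) / 2)
  have h3 := abs_bump_sub_le M (|a - b| / 2) 0
  rw [bump_one_right, abs_of_nonneg (show 0 ≤ 1 - (a + b) / 2 by linarith [hs.2]), abs_le] at h2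
  rw [bump_zero_right, sub_zero, sub_zero, abs_of_nonneg hd.1, abs_le] at h3
  rw [abs_of_nonneg (show 0 ≤ (a + b) / 2 - |a - b| / 2 by linarith), abs_le] at h1
  unfold mulApprox
  constructor <;> linarith [h1.1, h1.2, h2.1, h2.2, h3.1, h3.2]

/-- Polarization: with u = (a + b)/2 and v = |a - b|/2 one has min a b = u - v and ab = u² - v² = (u
- v) - (u - u²) + (v - v²). -/
theorem mulApprox_sub_mul (M : ℕ) (a b : ℝ) :
    mulApprox M a b - a * b = ((a + b) / 2 - ((a + b) / 2) ^ 2 - bump M ((a + b) / 2))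
      - (|a - b| / 2 - (|a - b| / 2) ^ 2 - bump M (|a - b| / 2)) := by
  rw [mulApprox, min_eq_half]
  have := sq_abs (a - b)
  linear_combination (-1 / 4) * this

theorem abs_mulApprox_error_left (M : ℕ) {a a' b : ℝ} (ha : a ∈ Set.Icc (0 : ℝ) 1)
    (ha' : a' ∈ Set.Icc (0 : ℝ) 1) (hb : b ∈ Set.Icc (0 : ℝ) 1) :
    |(mulApprox M a b - a * b) - (mulApprox M a' b - a' * b)| ≤ (1 / 2) ^ M * |a - a'| := by
  have h1 := abs_bump_error_sub_le M (half_add_mem ha hb) (half_add_mem ha' hb)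
  have h2 := abs_bump_error_sub_le M (half_abs_sub_mem ha hb) (half_abs_sub_mem ha' hb)
  rw [mulApprox_sub_mul, mulApprox_sub_mul]
  have e1 : |(a + b) / 2 - (a' + b) / 2| = |a - a'| / 2 := by
    rw [show (a + b) / 2 - (a' + b) / 2 = (a - a') / 2 by ring, abs_div,
      abs_of_pos (show (0 : ℝ) < 2 by norm_num)]
  have e2 : |(|a - b| / 2 - |a' - b| / 2)| ≤ |a - a'| / 2 := by
    rw [show |a - b| / 2 - |a' - b| / 2 = (|a - b| - |a' - b|) / 2 by ring, abs_div,
      abs_of_pos (show (0 : ℝ) < 2 by norm_num)]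
    have := abs_abs_sub_abs_le_abs_sub (a - b) (a' - b)
    rw [sub_sub_sub_cancel_right] at this
    linarith
  rw [e1] at h1
  have h3 := mul_le_mul_of_nonneg_left e2 (show (0 : ℝ) ≤ (1 / 2) ^ M by positivity)
  rw [abs_le] at h1 h2 ⊢
  constructor <;> linarith [h1.1, h1.2, h2.1, h2.2]

theorem mulApprox_comm (M : ℕ) (a b : ℝ) : mulApprox M a b = mulApprox M b a := by
  unfold mulApprox; rw [min_comm, add_comm a b, abs_sub_comm]

theorem abs_mulApprox_error_right (M : ℕ) {a b b' : ℝ} (ha : a ∈ Set.Icc (0 : ℝ) 1)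
    (hb : b ∈ Set.Icc (0 : ℝ) 1) (hb' : b' ∈ Set.Icc (0 : ℝ) 1) :
    |(mulApprox M a b - a * b) - (mulApprox M a b' - a * b')| ≤ (1 / 2) ^ M * |b - b'| := by
  rw [mulApprox_comm M a b, mulApprox_comm M a b', mul_comm a b, mul_comm a b']
  exact abs_mulApprox_error_left M hb hb' ha

theorem abs_mulApprox_sub_mul_le (M : ℕ) {a b : ℝ} (ha : a ∈ Set.Icc (0 : ℝ) 1)
    (hb : b ∈ Set.Icc (0 : ℝ) 1) : |mulApprox M a b - a * b| ≤ (1 / 2) ^ M := by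
  have h := abs_mulApprox_error_left M ha (a' := 0) ⟨le_rfl, zero_le_one⟩ hb
  rw [mulApprox_zero_left M hb.1, zero_mul, sub_zero, sub_zero, sub_zero, abs_of_nonneg ha.1] at h
  have : (1 / 2 : ℝ) ^ M * a ≤ (1 / 2) ^ M * 1 := by gcongr; exact ha.2
  linarith

/-- The ReLU approximation of the product `y 0 * ⋯ * y (n - 1)` of numbers in `[0, 1]`. -/
def prodApprox (M : ℕ) (y : ℕ → ℝ) : ℕ → ℝ
  | 0 => 1
  | n + 1 => mulApprox M (prodApprox M y n) (y n)

theorem prodApprox_mem (M : ℕ) {y : ℕ → ℝ} (hy : ∀ i, y i ∈ Set.Icc (0 : ℝ) 1) (n : ℕ) :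
    prodApprox M y n ∈ Set.Icc (0 : ℝ) 1 := by
  induction n with
  | zero => simp [prodApprox]
  | succ n ih => exact mulApprox_mem M ih (hy n)

theorem prodApprox_eq_zero (M : ℕ) {y : ℕ → ℝ} (hy : ∀ i, y i ∈ Set.Icc (0 : ℝ) 1) {n i : ℕ}
    (hi : i < n) (h0 : y i = 0) : prodApprox M y n = 0 := by
  induction n with
  | zero => omega
  | succ n ih =>
    rw [prodApprox]
    rcases Nat.lt_succ_iff_lt_or_eq.1 hi with h | rfl
    · rw [ih h, mulApprox_zero_left M (hy n).1]
    · rw [h0, mulApprox_zero_right M (prodApprox_mem M hy i).1]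

theorem prodApprox_congr (M : ℕ) {y y' : ℕ → ℝ} {n : ℕ} (h : ∀ i < n, y i = y' i) :
    prodApprox M y n = prodApprox M y' n := by
  induction n with
  | zero => rfl
  | succ n ih =>
    rw [prodApprox, prodApprox, ih fun i hi => h i (by omega), h n (by omega)]

theorem abs_prodApprox_sub_prod_le (M : ℕ) {y : ℕ → ℝ} (hy : ∀ i, y i ∈ Set.Icc (0 : ℝ) 1)
    (n : ℕ) : |prodApprox M y n - ∏ i ∈ Finset.range n, y i| ≤ n * (1 / 2) ^ M := by
  induction n with
  | zero => simp [prodApprox]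
  | succ n ih =>
    rw [prodApprox, Finset.prod_range_succ]
    have h1 := abs_mulApprox_sub_mul_le M (prodApprox_mem M hy n) (hy n)
    have h2 : |(prodApprox M y n - ∏ i ∈ Finset.range n, y i) * y n| ≤ n * (1 / 2) ^ M := by
      rw [abs_mul, abs_of_nonneg (hy n).1]
      calc _ ≤ |prodApprox M y n - ∏ i ∈ Finset.range n, y i| * 1 := by gcongr; exact (hy n).2
        _ ≤ _ := by rw [mul_one]; exact ih
    push_cast
    rw [abs_le] at h1 h2 ⊢
    constructor <;> linarith [h1.1, h1.2, h2.1, h2.2]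

theorem abs_prod_sub_prod_le {y y' : ℕ → ℝ} (hy : ∀ i, y i ∈ Set.Icc (0 : ℝ) 1) {i : ℕ}
    (h : ∀ j, j ≠ i → y j = y' j) (n : ℕ) :
    |∏ j ∈ Finset.range n, y j - ∏ j ∈ Finset.range n, y' j| ≤ |y i - y' i| := by
  by_cases hi : i ∈ Finset.range n
  · rw [← Finset.mul_prod_erase _ _ hi, ← Finset.mul_prod_erase _ _ hi,
      ← Finset.prod_congr rfl fun j hj => h j (Finset.ne_of_mem_erase hj), ← sub_mul, abs_mul]
    refine mul_le_of_le_one_right (abs_nonneg _) ?_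
    rw [abs_of_nonneg (Finset.prod_nonneg fun j _ => (hy j).1)]
    exact Finset.prod_le_one (fun j _ => (hy j).1) fun j _ => (hy j).2
  · rw [Finset.prod_congr rfl fun j hj => h j (fun e => hi (e ▸ hj)), sub_self, abs_zero]
    exact abs_nonneg _

/-- The error of `prodApprox` is Lipschitz in each variable, with a small constant. -/
theorem abs_prodApprox_error_sub_le (M : ℕ) {y y' : ℕ → ℝ} (hy : ∀ i, y i ∈ Set.Icc (0 : ℝ) 1)
    (hy' : ∀ i, y' i ∈ Set.Icc (0 : ℝ) 1) {i : ℕ} (h : ∀ j, j ≠ i → y j = y' j) (n : ℕ)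
    (hn : 2 * n * (1 / 2 : ℝ) ^ M ≤ 1) :
    |(prodApprox M y n - ∏ j ∈ Finset.range n, y j)
      - (prodApprox M y' n - ∏ j ∈ Finset.range n, y' j)|
      ≤ 2 * n * (1 / 2) ^ M * |y i - y' i| := by
  induction n with
  | zero => simp [prodApprox]
  | succ n ih =>
    set η : ℝ := (1 / 2) ^ M with hη
    have hη0 : 0 ≤ η := by positivity
    push_cast at hn ⊢
    have ih' := ih (by linarith)
    set P := prodApprox M y n with hP
    set P' := prodApprox M y' n with hP'
    set Q := ∏ j ∈ Finset.range n, y j with hQ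
    set Q' := ∏ j ∈ Finset.range n, y' j with hQ'
    have hPm : P ∈ Set.Icc (0 : ℝ) 1 := prodApprox_mem M hy n
    have hPm' : P' ∈ Set.Icc (0 : ℝ) 1 := prodApprox_mem M hy' n
    -- The exact product has slope at most 1, and by `hn` so does the error.
    have hPP : |P - P'| ≤ 2 * |y i - y' i| := by
      have h1 := abs_prod_sub_prod_le hy h n
      have h2 : 2 * n * η * |y i - y' i| ≤ 1 * |y i - y' i| := by gcongr; linarith
      have h3 : P - P' = ((P - Q) - (P' - Q')) + (Q - Q') := by ring
      rw [h3]
      exact (abs_add_le _ _).trans (by linarith)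
    rw [prodApprox, prodApprox, Finset.prod_range_succ, Finset.prod_range_succ]
    by_cases hin : i = n
    · subst hin
      have e1 : P = P' := prodApprox_congr M fun j hj => h j hj.ne
      have e2 : Q = Q' := Finset.prod_congr rfl fun j hj => h j (Finset.mem_range.1 hj).ne
      rw [← hP, ← hP', ← hQ, ← hQ', ← e1, ← e2]
      have h1 := abs_mulApprox_error_right M hPm (hy i) (hy' i)
      have h2 : |(P - Q) * (y i - y' i)| ≤ i * η * |y i - y' i| := by
        rw [abs_mul]; gcongr; exact abs_prodApprox_sub_prod_le M hy i
      have h3 : mulApprox M P (y i) - Q * y i - (mulApprox M P (y' i) - Q * y' i)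
        = (mulApprox M P (y i) - P * y i - (mulApprox M P (y' i) - P * y' i))
          + (P - Q) * (y i - y' i) := by ring
      rw [h3]
      refine (abs_add_le _ _).trans ?_
      have h4 : 0 ≤ η * |y i - y' i| := by positivity
      have h5 : 0 ≤ i * (η * |y i - y' i|) := by positivity
      nlinarith
    · have e1 : y n = y' n := h n (Ne.symm hin)
      rw [← hP, ← hP', ← hQ, ← hQ', ← e1]
      have h1 := abs_mulApprox_error_left M hPm hPm' (hy n)
      have h2 : |((P - Q) - (P' - Q')) * y n| ≤ 2 * n * η * |y i - y' i| := by
        rw [abs_mul, abs_of_nonneg (hy n).1]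
        exact (mul_le_of_le_one_right (abs_nonneg _) (hy n).2).trans ih'
      have h3 : mulApprox M P (y n) - Q * y n - (mulApprox M P' (y n) - Q' * y n)
        = (mulApprox M P (y n) - P * y n - (mulApprox M P' (y n) - P' * y n))
          + ((P - Q) - (P' - Q')) * y n := by ring
      rw [h3]
      refine (abs_add_le _ _).trans ?_
      have h4 : η * |P - P'| ≤ η * (2 * |y i - y' i|) := by gcongr
      linarith

/-! ### Hat functions -/

/-- The hat function of level `k` supported on `[s 2⁻ᵏ, (s + 1) 2⁻ᵏ]`. -/
def hat (k s : ℕ) (t : ℝ) : ℝ := max (1 - |2 ^ (k + 1) * t - 2 * s - 1|) 0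

theorem hat_mem (k s : ℕ) (t : ℝ) : hat k s t ∈ Set.Icc (0 : ℝ) 1 :=
  ⟨le_max_right _ _, max_le (by linarith [abs_nonneg (2 ^ (k + 1) * t - 2 * s - 1)]) zero_le_one⟩

theorem hat_eq_relu (k s : ℕ) (t : ℝ) : hat k s t =
    max (2 ^ (k + 1) * t - 2 * s) 0 - 2 * max (2 ^ (k + 1) * t - 2 * s - 1) 0
      + max (2 ^ (k + 1) * t - 2 * s - 2) 0 := by
  unfold hat
  generalize 2 ^ (k + 1) * t - 2 * (s : ℝ) = v
  rcases max_cases v 0 with h | h <;> rcases max_cases (v - 1) 0 with h' | h' <;>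
  rcases max_cases (v - 2) 0 with h'' | h'' <;> rcases abs_cases (v - 1) with ha | ha <;>
  rw [h.1, h'.1, h''.1, ha.1] <;>
  first
  | (rw [max_eq_left (by linarith)]; linarith)
  | (rw [max_eq_right (by linarith)]; linarith)

end

/-! ### Networks of constant width -/

/-- The states of a computation with the layers `max (A ℓ) 0`, started in `z`. -/
def run {ι : Type*} (A : ℕ → ι → (ι → ℝ) → ℝ) (z : ι → ℝ) : ℕ → ι → ℝ
  | 0 => z
  | ℓ + 1 => fun r => max (A ℓ r (run A z ℓ)) 0

theorem run_congr {ι : Type*} {A A' : ℕ → ι → (ι → ℝ) → ℝ} {n : ℕ} (h : ∀ ℓ < n, A ℓ = A' ℓ)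
    (z : ι → ℝ) : run A z n = run A' z n := by
  induction n with
  | zero => rfl
  | succ n ih => simp only [run, ih fun ℓ hℓ => h ℓ (by omega), h n (by omega)]

section Networks

variable {ι κ : Type*} [Fintype ι] [Fintype κ]

/-- `A` is an affine function of the coordinates. -/
def IsAffine (A : (ι → ℝ) → ℝ) : Prop := ∃ (w : ι → ℝ) (b : ℝ), ∀ z, A z = ∑ j, w j * z j + b

theorem isAffine_apply (j : ι) : IsAffine fun z : ι → ℝ => z j := by
  classical
  exact ⟨Pi.single j 1, 0, fun z => by simp [Pi.single_apply]⟩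

theorem isAffine_const (c : ℝ) : IsAffine fun _ : ι → ℝ => c := ⟨0, c, fun z => by simp⟩

theorem IsAffine.add {A A' : (ι → ℝ) → ℝ} (h : IsAffine A) (h' : IsAffine A') :
    IsAffine fun z => A z + A' z := by
  obtain ⟨w, b, hw⟩ := h
  obtain ⟨w', b', hw'⟩ := h'
  refine ⟨w + w', b + b', fun z => ?_⟩
  simp only [hw, hw', Pi.add_apply, add_mul, Finset.sum_add_distrib]
  ring

theorem IsAffine.const_mul {A : (ι → ℝ) → ℝ} (c : ℝ) (h : IsAffine A) :
    IsAffine fun z => c * A z := by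
  obtain ⟨w, b, hw⟩ := h
  refine ⟨fun j => c * w j, c * b, fun z => ?_⟩
  simp only [hw, mul_add, Finset.mul_sum, mul_assoc]

theorem IsAffine.sub {A A' : (ι → ℝ) → ℝ} (h : IsAffine A) (h' : IsAffine A') :
    IsAffine fun z => A z - A' z := by
  simpa [sub_eq_add_neg] using h.add (h'.const_mul (-1))

/-- A ReLU layer. -/
def IsLayer (F : (ι → ℝ) → κ → ℝ) : Prop :=
  ∃ A : κ → (ι → ℝ) → ℝ, (∀ r, IsAffine (A r)) ∧ ∀ z r, F z r = max (A r z) 0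

/-- `F` is a composition of `n` ReLU layers of the same width. -/
inductive IsLayers : ℕ → ((ι → ℝ) → ι → ℝ) → Prop
  | zero : IsLayers 0 id
  | succ {n F G} : IsLayers n F → IsLayer G → IsLayers (n + 1) (G ∘ F)

theorem IsLayers.comp {m n : ℕ} {F G : (ι → ℝ) → ι → ℝ} (hG : IsLayers n G) (hF : IsLayers m F) :
    IsLayers (m + n) (G ∘ F) := by
  induction hG with
  | zero => exact hF
  | succ _ hl ih => exact ih.succ hl

theorem IsLayer.isLayers {F : (ι → ℝ) → ι → ℝ} (h : IsLayer F) : IsLayers 1 F :=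
  IsLayers.zero.succ h

/-- The dimensions of a network with `n + 1` hidden layers of width `w`. -/
@[simps]
def constShape (d w n : ℕ) (hw : 1 ≤ w) : NetShape d where
  hidden := n + 1
  one_le_hidden := by omega
  N ℓ := if ℓ = 0 then d else if ℓ ≤ n + 1 then w else 1
  N_input := by simp
  N_output := by simp
  N_pos ℓ h1 h2 := by rw [if_neg (by omega), if_pos h2]; exact hw

theorem width_constShape_le (d w n : ℕ) (hw : 1 ≤ w) (hd : d ≤ w) :
    (constShape d w n hw).width ≤ w := by
  refine Finset.sup_le fun ℓ _ => ?_
  simp only [constShape_N]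
  split_ifs <;> omega

/-- Replaces the inductive composition by a family of affine maps indexed by the layer, from which
weight matrices can be read off. -/
theorem IsLayers.exists_run {n : ℕ} {F : (ι → ℝ) → ι → ℝ} (h : IsLayers n F) :
    ∃ A : ℕ → ι → (ι → ℝ) → ℝ, (∀ ℓ r, IsAffine (A ℓ r)) ∧ ∀ z, F z = run A z n := by
  induction h with
  | zero => exact ⟨fun _ _ _ => 0, fun _ _ => isAffine_const 0, fun z => rfl⟩
  | @succ n F G _ hG ih =>
    obtain ⟨A, hA, hF⟩ := ih
    obtain ⟨B, hB, hG⟩ := hG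
    refine ⟨fun ℓ => if ℓ < n then A ℓ else B, fun ℓ r => ?_, fun z => ?_⟩
    · dsimp only
      split_ifs
      exacts [hA ℓ r, hB r]
    · funext r
      rw [Function.comp_apply, hG, hF, run, if_neg (lt_irrefl n)]
      rw [run_congr fun ℓ hℓ => (if_pos hℓ).symm]

theorem sum_fin_equiv {m w : ℕ} (h : m = w) (e : ι ≃ Fin w) (g : Fin m → ℝ) :
    ∑ j, g j = ∑ r, g (Fin.cast h.symm (e r)) := by
  subst h
  exact (Fintype.sum_equiv e _ _ fun r => rfl).symm

/-- A composition of ReLU layers of the same width is realized by a network whose dimensions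
depend on the width and on the number of layers only. -/
theorem exists_net {d w n : ℕ} (hw : 1 ≤ w) (e : ι ≃ Fin w) {F₀ : (Fin d → ℝ) → ι → ℝ}
    (h₀ : IsLayer F₀) {F : (ι → ℝ) → ι → ℝ} (hF : IsLayers n F) {A : (ι → ℝ) → ℝ}
    (hA : IsAffine A) :
    ∃ Φ : Net (constShape d w n hw), ∀ x, Φ.output x = A (F (F₀ x)) := by
  obtain ⟨C, hC, hF⟩ := hF.exists_run
  obtain ⟨A₀, hA₀, h₀⟩ := h₀
  choose w₀ b₀ h₀' using hA₀
  choose wC bC hC' using hC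
  obtain ⟨v, c, hA⟩ := hA
  -- The dimensions of `constShape` are case distinctions on ℓ, so they equal `w` only
  -- propositionally. Range tests on the indices replace casts; in the layers used below they
  -- succeed.
  let Φ : Net (constShape d w n hw) :=
    { W := fun ℓ i j => if ℓ = 0 then
          (if hi : i.1 < w then if hj : j.1 < d then w₀ (e.symm ⟨i, hi⟩) ⟨j, hj⟩ else 0 else 0)
        else if ℓ ≤ n then
          (if hi : i.1 < w then if hj : j.1 < w then wC (ℓ - 1) (e.symm ⟨i, hi⟩) (e.symm ⟨j, hj⟩)
            else 0 else 0)
        else if hj : j.1 < w then v (e.symm ⟨j, hj⟩) else 0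
      b := fun ℓ i => if ℓ = 0 then (if hi : i.1 < w then b₀ (e.symm ⟨i, hi⟩) else 0)
        else if ℓ ≤ n then (if hi : i.1 < w then bC (ℓ - 1) (e.symm ⟨i, hi⟩) else 0) else c }
  have hN : ∀ ℓ ≤ n, (constShape d w n hw).N (ℓ + 1) = w := fun ℓ hℓ => by
    simp only [constShape_N]
    rw [if_neg (by omega), if_pos (by omega)]
  have key : ∀ x, ∀ ℓ ≤ n, ∀ (i : Fin ((constShape d w n hw).N (ℓ + 1))) (hi : i.1 < w),
      Φ.layer x (ℓ + 1) i = run C (F₀ x) ℓ (e.symm ⟨i, hi⟩) := by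
    intro x ℓ
    induction ℓ with
    | zero =>
      intro _ i hi
      rw [Net.layer, run, h₀, h₀']
      simp only [Matrix.mulVec, dotProduct]
      rw [sum_fin_equiv (constShape d w n hw).N_input (Equiv.refl (Fin d))]
      simp only [Φ, if_true, dif_pos hi]
      refine congrArg₂ (fun a b : ℝ => max (a + b) 0) (Finset.sum_congr rfl fun j _ => ?_) rfl
      exact congrArg₂ (· * ·) (dif_pos j.2) rfl
    | succ ℓ ih =>
      intro hℓ i hi
      rw [Net.layer, run]
      dsimp only
      rw [hC']
      congr 1
      simp only [Matrix.mulVec, dotProduct]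
      rw [sum_fin_equiv (hN ℓ (by omega)) e]
      simp only [Φ, dif_pos hi, Nat.succ_ne_zero, if_false, if_pos hℓ, Fin.val_cast,
        Fin.is_lt, dif_pos, Nat.add_sub_cancel, Fin.eta, Equiv.symm_apply_apply]
      congr 1
      refine Finset.sum_congr rfl fun r _ => ?_
      have := ih (by omega) (Fin.cast (hN ℓ (by omega)).symm (e r)) (e r).2
      simp only [Φ] at this
      rw [this]
      simp only [Fin.val_cast, Fin.eta, Equiv.symm_apply_apply]
  refine ⟨Φ, fun x => ?_⟩
  rw [hA, hF]
  change ∑ j, Φ.W (n + 1) _ j * Φ.layer x (n + 1) j + Φ.b (n + 1) _ = _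
  rw [sum_fin_equiv (hN n le_rfl) e]
  have hb : ∀ i, Φ.b (n + 1) i = c := fun i => by
    simp only [Φ]; rw [if_neg (by omega), if_neg (by omega)]
  refine congrArg₂ (· + ·) (Finset.sum_congr rfl fun r _ => ?_) (hb _)
  rw [key x n le_rfl (Fin.cast (hN n le_rfl).symm (e r)) (e r).2]
  simp only [Φ]
  rw [if_neg (by omega), if_neg (by omega), dif_pos (by simp)]
  simp only [Fin.val_cast, Fin.eta, Equiv.symm_apply_apply]

end Networks

/-! ### A network that sums up approximate tensor products of hat functions -/

/-- The registers of the computation, in addition to those that hold the input. -/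
inductive Reg
  | accp | accm | val | p1 | q1 | p2 | q2 | h0 | h1 | h2 | fac | dif
  deriving DecidableEq

instance : Fintype Reg where
  elems := {.accp, .accm, .val, .p1, .q1, .p2, .q2, .h0, .h1, .h2, .fac, .dif}
  complete r := by cases r <;> simp

section Program

open Reg

variable {d : ℕ}

/-- The state `z` holds the input `x`, the partial sums `a`, `b` of the positive and negative
contributions, and the current value `P`. -/
structure Holds (x : Fin d → ℝ) (a b P : ℝ) (z : Fin d ⊕ Reg → ℝ) : Prop where
  input : ∀ i, z (.inl i) = x i
  accp : z (.inr accp) = a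
  accm : z (.inr accm) = b
  val : z (.inr val) = P

/-- The layer that keeps the input and updates the registers by `U`. -/
noncomputable def keepLayer (U : (Fin d ⊕ Reg → ℝ) → Reg → ℝ) (z : Fin d ⊕ Reg → ℝ) :
    Fin d ⊕ Reg → ℝ :=
  Sum.elim (fun i => max (z (.inl i)) 0) fun r => max (U z r) 0

theorem isLayer_keepLayer {U : (Fin d ⊕ Reg → ℝ) → Reg → ℝ}
    (hU : ∀ r, IsAffine fun z => U z r) : IsLayer (keepLayer U) := by
  refine ⟨Sum.elim (fun i z => z (.inl i)) fun r z => U z r, ?_, ?_⟩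
  · rintro (i | r)
    exacts [isAffine_apply _, hU r]
  · rintro z (i | r) <;> rfl

/-- The ReLU units of a hat function. -/
noncomputable def hatUpdate (k s : ℕ) (i : Fin d) (z : Fin d ⊕ Reg → ℝ) : Reg → ℝ
  | accp => z (.inr accp)
  | accm => z (.inr accm)
  | val => z (.inr val)
  | h0 => 2 ^ (k + 1) * z (.inl i) - 2 * s
  | h1 => 2 ^ (k + 1) * z (.inl i) - 2 * s - 1
  | h2 => 2 ^ (k + 1) * z (.inl i) - 2 * s - 2
  | _ => 0

/-- The hat function and the positive part of its difference to the current value. -/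
noncomputable def factorUpdate (z : Fin d ⊕ Reg → ℝ) : Reg → ℝ
  | accp => z (.inr accp)
  | accm => z (.inr accm)
  | val => z (.inr val)
  | fac => z (.inr h0) - 2 * z (.inr h1) + z (.inr h2)
  | dif => z (.inr val) - (z (.inr h0) - 2 * z (.inr h1) + z (.inr h2))
  | _ => 0

/-- The initialization of the approximate multiplication. -/
noncomputable def mulUpdate (z : Fin d ⊕ Reg → ℝ) : Reg → ℝ
  | accp => z (.inr accp)
  | accm => z (.inr accm)
  | val => z (.inr val) - z (.inr dif)
  | p1 => 1 / 2 * (z (.inr val) + z (.inr fac))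
  | q1 => 1 / 2 * (z (.inr val) + z (.inr fac)) - 1 / 2
  | p2 => z (.inr dif) - 1 / 2 * (z (.inr val) - z (.inr fac))
  | q2 => z (.inr dif) - 1 / 2 * (z (.inr val) - z (.inr fac)) - 1 / 2
  | _ => 0

/-- One iteration of the approximate multiplication. -/
noncomputable def tentUpdate (j : ℕ) (z : Fin d ⊕ Reg → ℝ) : Reg → ℝ
  | accp => z (.inr accp)
  | accm => z (.inr accm)
  | val => z (.inr val) - 1 / 4 ^ (j + 1) * (2 * z (.inr p1) - 4 * z (.inr q1))
      + 1 / 4 ^ (j + 1) * (2 * z (.inr p2) - 4 * z (.inr q2))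
  | p1 => 2 * z (.inr p1) - 4 * z (.inr q1)
  | q1 => 2 * z (.inr p1) - 4 * z (.inr q1) - 1 / 2
  | p2 => 2 * z (.inr p2) - 4 * z (.inr q2)
  | q2 => 2 * z (.inr p2) - 4 * z (.inr q2) - 1 / 2
  | _ => 0

/-- The current value is added to the sum, with the factor `c`. -/
noncomputable def accUpdate (c : ℝ) (z : Fin d ⊕ Reg → ℝ) : Reg → ℝ
  | accp => z (.inr accp) + max c 0 * z (.inr val)
  | accm => z (.inr accm) + max (-c) 0 * z (.inr val)
  | val => 1
  | _ => 0

theorem isLayer_hatUpdate (k s : ℕ) (i : Fin d) : IsLayer (keepLayer (hatUpdate k s i)) := by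
  refine isLayer_keepLayer fun r => ?_
  cases r <;> simp only [hatUpdate] <;>
  repeat' (first | exact isAffine_apply _ | exact isAffine_const _ | apply IsAffine.sub |
    apply IsAffine.add | apply IsAffine.const_mul)

theorem isLayer_factorUpdate : IsLayer (keepLayer (factorUpdate (d := d))) := by
  refine isLayer_keepLayer fun r => ?_
  cases r <;> simp only [factorUpdate] <;>
  repeat' (first | exact isAffine_apply _ | exact isAffine_const _ | apply IsAffine.sub |
    apply IsAffine.add | apply IsAffine.const_mul)

theorem isLayer_mulUpdate : IsLayer (keepLayer (mulUpdate (d := d))) := by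
  refine isLayer_keepLayer fun r => ?_
  cases r <;> simp only [mulUpdate] <;>
  repeat' (first | exact isAffine_apply _ | exact isAffine_const _ | apply IsAffine.sub |
    apply IsAffine.add | apply IsAffine.const_mul)

theorem isLayer_tentUpdate (j : ℕ) : IsLayer (keepLayer (tentUpdate (d := d) j)) := by
  refine isLayer_keepLayer fun r => ?_
  cases r <;> simp only [tentUpdate] <;>
  repeat' (first | exact isAffine_apply _ | exact isAffine_const _ | apply IsAffine.sub |
    apply IsAffine.add | apply IsAffine.const_mul)

theorem isLayer_accUpdate (c : ℝ) : IsLayer (keepLayer (accUpdate (d := d) c)) := by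
  refine isLayer_keepLayer fun r => ?_
  cases r <;> simp only [accUpdate] <;>
  repeat' (first | exact isAffine_apply _ | exact isAffine_const _ | apply IsAffine.sub |
    apply IsAffine.add | apply IsAffine.const_mul)

/-- Invariant: `q` holds max(p - 1/2, 0), so the next tent iterate 2p - 4q is affine in the
registers. All stored values are nonnegative, hence the ReLU does not alter them. -/
theorem exists_layers_tent (M : ℕ) : ∃ F : (Fin d ⊕ Reg → ℝ) → Fin d ⊕ Reg → ℝ, IsLayers M F ∧
    ∀ (x : Fin d → ℝ) (a b P y : ℝ) (z : Fin d ⊕ Reg → ℝ), 0 ≤ x → 0 ≤ a → 0 ≤ b →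
      P ∈ Set.Icc (0 : ℝ) 1 → y ∈ Set.Icc (0 : ℝ) 1 → Holds x a b (min P y) z →
      z (.inr p1) = (P + y) / 2 → z (.inr q1) = max ((P + y) / 2 - 1 / 2) 0 →
      z (.inr p2) = |P - y| / 2 → z (.inr q2) = max (|P - y| / 2 - 1 / 2) 0 →
      Holds x a b (mulApprox M P y) (F z) ∧
      F z (.inr p1) = tent^[M] ((P + y) / 2) ∧
      F z (.inr q1) = max (tent^[M] ((P + y) / 2) - 1 / 2) 0 ∧
      F z (.inr p2) = tent^[M] (|P - y| / 2) ∧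
      F z (.inr q2) = max (tent^[M] (|P - y| / 2) - 1 / 2) 0 := by
  induction M with
  | zero =>
    refine ⟨id, .zero, fun x a b P y z _ _ _ _ _ hz h1 h2 h3 h4 => ⟨?_, h1, h2, h3, h4⟩⟩
    simpa [mulApprox, bump] using hz
  | succ M ih =>
    obtain ⟨F, hF, h⟩ := ih
    refine ⟨keepLayer (tentUpdate M) ∘ F, hF.succ (isLayer_tentUpdate M),
      fun x a b P y z hx ha hb hP hy hz h1 h2 h3 h4 => ?_⟩
    obtain ⟨⟨hi, hp, hm, hv⟩, e1, e2, e3, e4⟩ := h x a b P y z hx ha hb hP hy hz h1 h2 h3 h4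
    have t1 : 2 * F z (.inr p1) - 4 * F z (.inr q1) = tent^[M + 1] ((P + y) / 2) := by
      rw [e1, e2, Function.iterate_succ_apply', tent]
    have t2 : 2 * F z (.inr p2) - 4 * F z (.inr q2) = tent^[M + 1] (|P - y| / 2) := by
      rw [e3, e4, Function.iterate_succ_apply', tent]
    have m1 := tent_iterate_mem (M + 1) (half_add_mem hP hy)
    have m2 := tent_iterate_mem (M + 1) (half_abs_sub_mem hP hy)
    have m3 := mulApprox_mem (M + 1) hP hy
    refine ⟨⟨fun i => ?_, ?_, ?_, ?_⟩, ?_, ?_, ?_, ?_⟩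
    · simp only [Function.comp_apply, keepLayer, Sum.elim_inl, hi, max_eq_left (show 0 ≤ x i from hx i)]
    · simp only [Function.comp_apply, keepLayer, Sum.elim_inr, tentUpdate, hp, max_eq_left ha]
    · simp only [Function.comp_apply, keepLayer, Sum.elim_inr, tentUpdate, hm, max_eq_left hb]
    · simp only [Function.comp_apply, keepLayer, Sum.elim_inr, tentUpdate, t1, t2, hv]
      rw [← max_eq_left m3.1, mulApprox_succ]
      congr 1
      ring
    · simp only [Function.comp_apply, keepLayer, Sum.elim_inr, tentUpdate, t1, max_eq_left m1.1]
    · simp only [Function.comp_apply, keepLayer, Sum.elim_inr, tentUpdate, t1]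
    · simp only [Function.comp_apply, keepLayer, Sum.elim_inr, tentUpdate, t2, max_eq_left m2.1]
    · simp only [Function.comp_apply, keepLayer, Sum.elim_inr, tentUpdate, t2]

/-- The current value is multiplied by a hat function of one of the inputs. -/
theorem exists_layers_factor (M k s : ℕ) (i : Fin d) :
    ∃ F : (Fin d ⊕ Reg → ℝ) → Fin d ⊕ Reg → ℝ, IsLayers (M + 3) F ∧
    ∀ (x : Fin d → ℝ) (a b P : ℝ) (z : Fin d ⊕ Reg → ℝ), 0 ≤ x → 0 ≤ a → 0 ≤ b →
      P ∈ Set.Icc (0 : ℝ) 1 → Holds x a b P z →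
      Holds x a b (mulApprox M P (hat k s (x i))) (F z) := by
  obtain ⟨F, hF, h⟩ := exists_layers_tent (d := d) M
  refine ⟨F ∘ keepLayer mulUpdate ∘ keepLayer factorUpdate ∘ keepLayer (hatUpdate k s i), ?_,
    fun x a b P z hx ha hb hP hz => ?_⟩
  · rw [add_comm]
    exact hF.comp (((isLayer_hatUpdate k s i).isLayers.succ isLayer_factorUpdate).succ
      isLayer_mulUpdate)
  · obtain ⟨hi, hp, hm, hv⟩ := hz
    have hy := hat_mem k s (x i)
    set y := hat k s (x i) with hyd
    have hfac : max (2 ^ (k + 1) * x i - 2 * s) 0 - 2 * max (2 ^ (k + 1) * x i - 2 * s - 1) 0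
      + max (2 ^ (k + 1) * x i - 2 * s - 2) 0 = y := (hat_eq_relu k s (x i)).symm
    -- The register `dif` holds max(P - y, 0); given it, both the minimum and the absolute value
    -- below are affine.
    have hmin : P - max (P - y) 0 = min P y := by
      rcases le_total P y with h | h
      · rw [max_eq_right (by linarith), min_eq_left h, sub_zero]
      · rw [max_eq_left (by linarith), min_eq_right h]; ring
    have habs : max (P - y) 0 - 1 / 2 * (P - y) = |P - y| / 2 := by
      rcases le_total P y with h | h
      · rw [max_eq_right (by linarith), abs_of_nonpos (by linarith)]; ring
      · rw [max_eq_left (by linarith), abs_of_nonneg (by linarith)]; ring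
    have hhalf : 1 / 2 * (P + y) = (P + y) / 2 := by ring
    have m1 := half_add_mem hP hy
    have m2 := half_abs_sub_mem hP hy
    refine (h x a b P y _ hx ha hb hP hy ⟨fun j => ?_, ?_, ?_, ?_⟩ ?_ ?_ ?_ ?_).1
    · simp only [Function.comp_apply, keepLayer, Sum.elim_inl, hi, max_eq_left (show 0 ≤ x j from hx j)]
    · simp only [Function.comp_apply, keepLayer, Sum.elim_inr, mulUpdate, factorUpdate, hatUpdate,
        hp, max_eq_left ha]
    · simp only [Function.comp_apply, keepLayer, Sum.elim_inr, mulUpdate, factorUpdate, hatUpdate,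
        hm, max_eq_left hb]
    all_goals
      simp only [Function.comp_apply, keepLayer, Sum.elim_inr, mulUpdate, factorUpdate,
        hatUpdate, hv, hi, hfac, max_eq_left hP.1, max_eq_left hy.1, hmin, habs, hhalf,
        max_eq_left m1.1, max_eq_left m2.1, max_eq_left (le_min hP.1 hy.1)]

/-- The values of the hat functions of level `k` and position `s` at `x`, extended by one. -/
noncomputable def hatSeq (k s : Fin d → ℕ) (x : Fin d → ℝ) (j : ℕ) : ℝ :=
  if h : j < d then hat (k ⟨j, h⟩) (s ⟨j, h⟩) (x ⟨j, h⟩) else 1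

theorem hatSeq_mem (k s : Fin d → ℕ) (x : Fin d → ℝ) (j : ℕ) :
    hatSeq k s x j ∈ Set.Icc (0 : ℝ) 1 := by
  unfold hatSeq
  split_ifs
  exacts [hat_mem _ _ _, ⟨zero_le_one, le_rfl⟩]

theorem exists_layers_prod (M : ℕ) (k s : Fin d → ℕ) {n : ℕ} (hn : n ≤ d) :
    ∃ F : (Fin d ⊕ Reg → ℝ) → Fin d ⊕ Reg → ℝ, IsLayers (n * (M + 3)) F ∧
    ∀ (x : Fin d → ℝ) (a b : ℝ) (z : Fin d ⊕ Reg → ℝ), 0 ≤ x → 0 ≤ a → 0 ≤ b →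
      Holds x a b 1 z → Holds x a b (prodApprox M (hatSeq k s x) n) (F z) := by
  induction n with
  | zero => exact ⟨id, by simpa using IsLayers.zero, fun x a b z _ _ _ hz => hz⟩
  | succ n ih =>
    obtain ⟨F, hF, h⟩ := ih (by omega)
    obtain ⟨G, hG, h'⟩ := exists_layers_factor M (k ⟨n, hn⟩) (s ⟨n, hn⟩) (⟨n, hn⟩ : Fin d)
    refine ⟨G ∘ F, by rw [add_mul, one_mul]; exact hG.comp hF, fun x a b z hx ha hb hz => ?_⟩
    have := h' x a b _ _ hx ha hb (prodApprox_mem M (hatSeq_mem k s x) n) (h x a b z hx ha hb hz)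
    rw [prodApprox, hatSeq, dif_pos (show n < d from hn)]
    exact this

/-- One more term is added to the sum. -/
theorem exists_layers_term (M : ℕ) (k s : Fin d → ℕ) (c : ℝ) :
    ∃ F : (Fin d ⊕ Reg → ℝ) → Fin d ⊕ Reg → ℝ, IsLayers (d * (M + 3) + 1) F ∧
    ∀ (x : Fin d → ℝ) (a b : ℝ) (z : Fin d ⊕ Reg → ℝ), 0 ≤ x → 0 ≤ a → 0 ≤ b →
      Holds x a b 1 z → Holds x (a + max c 0 * prodApprox M (hatSeq k s x) d)
        (b + max (-c) 0 * prodApprox M (hatSeq k s x) d) 1 (F z) := by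
  obtain ⟨F, hF, h⟩ := exists_layers_prod M k s le_rfl
  refine ⟨keepLayer (accUpdate c) ∘ F, hF.succ (isLayer_accUpdate c),
    fun x a b z hx ha hb hz => ?_⟩
  obtain ⟨hi, hp, hm, hv⟩ := h x a b z hx ha hb hz
  have hP := (prodApprox_mem M (hatSeq_mem k s x) d).1
  refine ⟨fun i => ?_, ?_, ?_, ?_⟩
  · simp only [Function.comp_apply, keepLayer, Sum.elim_inl, hi, max_eq_left (show 0 ≤ x i from hx i)]
  · simp only [Function.comp_apply, keepLayer, Sum.elim_inr, accUpdate, hp, hv]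
    exact max_eq_left (by positivity)
  · simp only [Function.comp_apply, keepLayer, Sum.elim_inr, accUpdate, hm, hv]
    exact max_eq_left (by positivity)
  · simp only [Function.comp_apply, keepLayer, Sum.elim_inr, accUpdate]
    exact max_eq_left zero_le_one

/-- A ReLU register cannot hold a negative number. Terms with positive and negative coefficients are
therefore accumulated separately, and only the difference a' - b' matters. -/
theorem exists_layers_sum (M : ℕ) (c : (Fin d → ℕ) × (Fin d → ℕ) → ℝ)
    (l : List ((Fin d → ℕ) × (Fin d → ℕ))) :
    ∃ F : (Fin d ⊕ Reg → ℝ) → Fin d ⊕ Reg → ℝ, IsLayers (l.length * (d * (M + 3) + 1)) F ∧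
    ∀ (x : Fin d → ℝ) (a b : ℝ) (z : Fin d ⊕ Reg → ℝ), 0 ≤ x → 0 ≤ a → 0 ≤ b → Holds x a b 1 z →
      ∃ a' b', Holds x a' b' 1 (F z) ∧
        a' - b' = a - b + (l.map fun t => c t * prodApprox M (hatSeq t.1 t.2 x) d).sum := by
  induction l with
  | nil =>
    exact ⟨id, by simpa using IsLayers.zero, fun x a b z _ _ _ hz => ⟨a, b, hz, by simp⟩⟩
  | cons t l ih =>
    obtain ⟨G, hG, h'⟩ := ih
    obtain ⟨F, hF, h⟩ := exists_layers_term M t.1 t.2 (c t)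
    refine ⟨G ∘ F, ?_, fun x a b z hx ha hb hz => ?_⟩
    · rw [List.length_cons, add_mul, one_mul, add_comm]
      exact hG.comp hF
    · have hP := (prodApprox_mem M (hatSeq_mem t.1 t.2 x) d).1
      obtain ⟨a', b', hz', e⟩ := h' x _ _ _ hx (by positivity) (by positivity)
        (h x a b z hx ha hb hz)
      refine ⟨a', b', hz', ?_⟩
      rw [e, List.map_cons, List.sum_cons]
      have : c t = max (c t) 0 - max (-c t) 0 := by
        rcases le_total 0 (c t) with h | h
        · rw [max_eq_left h, max_eq_right (by linarith), sub_zero]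
        · rw [max_eq_right h, max_eq_left (by linarith)]; ring
      linear_combination (-prodApprox M (hatSeq t.1 t.2 x) d) * this

/-- The start layer. -/
noncomputable def startLayer (x : Fin d → ℝ) : Fin d ⊕ Reg → ℝ :=
  Sum.elim (fun i => max (x i) 0) fun r => max (if r = val then 1 else 0) 0

theorem isLayer_startLayer : IsLayer (startLayer (d := d)) := by
  refine ⟨Sum.elim (fun i x => x i) fun r _ => if r = val then 1 else 0, ?_, ?_⟩
  · rintro (i | r)
    exacts [isAffine_apply _, isAffine_const _]
  · rintro z (i | r) <;> rfl

theorem holds_startLayer {x : Fin d → ℝ} (hx : 0 ≤ x) : Holds x 0 0 1 (startLayer x) := by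
  refine ⟨fun i => ?_, ?_, ?_, ?_⟩
  · simp only [startLayer, Sum.elim_inl, max_eq_left (show 0 ≤ x i from hx i)]
  all_goals simp [startLayer]

theorem card_register : Fintype.card (Fin d ⊕ Reg) = d + 12 := by
  rw [Fintype.card_sum, Fintype.card_fin]; rfl

/-- Sums of approximate tensor products of hat functions are realized by networks of width
`d + 12`, whose dimensions do not depend on the coefficients. -/
theorem exists_net_sum (M : ℕ) (T : Finset ((Fin d → ℕ) × (Fin d → ℕ)))
    (c : (Fin d → ℕ) × (Fin d → ℕ) → ℝ) :
    ∃ Φ : Net (constShape d (d + 12) (T.card * (d * (M + 3) + 1)) (by omega)),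
      ∀ x, 0 ≤ x → Φ.output x = ∑ t ∈ T, c t * prodApprox M (hatSeq t.1 t.2 x) d := by
  obtain ⟨F, hF, h⟩ := exists_layers_sum M c T.toList
  rw [Finset.length_toList] at hF
  obtain ⟨Φ, hΦ⟩ := exists_net (w := d + 12) (by omega) (Fintype.equivFinOfCardEq card_register)
    isLayer_startLayer hF ((isAffine_apply (.inr accp)).sub (isAffine_apply (.inr accm)))
  refine ⟨Φ, fun x hx => ?_⟩
  obtain ⟨a, b, hz, e⟩ := h x 0 0 _ hx le_rfl le_rfl (holds_startLayer hx)
  rw [hΦ, hz.accp, hz.accm, e, Finset.sum_map_toList]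
  ring

end Program

noncomputable section

/-! ### Hat functions of one level -/

theorem of_hat_ne_zero {k s : ℕ} {t : ℝ} (h : hat k s t ≠ 0) :
    (s : ℝ) < 2 ^ k * t ∧ 2 ^ k * t < s + 1 := by
  unfold hat at h
  have h' : ¬ (1 - |2 ^ (k + 1) * t - 2 * s - 1| ≤ 0) := fun h' => h (max_eq_right h')
  have h2 : |2 ^ (k + 1) * t - 2 * s - 1| < 1 := by linarith
  rw [abs_lt, pow_succ] at h2
  constructor <;> linarith [h2.1, h2.2]

theorem eq_floor_of_hat_ne_zero {k s : ℕ} {t : ℝ} (h : hat k s t ≠ 0) : s = ⌊2 ^ k * t⌋₊ := by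
  obtain ⟨h1, h2⟩ := of_hat_ne_zero h
  exact ((Nat.floor_eq_iff (by linarith [show (0 : ℝ) ≤ s from s.cast_nonneg])).2
    ⟨h1.le, h2⟩).symm

theorem hat_eq_zero_of_ne_floor {k s : ℕ} {t : ℝ} (h : s ≠ ⌊2 ^ k * t⌋₊) : hat k s t = 0 := by
  by_contra h'
  exact h (eq_floor_of_hat_ne_zero h')

theorem hat_eq_zero {k s : ℕ} {t : ℝ} (hs : s < 2 ^ k) (ht : t ≤ 0 ∨ 1 ≤ t) : hat k s t = 0 := by
  by_contra h
  obtain ⟨h1, h2⟩ := of_hat_ne_zero h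
  have hs' : (s : ℝ) + 1 ≤ 2 ^ k := by exact_mod_cast hs
  have h0 : (0 : ℝ) ≤ s := s.cast_nonneg
  have hk : (0 : ℝ) < 2 ^ k := by positivity
  rcases ht with ht | ht <;> nlinarith

theorem sum_hat_mem (k : ℕ) (t : ℝ) :
    ∑ s ∈ Finset.range (2 ^ k), hat k s t ∈ Set.Icc (0 : ℝ) 1 := by
  refine ⟨Finset.sum_nonneg fun s _ => (hat_mem k s t).1, ?_⟩
  by_cases h : ⌊2 ^ k * t⌋₊ ∈ Finset.range (2 ^ k)
  · rw [Finset.sum_eq_single_of_mem _ h fun s _ hs => hat_eq_zero_of_ne_floor hs]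
    exact (hat_mem _ _ _).2
  · rw [Finset.sum_eq_zero fun s hs => hat_eq_zero_of_ne_floor fun e => h (e ▸ hs)]
    exact zero_le_one

/-- A hat has slope 2^(k+1) on its support, so its change is at most this slope times the length of
the part of [a, b] inside the support. Writing that length through min(t, s/2^k) makes the sum over
s telescope. -/
theorem abs_hat_sub_le_clip (k s : ℕ) {a b : ℝ} (hab : a ≤ b) :
    |hat k s a - hat k s b| ≤ 2 ^ (k + 1) *
      ((min b ((s + 1 : ℕ) / 2 ^ k) - min b (s / 2 ^ k))
        - (min a ((s + 1 : ℕ) / 2 ^ k) - min a (s / 2 ^ k))) := by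
  have hk : (0 : ℝ) < 2 ^ k := by positivity
  have e : ∀ (t : ℝ) (m : ℕ), 2 ^ (k + 1) * min t (m / 2 ^ k) = min (2 ^ (k + 1) * t) (2 * m) := by
    intro t m
    rw [mul_min_of_nonneg _ _ (by positivity)]
    congr 1
    rw [pow_succ]; field_simp
  rw [mul_sub, mul_sub, mul_sub, e, e, e, e]
  have hab' : (2 : ℝ) ^ (k + 1) * a ≤ 2 ^ (k + 1) * b := by gcongr
  unfold hat
  generalize (2 : ℝ) ^ (k + 1) * a = u at *
  generalize (2 : ℝ) ^ (k + 1) * b = v at *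
  push_cast
  generalize (s : ℝ) = m at *
  rcases abs_cases (u - 2 * m - 1) with h1 | h1 <;> rcases abs_cases (v - 2 * m - 1) with h2 | h2 <;>
  rcases max_cases (1 - |u - 2 * m - 1|) 0 with h3 | h3 <;>
  rcases max_cases (1 - |v - 2 * m - 1|) 0 with h4 | h4 <;>
  rcases min_cases u (2 * m) with h5 | h5 <;> rcases min_cases v (2 * m) with h6 | h6 <;>
  rcases min_cases u (2 * (m + 1)) with h7 | h7 <;>
  rcases min_cases v (2 * (m + 1)) with h8 | h8 <;>
  first
  | (exfalso; linarith)
  | (rw [h3.1, h4.1, h5.1, h6.1, h7.1, h8.1, abs_le]; constructor <;> linarith)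

/-- The clipped lengths telescope over s, so the whole level obeys the bound of a single hat,
without a factor 2^k. -/
theorem sum_abs_hat_sub_le (k : ℕ) (a b : ℝ) :
    ∑ s ∈ Finset.range (2 ^ k), |hat k s a - hat k s b| ≤ 2 ^ (k + 1) * |a - b| := by
  wlog hab : a ≤ b generalizing a b
  · have := this b a (le_of_not_ge hab)
    simp only [abs_sub_comm (hat k _ a), abs_sub_comm a b]
    exact this
  refine (Finset.sum_le_sum fun s _ => abs_hat_sub_le_clip k s hab).trans ?_
  rw [← Finset.mul_sum, Finset.sum_sub_distrib,
    Finset.sum_range_sub (fun s : ℕ => min b (s / 2 ^ k : ℝ)),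
    Finset.sum_range_sub (fun s : ℕ => min a (s / 2 ^ k : ℝ))]
  gcongr
  push_cast
  rw [div_self (by positivity), zero_div, abs_sub_comm, abs_of_nonneg (by linarith)]
  rcases min_cases b 1 with h1 | h1 <;> rcases min_cases b 0 with h2 | h2 <;>
  rcases min_cases a 1 with h3 | h3 <;> rcases min_cases a 0 with h4 | h4 <;> linarith

/-! ### Formal combinations of point evaluations -/

/-- The point evaluation at `t`. -/
def pt (t : ℝ) : Π₀ _ : ℝ, ℝ := DFinsupp.single t 1

variable {d : ℕ}

/-- The application of a tensor product of combinations of point evaluations to `f`. -/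
def ev (f : (Fin d → ℝ) → ℝ) : MultilinearMap ℝ (fun _ : Fin d => Π₀ _ : ℝ, ℝ) ℝ :=
  MultilinearMap.fromDFinsuppEquiv (fun _ : Fin d => ℝ) ℝ
    (fun p => f p • MultilinearMap.mkPiAlgebra ℝ (Fin d) ℝ)

theorem ev_pt (f : (Fin d → ℝ) → ℝ) (p : Fin d → ℝ) : ev f (fun i => pt (p i)) = f p := by
  simp only [ev, pt]
  rw [MultilinearMap.fromDFinsuppEquiv_single]
  simp

/-- One factor carried by S, where f vanishes, annihilates the whole tensor product. -/
theorem ev_eq_zero {f : (Fin d → ℝ) → ℝ} {a : Fin d → Π₀ _ : ℝ, ℝ} (i : Fin d) {S : Set ℝ}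
    (hf : ∀ p, p i ∈ S → f p = 0) (ha : ∀ t, t ∉ S → a i t = 0) : ev f a = 0 := by
  classical
  rw [ev, MultilinearMap.fromDFinsuppEquiv_apply]
  refine Finset.sum_eq_zero fun p _ => ?_
  by_cases hp : p i ∈ S
  · simp [hf p hp]
  · have : ∏ j, a j (p j) = 0 :=
      Finset.prod_eq_zero (f := fun j => a j (p j)) (Finset.mem_univ i) (ha _ hp)
    simp [this]

/-- The second difference with step `h`, as a combination of point evaluations. -/
def diffPt (h t : ℝ) : Π₀ _ : ℝ, ℝ := pt (t + 2 * h) - (2 : ℝ) • pt (t + h) + pt t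

theorem ev_update_diffPt (f : (Fin d → ℝ) → ℝ) (a : Fin d → Π₀ _ : ℝ, ℝ) (i : Fin d) (h t : ℝ) :
    ev f (Function.update a i (diffPt h t)) = ev f (Function.update a i (pt (t + 2 * h)))
      - 2 * ev f (Function.update a i (pt (t + h))) + ev f (Function.update a i (pt t)) := by
  rw [diffPt, MultilinearMap.map_update_add, MultilinearMap.map_update_sub,
    MultilinearMap.map_update_smul, smul_eq_mul]

theorem mixedDiff_insert {u : Finset (Fin d)} {i : Fin d} (hi : i ∉ u) (h : Fin d → ℝ)
    (f : (Fin d → ℝ) → ℝ) (x : Fin d → ℝ) :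
    mixedDiff (insert i u) h f x = mixedDiff u h f (x + Pi.single i (2 * h i))
      - 2 * mixedDiff u h f (x + Pi.single i (h i)) + mixedDiff u h f x := by
  have e : mixedDiff (insert i u) h = secondDiff i (h i) * mixedDiff u h :=
    Finset.noncommProd_insert_of_notMem _ _ _ _ hi
  rw [e]
  rfl

theorem mixedDiff_empty (h : Fin d → ℝ) (f : (Fin d → ℝ) → ℝ) (x : Fin d → ℝ) :
    mixedDiff ∅ h f x = f x := by
  have e : mixedDiff ∅ h = 1 := Finset.noncommProd_empty _ _
  rw [e]
  rfl

/-- With differences and interpolation both written as tensor products of functionals, univariate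
identities extend to d variables by multilinearity of `ev f`. -/
theorem mixedDiff_eq_ev (u : Finset (Fin d)) (h : Fin d → ℝ) (f : (Fin d → ℝ) → ℝ)
    (x : Fin d → ℝ) :
    mixedDiff u h f x = ev f (fun i => if i ∈ u then diffPt (h i) (x i) else pt (x i)) := by
  classical
  induction u using Finset.induction_on generalizing x with
  | empty => simp [mixedDiff_empty, ev_pt]
  | insert i u hi ih =>
    set a : Fin d → Π₀ _ : ℝ, ℝ := fun j => if j ∈ u then diffPt (h j) (x j) else pt (x j) with ha
    have e1 : (fun j => if j ∈ insert i u then diffPt (h j) (x j) else pt (x j))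
        = Function.update a i (diffPt (h i) (x i)) := by
      funext j
      by_cases hj : j = i
      · subst hj; simp
      · simp [hj, ha]
    have e2 : ∀ t, (fun j => if j ∈ u then diffPt (h j) ((x + Pi.single i t : Fin d → ℝ) j)
        else pt ((x + Pi.single i t : Fin d → ℝ) j)) = Function.update a i (pt (x i + t)) := by
      intro t
      funext j
      by_cases hj : j = i
      · subst hj; simp [hi]
      · simp [hj, ha]
    have e3 : a = Function.update a i (pt (x i)) := by
      funext j
      by_cases hj : j = i
      · subst hj; simp [hi, ha]
      · simp [hj]
    rw [mixedDiff_insert hi, ih, ih, ih, e1, ev_update_diffPt, e2, e2, ← ha, ← e3]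

/-! ### Piecewise linear interpolation -/

/-- The piecewise linear interpolation with nodes in `2⁻ᵏ ℤ`, evaluated at `t`. -/
def interp (k : ℕ) (t : ℝ) : Π₀ _ : ℝ, ℝ :=
  (1 - (2 ^ k * t - ⌊2 ^ k * t⌋₊)) • pt (⌊2 ^ k * t⌋₊ / 2 ^ k)
    + (2 ^ k * t - ⌊2 ^ k * t⌋₊) • pt ((⌊2 ^ k * t⌋₊ + 1) / 2 ^ k)

/-- The contribution of level `k` to the interpolation at `t`. -/
def levelPt (k : ℕ) (t : ℝ) : Π₀ _ : ℝ, ℝ :=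
  ∑ s ∈ Finset.range (2 ^ k), (-(1 / 2) * hat k s t) • diffPt (1 / 2 ^ (k + 1)) (s / 2 ^ k)

/-- Refinement only changes the value at the midpoint of the dyadic interval containing t. The
correction there is -1/2 times a second difference, and the hat spreads it linearly to the
endpoints. -/
theorem interp_succ (k : ℕ) {t : ℝ} (h0 : 0 ≤ t) (h1 : t < 1) :
    interp (k + 1) t = interp k t + levelPt k t := by
  have hk : (0 : ℝ) < 2 ^ k := by positivity
  set m := ⌊2 ^ k * t⌋₊ with hm
  have hm1 : (m : ℝ) ≤ 2 ^ k * t := Nat.floor_le (by positivity)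
  have hm2 : 2 ^ k * t < m + 1 := Nat.lt_floor_add_one _
  have hmr : m ∈ Finset.range (2 ^ k) := by
    rw [Finset.mem_range, hm, Nat.floor_lt (by positivity)]
    push_cast
    nlinarith
  have hl : levelPt k t = (-(1 / 2) * hat k m t) • diffPt (1 / 2 ^ (k + 1)) (m / 2 ^ k) := by
    rw [levelPt]
    refine Finset.sum_eq_single_of_mem m hmr fun s _ hs => ?_
    rw [hat_eq_zero_of_ne_floor (hm ▸ hs), mul_zero]
    exact zero_smul ℝ (diffPt (1 / 2 ^ (k + 1)) (s / 2 ^ k))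
  have p1 : (m : ℝ) / 2 ^ k + 2 * (1 / 2 ^ (k + 1)) = (m + 1) / 2 ^ k := by
    rw [pow_succ]; field_simp
  have p2 : (m : ℝ) / 2 ^ k + 1 / 2 ^ (k + 1) = (2 * m + 1) / 2 ^ (k + 1) := by
    rw [pow_succ]; field_simp
  have p3 : (2 * m : ℝ) / 2 ^ (k + 1) = m / 2 ^ k := by
    rw [pow_succ]; field_simp
  have p4 : (2 * m + 1 + 1 : ℝ) / 2 ^ (k + 1) = (m + 1) / 2 ^ k := by
    rw [pow_succ]; field_simp; ring
  rw [hl, diffPt, p1, p2, interp, interp, ← hm]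
  set θ := 2 ^ k * t - m with hθ
  have e : (2 : ℝ) ^ (k + 1) * t = 2 * m + 2 * θ := by rw [pow_succ, hθ]; ring
  -- The half of the interval in which t lies determines the floor at level k + 1.
  by_cases hc : θ < 1 / 2
  · have hf : ⌊(2 : ℝ) ^ (k + 1) * t⌋₊ = 2 * m := by
      rw [Nat.floor_eq_iff (by positivity)]
      push_cast
      constructor <;> linarith
    have hh : hat k m t = 2 * θ := by
      rw [hat, e, abs_of_nonpos (by linarith), max_eq_left (by linarith)]; ring
    rw [hf, hh, e]
    push_cast
    rw [p3]
    module
  · have hf : ⌊(2 : ℝ) ^ (k + 1) * t⌋₊ = 2 * m + 1 := by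
      rw [Nat.floor_eq_iff (by positivity)]
      push_cast
      constructor <;> linarith
    have hh : hat k m t = 2 - 2 * θ := by
      rw [hat, e, abs_of_nonneg (by linarith), max_eq_left (by linarith)]; ring
    rw [hf, hh, e]
    push_cast
    rw [p4]
    module

theorem interp_eq_sum (n : ℕ) {t : ℝ} (h0 : 0 ≤ t) (h1 : t < 1) :
    interp n t = ∑ k ∈ Finset.range n, levelPt k t + interp 0 t := by
  induction n with
  | zero => simp
  | succ n ih => rw [interp_succ n h0 h1, ih, Finset.sum_range_succ]; abel

theorem interp_zero_apply {t u : ℝ} (h1 : t < 1) (hu : u ∉ ({0, 1} : Set ℝ)) :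
    interp 0 t u = 0 := by
  have hf : ⌊t⌋₊ = 0 := Nat.floor_eq_zero.2 h1
  simp only [Set.mem_insert_iff, Set.mem_singleton_iff, not_or] at hu
  simp [interp, hf, pt, DFinsupp.single_apply, Ne.symm hu.1, Ne.symm hu.2]

/-- The coefficients of the Faber series. -/
def coef (f : (Fin d → ℝ) → ℝ) (k s : Fin d → ℕ) : ℝ :=
  (-(1 / 2)) ^ d * mixedDiff Finset.univ (fun j => 1 / 2 ^ (k j + 1)) f fun j => s j / 2 ^ k j

/-- The positions of the hat functions of level `k`. -/
def positions (k : Fin d → ℕ) : Finset (Fin d → ℕ) :=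
  Fintype.piFinset fun j => Finset.range (2 ^ k j)

/-- The term of level `k` of the Faber series. -/
def level (f : (Fin d → ℝ) → ℝ) (k : Fin d → ℕ) (x : Fin d → ℝ) : ℝ :=
  ∑ s ∈ positions k, coef f k s * ∏ j, hat (k j) (s j) (x j)

theorem ev_levelPt (f : (Fin d → ℝ) → ℝ) (k : Fin d → ℕ) (x : Fin d → ℝ) :
    ev f (fun i => levelPt (k i) (x i)) = level f k x := by
  simp only [levelPt]
  rw [MultilinearMap.map_sum_finset]
  refine Finset.sum_congr rfl fun s _ => ?_
  rw [MultilinearMap.map_smul_univ, coef, mixedDiff_eq_ev, Finset.prod_mul_distrib]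
  simp
  ring

/-- Expanding the tensor product of `interp_eq_sum`, each mixed term contains a factor `interp 0`.
It evaluates only at 0 and 1, so the boundary condition removes all terms but the one made of
levels. -/
theorem ev_interp_eq_sum {f : (Fin d → ℝ) → ℝ} (hf : ∀ p, (∃ i, p i = 0 ∨ p i = 1) → f p = 0)
    (n : ℕ) {x : Fin d → ℝ} (h0 : ∀ i, 0 ≤ x i) (h1 : ∀ i, x i < 1) :
    ev f (fun i => interp n (x i))
      = ∑ k ∈ Fintype.piFinset fun _ : Fin d => Finset.range n, level f k x := by
  classical
  have e : (fun i => interp n (x i)) = (fun i => ∑ k ∈ Finset.range n, levelPt k (x i))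
      + fun i => interp 0 (x i) := by
    funext i
    exact interp_eq_sum n (h0 i) (h1 i)
  rw [e, MultilinearMap.map_add_univ, Finset.sum_eq_single_of_mem Finset.univ (Finset.mem_univ _),
    Finset.piecewise_univ, MultilinearMap.map_sum_finset]
  · exact Finset.sum_congr rfl fun k _ => ev_levelPt f k x
  · intro S _ hS
    obtain ⟨i, hi⟩ : ∃ i, i ∉ S := by
      by_contra! h
      exact hS (Finset.eq_univ_of_forall h)
    refine ev_eq_zero i (S := {0, 1}) (fun p hp => hf p ⟨i, hp⟩) fun t ht => ?_
    rw [Finset.piecewise_eq_of_notMem _ _ _ hi]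
    exact interp_zero_apply (h1 i) ht

/-- The interpolant at x is a convex combination of the values of f at the vertices of a dyadic cube
of side 2^(-n) around x. -/
theorem tendsto_ev_interp {f : (Fin d → ℝ) → ℝ} (hf : Continuous f) {x : Fin d → ℝ}
    (h0 : ∀ i, 0 ≤ x i) :
    Filter.Tendsto (fun n => ev f fun i => interp n (x i)) Filter.atTop (nhds (f x)) := by
  classical
  rw [Metric.tendsto_atTop]
  intro ε hε
  obtain ⟨δ, hδ, h⟩ := Metric.continuousAt_iff.1 hf.continuousAt (ε / 2) (by positivity)
  obtain ⟨N, hN⟩ := exists_pow_lt_of_lt_one hδ (show (1 / 2 : ℝ) < 1 by norm_num)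
  refine ⟨N, fun n hn => ?_⟩
  have hn' : (1 : ℝ) / 2 ^ n < δ := by
    rw [← one_div_pow]
    exact (pow_le_pow_of_le_one (by norm_num) (by norm_num) hn).trans_lt hN
  have hk : (0 : ℝ) < 2 ^ n := by positivity
  set m : Fin d → ℕ := fun i => ⌊2 ^ n * x i⌋₊ with hm
  set θ : Fin d → ℝ := fun i => 2 ^ n * x i - m i with hθ
  have hθ0 : ∀ i, 0 ≤ θ i := fun i => by
    have := Nat.floor_le (show 0 ≤ 2 ^ n * x i from mul_nonneg hk.le (h0 i))
    simp only [hθ, hm]; linarith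
  have hθ1 : ∀ i, θ i ≤ 1 := fun i => by
    have := Nat.lt_floor_add_one (2 ^ n * x i)
    simp only [hθ, hm]; linarith
  set a : Fin d → ℝ := fun i => m i / 2 ^ n
  set b : Fin d → ℝ := fun i => (m i + 1) / 2 ^ n
  have e : (fun i => interp n (x i)) = (fun i => (1 - θ i) • pt (a i)) + fun i => θ i • pt (b i) :=
    rfl
  have e' : ev f (fun i => interp n (x i))
      = ∑ S : Finset (Fin d), (∏ i, S.piecewise (fun i => 1 - θ i) θ i) * f (S.piecewise a b) := by
    rw [e, MultilinearMap.map_add_univ]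
    refine Finset.sum_congr rfl fun S _ => ?_
    rw [← ev_pt f (S.piecewise a b), ← smul_eq_mul, ← MultilinearMap.map_smul_univ]
    congr 1
    funext i
    by_cases hi : i ∈ S <;> simp [hi]
  have hw : ∑ S : Finset (Fin d), (∏ i, S.piecewise (fun i => 1 - θ i) θ i) = 1 := by
    have := Finset.prod_add (fun i => 1 - θ i) θ (Finset.univ : Finset (Fin d))
    simp only [sub_add_cancel, Finset.prod_const_one, Finset.powerset_univ] at this
    refine (Finset.sum_congr rfl fun S _ => ?_).trans this.symm
    rw [Finset.prod_piecewise]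
    simp
  have hw0 : ∀ S : Finset (Fin d), 0 ≤ ∏ i, S.piecewise (fun i => 1 - θ i) θ i := fun S =>
    Finset.prod_nonneg fun i _ => by
      by_cases hi : i ∈ S
      · simp only [hi, Finset.piecewise_eq_of_mem]; linarith [hθ1 i]
      · simp only [hi, not_false_eq_true, Finset.piecewise_eq_of_notMem]; exact hθ0 i
  have hx : ∀ S : Finset (Fin d), |f (S.piecewise a b) - f x| ≤ ε / 2 := fun S => by
    rw [← Real.dist_eq]
    refine (h ?_).le
    refine ((dist_pi_le_iff (by positivity)).2 fun i => ?_).trans_lt hn'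
    have hxi : x i = (m i + θ i) / 2 ^ n := by simp only [hθ]; field_simp; ring
    rw [Real.dist_eq]
    by_cases hi : i ∈ S
    · rw [Finset.piecewise_eq_of_mem _ _ _ hi, hxi, ← sub_div, abs_div, abs_of_pos hk]
      gcongr
      rw [abs_le]; constructor <;> linarith [hθ0 i, hθ1 i]
    · rw [Finset.piecewise_eq_of_notMem _ _ _ hi, hxi, ← sub_div, abs_div, abs_of_pos hk]
      gcongr
      rw [abs_le]; constructor <;> linarith [hθ0 i, hθ1 i]
  have e2 : ev f (fun i => interp n (x i)) - f x
      = ∑ S : Finset (Fin d), (∏ i, S.piecewise (fun i => 1 - θ i) θ i)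
        * (f (S.piecewise a b) - f x) := by
    simp only [mul_sub, Finset.sum_sub_distrib, ← Finset.sum_mul, hw, one_mul, e']
  rw [Real.dist_eq, e2]
  refine (Finset.abs_sum_le_sum_abs _ _).trans_lt ?_
  calc _ ≤ ∑ S : Finset (Fin d), (∏ i, S.piecewise (fun i => 1 - θ i) θ i) * (ε / 2) :=
        Finset.sum_le_sum fun S _ => by
          rw [abs_mul, abs_of_nonneg (hw0 S)]
          exact mul_le_mul_of_nonneg_left (hx S) (hw0 S)
    _ = ε / 2 := by rw [← Finset.sum_mul, hw, one_mul]
    _ < ε := by linarith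

theorem prod_hat_eq_zero {k s : Fin d → ℕ} (hs : s ∈ positions k) {x : Fin d → ℝ}
    (hx : ∃ i, x i ≤ 0 ∨ 1 ≤ x i) : ∏ j, hat (k j) (s j) (x j) = 0 := by
  obtain ⟨i, hi⟩ := hx
  exact Finset.prod_eq_zero (Finset.mem_univ i)
    (hat_eq_zero (Finset.mem_range.1 (Fintype.mem_piFinset.1 hs i)) hi)

/-- The Faber series of a function that vanishes outside of the open cube. -/
theorem hasSum_level {f : (Fin d → ℝ) → ℝ} (hf : Continuous f)
    (hv : ∀ p, (∃ i, p i ≤ 0 ∨ 1 ≤ p i) → f p = 0) {x : Fin d → ℝ}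
    (hs : Summable fun k => level f k x) : HasSum (fun k => level f k x) (f x) := by
  by_cases hx : ∃ i, x i ≤ 0 ∨ 1 ≤ x i
  · rw [hv x hx]
    have : (fun k => level f k x) = fun _ => 0 := funext fun k =>
      Finset.sum_eq_zero fun s hs => by rw [prod_hat_eq_zero hs hx, mul_zero]
    rw [this]
    exact hasSum_zero
  · push Not at hx
    have h1 := hs.hasSum
    -- The boxes exhaust all levels; by summability the limit along them is the unconditional sum.
    have ht : Filter.Tendsto (fun n : ℕ => Fintype.piFinset fun _ : Fin d => Finset.range n)
        Filter.atTop Filter.atTop := by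
      refine Filter.tendsto_atTop_finset_of_monotone
        (fun m n h => Fintype.piFinset_subset _ _ fun _ => Finset.range_mono h) fun k => ?_
      refine ⟨∑ j, k j + 1, Fintype.mem_piFinset.2 fun j => Finset.mem_range.2 ?_⟩
      exact Nat.lt_succ_of_le (Finset.single_le_sum (fun _ _ => Nat.zero_le _) (Finset.mem_univ j))
    have h2 := Filter.Tendsto.comp h1 ht
    have h3 := tendsto_ev_interp hf (x := x) fun i => (hx i).1.le
    have h4 : (fun n => ev f fun i => interp n (x i))
        = (fun s : Finset (Fin d → ℕ) => ∑ k ∈ s, level f k x)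
          ∘ fun n : ℕ => Fintype.piFinset fun _ : Fin d => Finset.range n := by
      funext n
      exact ev_interp_eq_sum (fun p ⟨i, hi⟩ => hv p ⟨i, hi.imp (fun h => h.le) (fun h => h.ge)⟩) n
        (fun i => (hx i).1.le) fun i => (hx i).2
    rw [h4] at h3
    rw [← tendsto_nhds_unique h2 h3]
    exact h1

end

noncomputable section

/-! ### Sums over sparse grids -/

/-- Every finite set of indices lies in a box, over which the sum factorizes. -/
theorem tsum_prod_le {κ : Type*} [Fintype κ] (g : ℕ → ℝ≥0∞) :
    ∑' k : κ → ℕ, ∏ j, g (k j) ≤ (∑' n, g n) ^ Fintype.card κ := by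
  classical
  rw [ENNReal.tsum_eq_iSup_sum]
  refine iSup_le fun S => ?_
  have hS : S ⊆ Fintype.piFinset fun _ : κ => Finset.range (S.sup (fun k => ∑ j, k j) + 1) := by
    intro k hk
    refine Fintype.mem_piFinset.2 fun j => Finset.mem_range.2 (Nat.lt_succ_of_le ?_)
    exact (Finset.single_le_sum (fun _ _ => Nat.zero_le _) (Finset.mem_univ j)).trans
      (Finset.le_sup (f := fun k : κ → ℕ => ∑ j, k j) hk)
  refine (Finset.sum_le_sum_of_subset hS).trans ?_
  rw [← Finset.prod_univ_sum (fun _ : κ => Finset.range (S.sup (fun k => ∑ j, k j) + 1))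
    fun _ n => g n, Finset.prod_const]
  exact pow_le_pow_left' (ENNReal.sum_le_tsum _) _

variable {d : ℕ}

/-- The common pattern of the sparse grid sums: the summand sees k only through k_i and the sum n of
the other indices. If summing over k_i leaves C ρ^n, the remaining d - 1 indices contribute one
geometric series each. -/
theorem tsum_split_le (i : Fin d) (φ : ℕ → ℕ → ℝ≥0∞) (C ρ : ℝ≥0∞)
    (h : ∀ n, ∑' a, φ a n ≤ C * ρ ^ n) :
    ∑' k : Fin d → ℕ, φ (k i) (∑ j : {j // j ≠ i}, k j) ≤ C * ((1 - ρ)⁻¹) ^ (d - 1) := by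
  have e : ∑' k : Fin d → ℕ, φ (k i) (∑ j : {j // j ≠ i}, k j)
      = ∑' p : ℕ × ({j // j ≠ i} → ℕ), φ p.1 (∑ j, p.2 j) :=
    (Equiv.funSplitAt i ℕ).tsum_eq fun p : ℕ × ({j // j ≠ i} → ℕ) => φ p.1 (∑ j, p.2 j)
  rw [e, ENNReal.tsum_prod (f := fun a (k : {j // j ≠ i} → ℕ) => φ a (∑ j, k j)), ENNReal.tsum_comm]
  calc _ ≤ ∑' k : {j // j ≠ i} → ℕ, C * ∏ j, ρ ^ (k j) :=
        ENNReal.tsum_le_tsum fun k => (h _).trans_eq (by rw [Finset.prod_pow_eq_pow_sum])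
    _ ≤ _ := by
        rw [ENNReal.tsum_mul_left]
        gcongr
        refine (tsum_prod_le fun n => ρ ^ n).trans_eq ?_
        rw [ENNReal.tsum_geometric]
        congr 1
        rw [Fintype.card_subtype_compl, Fintype.card_fin, Fintype.card_subtype_eq]

theorem sum_eq_add_sum_ne (i : Fin d) (k : Fin d → ℕ) :
    (∑ j, (k j : ℝ)) = k i + (∑ j : {j // j ≠ i}, k j : ℕ) := by
  rw [Fintype.sum_eq_add_sum_subtype_ne _ i]
  push_cast
  rfl

theorem one_sub_ofReal_inv {t : ℝ} (h0 : 0 ≤ t) (h1 : t < 1) :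
    (1 - ENNReal.ofReal t)⁻¹ = ENNReal.ofReal ((1 - t)⁻¹) := by
  rw [← ENNReal.ofReal_one, ← ENNReal.ofReal_sub _ h0, ENNReal.ofReal_inv_of_pos (by linarith)]

/-- The weight `2 ^ (kᵢ - α |k|)`. -/
def weight (α : ℝ) (i : Fin d) (k : Fin d → ℕ) : ℝ := (2 : ℝ) ^ ((k i : ℝ) - α * ∑ j, (k j : ℝ))

theorem weight_eq (α : ℝ) (i : Fin d) (k : Fin d → ℕ) : ENNReal.ofReal (weight α i k)
    = ENNReal.ofReal ((2 : ℝ) ^ (1 - α)) ^ k i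
      * ENNReal.ofReal ((2 : ℝ) ^ (-α)) ^ (∑ j : {j // j ≠ i}, k j) := by
  rw [← ENNReal.ofReal_pow (by positivity), ← ENNReal.ofReal_pow (by positivity),
    ← ENNReal.ofReal_mul (by positivity), weight, sum_eq_add_sum_ne i, ← Real.rpow_mul_natCast (by norm_num),
    ← Real.rpow_mul_natCast (by norm_num), ← Real.rpow_add (by norm_num)]
  congr 2
  ring

theorem two_rpow_lt_one {t : ℝ} (ht : t < 0) : (2 : ℝ) ^ t < 1 :=
  Real.rpow_lt_one_of_one_lt_of_neg (by norm_num) ht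

theorem tsum_weight_le {α : ℝ} (hα : 1 < α) (i : Fin d) :
    ∑' k : Fin d → ℕ, ENNReal.ofReal (weight α i k)
      ≤ ENNReal.ofReal ((1 - (2 : ℝ) ^ (1 - α))⁻¹ * ((1 - (2 : ℝ) ^ (-α))⁻¹) ^ (d - 1)) := by
  have h1 := two_rpow_lt_one (show 1 - α < 0 by linarith)
  have h2 := two_rpow_lt_one (show -α < 0 by linarith)
  simp only [weight_eq]
  refine (tsum_split_le i (fun a n => ENNReal.ofReal ((2 : ℝ) ^ (1 - α)) ^ a
      * ENNReal.ofReal ((2 : ℝ) ^ (-α)) ^ n) (ENNReal.ofReal ((1 - (2 : ℝ) ^ (1 - α))⁻¹))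
      (ENNReal.ofReal ((2 : ℝ) ^ (-α))) fun n => ?_).trans_eq ?_
  · rw [ENNReal.tsum_mul_right, ENNReal.tsum_geometric, one_sub_ofReal_inv (by positivity) h1]
  · rw [one_sub_ofReal_inv (by positivity) h2, ← ENNReal.ofReal_pow (inv_nonneg.2 (by linarith)),
      ← ENNReal.ofReal_mul (inv_nonneg.2 (by linarith))]

/-- The sparse grid levels. -/
def sparse (d : ℕ) (β m : ℝ) : Set (Fin d → ℕ) :=
  {k | ∃ i, β * ∑ j, (k j : ℝ) - k i ≤ (β - 1) * m}

theorem finite_sparse (d : ℕ) {β : ℝ} (hβ : 1 < β) (m : ℝ) : (sparse d β m).Finite := by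
  refine (Fintype.piFinset fun _ : Fin d => Finset.range (⌊m⌋₊ + 1)).finite_toSet.subset ?_
  rintro k ⟨i, hi⟩
  refine Finset.mem_coe.2 (Fintype.mem_piFinset.2 fun j => Finset.mem_range.2 ?_)
  have h : ∀ j, (k j : ℝ) ≤ ∑ j, (k j : ℝ) := fun j =>
    Finset.single_le_sum (f := fun j => (k j : ℝ)) (fun _ _ => Nat.cast_nonneg _)
      (Finset.mem_univ j)
  refine Nat.lt_succ_of_le (Nat.le_floor ?_)
  have := h i
  have := h j
  nlinarith

theorem tsum_gt_le {r τ : ℝ} (h0 : 0 < r) (h1 : r < 1) :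
    ∑' a : ℕ, (if τ < a then ENNReal.ofReal r ^ a else 0) ≤ ENNReal.ofReal (r ^ τ * (1 - r)⁻¹) := by
  rw [← Summable.sum_add_tsum_nat_add' (f := fun a : ℕ => if τ < a then ENNReal.ofReal r ^ a else 0)
    (k := ⌈τ⌉₊) ENNReal.summable, Finset.sum_eq_zero, zero_add]
  · calc _ ≤ ∑' a : ℕ, ENNReal.ofReal r ^ ⌈τ⌉₊ * ENNReal.ofReal r ^ a := by
          refine ENNReal.tsum_le_tsum fun a => ?_
          split_ifs
          · rw [add_comm, pow_add]
          · exact zero_le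
      _ ≤ _ := by
          rw [ENNReal.tsum_mul_left, ENNReal.tsum_geometric, one_sub_ofReal_inv h0.le h1,
            ← ENNReal.ofReal_pow h0.le, ← ENNReal.ofReal_mul (by positivity), ← Real.rpow_natCast]
          refine ENNReal.ofReal_le_ofReal (mul_le_mul_of_nonneg_right ?_
            (inv_nonneg.2 (by linarith)))
          exact Real.rpow_le_rpow_of_exponent_ge h0 h1.le (Nat.le_ceil τ)
  · intro a ha
    have := Nat.lt_ceil.1 (Finset.mem_range.1 ha)
    rw [if_neg (by linarith)]

theorem tsum_le_le (τ : ℝ) :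
    ∑' a : ℕ, (if (a : ℝ) ≤ τ then (2 : ℝ≥0∞) ^ a else 0) ≤ ENNReal.ofReal (2 * 2 ^ τ) := by
  by_cases hτ : τ < 0
  · rw [ENNReal.tsum_eq_zero.2 fun a => if_neg fun h => ?_]
    · exact zero_le
    · linarith [show (0 : ℝ) ≤ a from a.cast_nonneg]
  push Not at hτ
  rw [tsum_eq_sum (s := Finset.range (⌊τ⌋₊ + 1))]
  · calc _ ≤ ∑ a ∈ Finset.range (⌊τ⌋₊ + 1), (2 : ℝ≥0∞) ^ a :=
          Finset.sum_le_sum fun a _ => by split_ifs <;> simp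
      _ ≤ ((2 ^ (⌊τ⌋₊ + 1) : ℕ) : ℝ≥0∞) := by
          have h : ∀ n, ∑ a ∈ Finset.range n, 2 ^ a ≤ 2 ^ n := fun n => by
            induction n with
            | zero => simp
            | succ n ih => rw [Finset.sum_range_succ, pow_succ]; omega
          exact_mod_cast h _
      _ ≤ _ := by
          rw [← ENNReal.ofReal_natCast]
          refine ENNReal.ofReal_le_ofReal ?_
          push_cast
          rw [pow_succ, mul_comm, ← Real.rpow_natCast]
          gcongr
          · norm_num
          · exact Nat.floor_le hτ
  · intro a ha
    refine if_neg fun h => ha (Finset.mem_range.2 (Nat.lt_succ_of_le (Nat.le_floor h)))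

/-- Membership as a threshold for k_i given the sum of the other indices, the form that
`tsum_split_le` can use. -/
theorem mem_sparse_iff {β m : ℝ} (hβ : 1 < β) {k : Fin d → ℕ} : k ∈ sparse d β m ↔
    ∃ i, (k i : ℝ) ≤ m - β / (β - 1) * (∑ j : {j // j ≠ i}, k j : ℕ) := by
  refine exists_congr fun i => ?_
  rw [sum_eq_add_sum_ne i]
  generalize ((∑ j : {j // j ≠ i}, k j : ℕ) : ℝ) = n
  have hβ' : 0 < β - 1 := by linarith
  rw [show m - β / (β - 1) * n = ((β - 1) * m - β * n) / (β - 1) by field_simp,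
    le_div_iff₀ hβ']
  constructor <;> intro h <;> linarith

open Classical in
-- Outside of the sparse grid k_i exceeds m - βn/(β-1), n being the sum of the other indices. The
-- geometric tail in k_i times 2^(-αn) then has n-dependence 2^(-n(β-α)/(β-1)), because (α-1)β/(β-1)
-- - α = -(β-α)/(β-1). The condition α < β makes this summable.
theorem tsum_weight_compl_sparse_le {α β : ℝ} (hα : 1 < α) (hβ : α < β) (m : ℝ) (i : Fin d) :
    ∑' k : Fin d → ℕ, (if k ∈ sparse d β m then 0 else ENNReal.ofReal (weight α i k))
      ≤ ENNReal.ofReal ((2 : ℝ) ^ ((1 - α) * m) * (1 - (2 : ℝ) ^ (1 - α))⁻¹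
        * ((gap α β)⁻¹) ^ (d - 1)) := by
  have h1 := two_rpow_lt_one (show 1 - α < 0 by linarith)
  have hb : 0 < β - 1 := by linarith
  have hg : -((β - α) / (β - 1)) < 0 := neg_neg_of_pos (div_pos (by linarith) hb)
  have h2 := two_rpow_lt_one hg
  set q := ENNReal.ofReal ((2 : ℝ) ^ (1 - α)) with hq
  refine (ENNReal.tsum_le_tsum (g := fun k => (fun a n =>
    (if m - β / (β - 1) * (n : ℕ) < (a : ℕ) then q ^ a else 0)
      * ENNReal.ofReal ((2 : ℝ) ^ (-α)) ^ n) (k i) (∑ j : {j // j ≠ i}, k j)) fun k => ?_).trans ?_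
  · split_ifs with h
    · exact zero_le
    · rw [weight_eq]
      have h' : m - β / (β - 1) * (∑ j : {j // j ≠ i}, k j : ℕ) < k i := by
        by_contra h'
        exact h ((mem_sparse_iff (by linarith)).2 ⟨i, not_lt.1 h'⟩)
      simp only [if_pos h']
      exact le_rfl
  · refine (tsum_split_le i (fun a n => (if m - β / (β - 1) * (n : ℕ) < (a : ℕ) then q ^ a else 0)
      * ENNReal.ofReal ((2 : ℝ) ^ (-α)) ^ n)
      (ENNReal.ofReal ((2 : ℝ) ^ ((1 - α) * m) * (1 - (2 : ℝ) ^ (1 - α))⁻¹)) (ENNReal.ofReal ((2 : ℝ) ^ (-((β - α) / (β - 1))))) fun n => ?_).trans_eq ?_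
    · rw [ENNReal.tsum_mul_right]
      calc _ ≤ ENNReal.ofReal (((2 : ℝ) ^ (1 - α)) ^ (m - β / (β - 1) * n)
              * (1 - (2 : ℝ) ^ (1 - α))⁻¹) * ENNReal.ofReal ((2 : ℝ) ^ (-α)) ^ n := by
            gcongr
            exact tsum_gt_le (by positivity) h1
        _ = _ := by
            have h3 : 0 ≤ (1 - (2 : ℝ) ^ (1 - α))⁻¹ := inv_nonneg.2 (by linarith)
            rw [← ENNReal.ofReal_pow (by positivity), ← ENNReal.ofReal_pow (by positivity),
              ← ENNReal.ofReal_mul (by positivity), ← ENNReal.ofReal_mul (by positivity),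
              ← Real.rpow_mul (by norm_num), ← Real.rpow_mul_natCast (by norm_num),
              ← Real.rpow_mul_natCast (by norm_num)]
            congr 1
            rw [mul_right_comm, ← Real.rpow_add (by norm_num), mul_right_comm,
              ← Real.rpow_add (by norm_num)]
            congr 2
            field_simp
            ring
    · have h3 : 0 ≤ (1 - (2 : ℝ) ^ (1 - α))⁻¹ := inv_nonneg.2 (by linarith)
      rw [one_sub_ofReal_inv (by positivity) h2, ← ENNReal.ofReal_pow (inv_nonneg.2 (by linarith)),
        ← ENNReal.ofReal_mul (by positivity), gap]

open Classical in
/-- The number of grid points. -/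
theorem sum_card_positions_le {β : ℝ} (hβ : 1 < β) (m : ℝ) :
    ((∑ k ∈ (finite_sparse d hβ m).toFinset, (positions k).card : ℕ) : ℝ)
      ≤ 2 * d * 2 ^ m * ((1 - (2 : ℝ) ^ (-(1 / (β - 1))))⁻¹) ^ (d - 1) := by
  have hb : 0 < β - 1 := by linarith
  have hg : -(1 / (β - 1)) < 0 := neg_neg_of_pos (by positivity)
  have h2 := two_rpow_lt_one hg
  have h3 : 0 ≤ (1 - (2 : ℝ) ^ (-(1 / (β - 1))))⁻¹ := inv_nonneg.2 (by linarith)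
  -- Level k has 2^|k| positions. Summing 2^a up to the threshold m - βn/(β-1) and multiplying by
  -- 2^n leaves the ratio 2^(-1/(β-1)), as 1 - β/(β-1) = -1/(β-1).
  have hmain : ∀ i : Fin d, ∑' k : Fin d → ℕ, (fun a n =>
      (if ((a : ℕ) : ℝ) ≤ m - β / (β - 1) * (n : ℕ) then (2 : ℝ≥0∞) ^ a else 0) * 2 ^ n)
        (k i) (∑ j : {j // j ≠ i}, k j)
      ≤ ENNReal.ofReal (2 * 2 ^ m * ((1 - (2 : ℝ) ^ (-(1 / (β - 1))))⁻¹) ^ (d - 1)) := by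
    intro i
    refine (tsum_split_le i (fun a n =>
      (if ((a : ℕ) : ℝ) ≤ m - β / (β - 1) * (n : ℕ) then (2 : ℝ≥0∞) ^ a else 0) * 2 ^ n)
      (ENNReal.ofReal (2 * 2 ^ m))
      (ENNReal.ofReal ((2 : ℝ) ^ (-(1 / (β - 1))))) fun n => ?_).trans_eq ?_
    · rw [ENNReal.tsum_mul_right]
      calc _ ≤ ENNReal.ofReal (2 * 2 ^ (m - β / (β - 1) * n)) * 2 ^ n := by
            gcongr
            exact tsum_le_le _
        _ = _ := by
            rw [show (2 : ℝ≥0∞) = ENNReal.ofReal 2 by simp, ← ENNReal.ofReal_pow (by positivity),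
              ← ENNReal.ofReal_pow (by positivity), ← ENNReal.ofReal_mul (by positivity),
              ← ENNReal.ofReal_mul (by positivity), ← Real.rpow_mul_natCast (by norm_num),
              ← Real.rpow_natCast, mul_assoc, mul_assoc, ← Real.rpow_add (by norm_num),
              ← Real.rpow_add (by norm_num)]
            congr 3
            field_simp
            ring
    · rw [one_sub_ofReal_inv (by positivity) h2, ← ENNReal.ofReal_pow h3,
        ← ENNReal.ofReal_mul (by positivity)]
  -- A union bound over the index i that witnesses membership; it costs the factor d.
  have hN : ((∑ k ∈ (finite_sparse d hβ m).toFinset, (positions k).card : ℕ) : ℝ≥0∞)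
      ≤ ∑ i : Fin d, ENNReal.ofReal (2 * 2 ^ m * ((1 - (2 : ℝ) ^ (-(1 / (β - 1))))⁻¹) ^ (d - 1)) := by
    refine le_trans ?_ (Finset.sum_le_sum fun i _ => hmain i)
    push_cast
    rw [← Summable.tsum_finsetSum fun _ _ => ENNReal.summable]
    refine le_trans (Finset.sum_le_sum fun k hk => ?_) (ENNReal.sum_le_tsum
      (finite_sparse d hβ m).toFinset)
    rw [Set.Finite.mem_toFinset, mem_sparse_iff hβ] at hk
    obtain ⟨i, hi⟩ := hk
    refine le_trans ?_ (Finset.single_le_sum (fun _ _ => zero_le) (Finset.mem_univ i))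
    push_cast at hi
    rw [if_pos hi, ← pow_add, positions, Fintype.card_piFinset]
    simp only [Finset.card_range]
    rw [Finset.prod_pow_eq_pow_sum, ← Fintype.sum_eq_add_sum_subtype_ne]
    push_cast
    exact le_rfl
  rw [Finset.sum_const, Finset.card_univ, Fintype.card_fin, nsmul_eq_mul, ← ENNReal.ofReal_natCast,
    ← ENNReal.ofReal_natCast, ← ENNReal.ofReal_mul (by positivity),
    ENNReal.ofReal_le_ofReal_iff (by positivity)] at hN
  exact hN.trans_eq (by ring)

end

noncomputable section

/-! ### Norms of sums of hat functions -/

/-- The sum of the hat functions of level `k`. -/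
def sawtooth (k : ℕ) (t : ℝ) : ℝ := ∑ s ∈ Finset.range (2 ^ k), hat k s t

theorem continuous_hat (k s : ℕ) : Continuous (hat k s) := by
  unfold hat
  fun_prop

theorem sawtooth_mem (k : ℕ) (t : ℝ) : sawtooth k t ∈ Set.Icc (0 : ℝ) 1 := sum_hat_mem k t

theorem continuous_sawtooth (k : ℕ) : Continuous (sawtooth k) :=
  continuous_finsetSum _ fun s _ => continuous_hat k s

theorem integral_hat_rpow (k s : ℕ) {p : ℝ} (hp : 0 < p) :
    ∫ t, hat k s t ^ p = (1 / 2) ^ k * (p + 1)⁻¹ := by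
  have h1 : ∀ t, hat k s t ^ p = (fun v => (max (1 - |v|) 0) ^ p) (2 ^ (k + 1) * t - (2 * s + 1)) := by
    intro t
    simp only [hat]
    rw [sub_sub]
  have h2 : ∫ v : ℝ, (max (1 - |v|) 0) ^ p = 2 * (p + 1)⁻¹ := by
    rw [integral_comp_abs (f := fun v => (max (1 - v) 0) ^ p)]
    congr 1
    rw [setIntegral_eq_of_subset_of_forall_sdiff_eq_zero (s := Set.Ioc 0 1) measurableSet_Ioi
      (fun v hv => hv.1) (fun v hv => ?_)]
    · rw [setIntegral_congr_fun (g := fun v => (1 - v) ^ p) measurableSet_Ioc (fun v hv => by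
          simp only [max_eq_left (sub_nonneg.2 hv.2)]), ← intervalIntegral.integral_of_le zero_le_one,
        intervalIntegral.integral_comp_sub_left (fun v => v ^ p) 1]
      rw [integral_rpow (Or.inl (by linarith))]
      simp [Real.zero_rpow (by linarith : p + 1 ≠ 0)]
    · have : 1 < v := by
        by_contra h
        exact hv.2 ⟨hv.1, not_lt.1 h⟩
      rw [max_eq_right (by linarith), Real.zero_rpow hp.ne']
  simp only [h1]
  rw [Measure.integral_comp_mul_left (fun v => (fun v => (max (1 - |v|) 0) ^ p) (v - (2 * s + 1))),
    integral_sub_right_eq_self (fun v : ℝ => (max (1 - |v|) 0) ^ p), h2, smul_eq_mul,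
    abs_of_pos (by positivity), pow_succ]
  field_simp
  rw [← mul_pow]; norm_num

theorem integrable_hat_rpow (k s : ℕ) {p : ℝ} (hp : 0 < p) : Integrable fun t => hat k s t ^ p := by
  refine Continuous.integrable_of_hasCompactSupport
    ((continuous_hat k s).rpow_const fun _ => Or.inr hp.le) ?_
  refine HasCompactSupport.intro (K := Set.Icc ((s : ℝ) / 2 ^ k) ((s + 1) / 2 ^ k)) isCompact_Icc
    fun t ht => ?_
  have : hat k s t = 0 := by
    by_contra h
    obtain ⟨h1, h2⟩ := of_hat_ne_zero h
    exact ht ⟨(div_le_iff₀' (by positivity)).2 h1.le, (le_div_iff₀' (by positivity)).2 h2.le⟩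
  rw [this, Real.zero_rpow hp.ne']

/-- At most one hat of the level is nonzero at t. -/
theorem sawtooth_rpow (k : ℕ) (t : ℝ) {p : ℝ} (hp : 0 < p) :
    sawtooth k t ^ p = ∑ s ∈ Finset.range (2 ^ k), hat k s t ^ p := by
  unfold sawtooth
  by_cases h : ⌊2 ^ k * t⌋₊ ∈ Finset.range (2 ^ k)
  · rw [Finset.sum_eq_single_of_mem _ h fun s _ hs => hat_eq_zero_of_ne_floor hs,
      Finset.sum_eq_single_of_mem _ h fun s _ hs => by
        rw [hat_eq_zero_of_ne_floor hs, Real.zero_rpow hp.ne']]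
  · have h' : ∀ s ∈ Finset.range (2 ^ k), hat k s t = 0 := fun s hs =>
      hat_eq_zero_of_ne_floor fun e => h (e ▸ hs)
    rw [Finset.sum_eq_zero h', Real.zero_rpow hp.ne', Finset.sum_eq_zero fun s hs => by
      rw [h' s hs, Real.zero_rpow hp.ne']]

/-- There are 2^k hats, each contributing 2^(-k)/(p+1). -/
theorem setIntegral_sawtooth_rpow_le (k : ℕ) {p : ℝ} (hp : 0 < p) :
    ∫ t in Set.Icc (0 : ℝ) 1, sawtooth k t ^ p ≤ (p + 1)⁻¹ := by
  simp only [sawtooth_rpow k _ hp]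
  rw [integral_finsetSum _ fun s _ => (integrable_hat_rpow k s hp).integrableOn]
  calc _ ≤ ∑ s ∈ Finset.range (2 ^ k), ((1 / 2 : ℝ) ^ k * (p + 1)⁻¹) := by
        refine Finset.sum_le_sum fun s _ => ?_
        rw [← integral_hat_rpow k s hp]
        exact setIntegral_le_integral (integrable_hat_rpow k s hp)
          (.of_forall fun t => Real.rpow_nonneg (hat_mem k s t).1 p)
    _ = (p + 1)⁻¹ := by
        rw [Finset.sum_const, Finset.card_range, nsmul_eq_mul, ← mul_assoc]
        push_cast
        rw [← mul_pow]
        norm_num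

/-! ### L_p norms on the cube as a product probability space -/

variable {d : ℕ}

theorem cube_eq_pi (d : ℕ) : cube d = Set.univ.pi fun _ => Set.Icc (0 : ℝ) 1 := by
  rw [Set.pi_univ_Icc]; rfl

theorem measurableSet_cube (d : ℕ) : MeasurableSet (cube d) := measurableSet_Icc

theorem volume_restrict_cube (d : ℕ) : (volume : Measure (Fin d → ℝ)).restrict (cube d)
    = Measure.pi fun _ => (volume : Measure ℝ).restrict (Set.Icc 0 1) := by
  rw [cube_eq_pi, volume_pi, Measure.restrict_pi_pi]

instance : IsProbabilityMeasure ((volume : Measure (Fin d → ℝ)).restrict (cube d)) := by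
  rw [volume_restrict_cube]
  have : IsProbabilityMeasure ((volume : Measure ℝ).restrict (Set.Icc 0 1)) := ⟨by simp⟩
  infer_instance

theorem eLpNorm_le_of_bound {p : ℝ≥0∞} {f : (Fin d → ℝ) → ℝ} {C : ℝ} (h : ∀ x, |f x| ≤ C) :
    eLpNorm f p (volume.restrict (cube d)) ≤ ENNReal.ofReal C := by
  refine (eLpNorm_le_of_ae_bound (.of_forall h)).trans_eq ?_
  rw [measure_univ, ENNReal.one_rpow, one_mul]

theorem prod_sawtooth_mem (k : Fin d → ℕ) (S : Finset (Fin d)) (x : Fin d → ℝ) :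
    ∏ j ∈ S, sawtooth (k j) (x j) ∈ Set.Icc (0 : ℝ) 1 :=
  ⟨Finset.prod_nonneg fun _ _ => (sawtooth_mem _ _).1,
    Finset.prod_le_one (fun _ _ => (sawtooth_mem _ _).1) fun _ _ => (sawtooth_mem _ _).2⟩

theorem continuous_prod_sawtooth (k : Fin d → ℕ) (S : Finset (Fin d)) :
    Continuous fun x : Fin d → ℝ => ∏ j ∈ S, sawtooth (k j) (x j) :=
  continuous_finsetProd _ fun j _ => (continuous_sawtooth (k j)).comp (continuous_apply j)

/-- The integral of the p-th power factorizes over the coordinates, and each of the d - 1 sawtooths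
gains (p+1)^(-1/p). This is where the p-dependent exponential factor of `B` comes from. -/
theorem eLpNorm_prod_sawtooth_le {p : ℝ≥0∞} (hp : 1 ≤ p) (k : Fin d → ℕ) (i : Fin d) :
    eLpNorm (fun x : Fin d → ℝ => ∏ j ∈ Finset.univ.erase i, sawtooth (k j) (x j)) p
      (volume.restrict (cube d)) ≤ ENNReal.ofReal (((pPow p 1)⁻¹) ^ (d - 1)) := by
  have hb : ∀ x : Fin d → ℝ, |∏ j ∈ Finset.univ.erase i, sawtooth (k j) (x j)| ≤ 1 := fun x => by
    have := prod_sawtooth_mem k (Finset.univ.erase i) x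
    rw [abs_of_nonneg this.1]
    exact this.2
  by_cases hpt : p = ⊤
  · refine (eLpNorm_le_of_bound hb).trans_eq ?_
    simp [pPow, hpt]
  have hp0 : p ≠ 0 := (zero_lt_one.trans_le hp).ne'
  have hpr : 0 < p.toReal := ENNReal.toReal_pos hp0 hpt
  have hm : MemLp (fun x : Fin d → ℝ => ∏ j ∈ Finset.univ.erase i, sawtooth (k j) (x j)) p
      (volume.restrict (cube d)) :=
    MemLp.of_bound (continuous_prod_sawtooth k _).aestronglyMeasurable 1 (.of_forall hb)
  rw [hm.eLpNorm_eq_integral_rpow_norm hp0 hpt]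
  refine ENNReal.ofReal_le_ofReal ?_
  have e : ∀ x : Fin d → ℝ, ‖∏ j ∈ Finset.univ.erase i, sawtooth (k j) (x j)‖ ^ p.toReal
      = ∏ j, (fun j t => if j = i then 1 else sawtooth (k j) t ^ p.toReal) j (x j) := by
    intro x
    rw [Real.norm_of_nonneg (prod_sawtooth_mem k _ x).1,
      ← Real.finsetProd_rpow _ _ (fun j _ => (sawtooth_mem _ _).1),
      ← Finset.mul_prod_erase _ _ (Finset.mem_univ i)]
    simp only [if_true, one_mul]
    exact Finset.prod_congr rfl fun j hj => (if_neg (Finset.ne_of_mem_erase hj)).symm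
  rw [integral_congr_ae (.of_forall e), volume_restrict_cube, integral_fintype_prod_eq_prod
    (fun j t => if j = i then 1 else sawtooth (k j) t ^ p.toReal),
    ← Finset.mul_prod_erase _ _ (Finset.mem_univ i)]
  have h1 : ∏ j ∈ Finset.univ.erase i, ∫ t in Set.Icc (0 : ℝ) 1,
      (if j = i then 1 else sawtooth (k j) t ^ p.toReal) ≤ ((p.toReal + 1)⁻¹) ^ (d - 1) := by
    calc _ ≤ ∏ j ∈ Finset.univ.erase i, (p.toReal + 1)⁻¹ := by
          refine Finset.prod_le_prod (fun j _ => ?_) fun j hj => ?_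
          · refine integral_nonneg fun t => ?_
            split_ifs
            · exact zero_le_one
            · exact Real.rpow_nonneg (sawtooth_mem _ _).1 _
          · simp only [if_neg (Finset.ne_of_mem_erase hj)]
            exact setIntegral_sawtooth_rpow_le _ hpr
      _ = _ := by
          rw [Finset.prod_const, Finset.card_erase_of_mem (Finset.mem_univ i), Finset.card_univ,
            Fintype.card_fin]
  have h0 : 0 ≤ ∏ j ∈ Finset.univ.erase i, ∫ t in Set.Icc (0 : ℝ) 1,
      (if j = i then 1 else sawtooth (k j) t ^ p.toReal) := by
    refine Finset.prod_nonneg fun j _ => integral_nonneg fun t => ?_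
    split_ifs
    · exact zero_le_one
    · exact Real.rpow_nonneg (sawtooth_mem _ _).1 _
  simp only [if_true, integral_const, measureReal_restrict_apply_univ, Real.volume_real_Icc, sub_zero,
    zero_le_one, sup_of_le_left, smul_eq_mul, mul_one, one_mul]
  refine (Real.rpow_le_rpow h0 h1 (by positivity)).trans_eq ?_
  rw [pPow, if_neg hpt, one_div, ← Real.rpow_natCast, ← Real.rpow_natCast,
    ← Real.rpow_mul (by positivity), ← Real.inv_rpow (by positivity),
    ← Real.rpow_mul (by positivity), mul_comm]

/-- Minkowski's inequality for series. -/
theorem eLpNorm_tsum_le {p : ℝ≥0∞} (hp : 1 ≤ p) {μ : Measure (Fin d → ℝ)} {ι : Type*} [Countable ι]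
    {g : ι → (Fin d → ℝ) → ℝ} (hg : ∀ k, AEStronglyMeasurable (g k) μ)
    (hs : ∀ x, Summable fun k => g k x) :
    eLpNorm (fun x => ∑' k, g k x) p μ ≤ ∑' k, eLpNorm (g k) p μ := by
  refine Lp.eLpNorm_le_of_ae_tendsto (u := Filter.atTop) (f := fun S : Finset ι => ∑ k ∈ S, g k)
    (.of_forall fun S => (eLpNorm_sum_le (fun k _ => hg k) hp).trans (ENNReal.sum_le_tsum S))
    (fun S => Finset.aestronglyMeasurable_sum S fun k _ => hg k) (.of_forall fun x => ?_)
  simp only [Finset.sum_apply]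
  exact (hs x).hasSum

end

noncomputable section

variable {d : ℕ}

/-! ### Lipschitz functions that vanish outside of the cube -/

/-- Pass from x to y by changing one coordinate at a time. -/
theorem lipschitzWith_of_update {F : (Fin d → ℝ) → ℝ} {C : NNReal}
    (h : ∀ x i t, |F (Function.update x i t) - F x| ≤ C * |t - x i|) :
    LipschitzWith (d * C) F := by
  classical
  refine LipschitzWith.of_dist_le_mul fun y x => ?_
  have key : ∀ S : Finset (Fin d), |F (S.piecewise y x) - F x| ≤ ∑ _i ∈ S, C * dist y x := by
    intro S
    induction S using Finset.induction_on with
    | empty => simp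
    | insert i S hi ih =>
      rw [Finset.piecewise_insert, Finset.sum_insert hi]
      have h1 := h (S.piecewise y x) i (y i)
      rw [Finset.piecewise_eq_of_notMem _ _ _ hi] at h1
      have h2 : C * |y i - x i| ≤ C * dist y x := by
        gcongr
        rw [← Real.dist_eq]
        exact dist_le_pi_dist y x i
      rw [← sub_add_sub_cancel _ (F (S.piecewise y x))]
      exact (abs_add_le _ _).trans (add_le_add (h1.trans h2) ih)
  have := key Finset.univ
  rw [Finset.piecewise_univ, Finset.sum_const, Finset.card_univ, Fintype.card_fin, nsmul_eq_mul]
    at this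
  rw [Real.dist_eq]
  push_cast
  rwa [mul_assoc]

theorem add_smul_single_eq_update (x : Fin d → ℝ) (i : Fin d) (t : ℝ) :
    x + t • Pi.single i (1 : ℝ) = Function.update x i (x i + t) := by
  funext j
  by_cases hj : j = i
  · subst hj; simp
  · simp [hj]

/-- The constant c may depend on x, so the sawtooth factors survive in the bound for the gradient.
-/
theorem abs_lineDeriv_le_of_update {F : (Fin d → ℝ) → ℝ} {x : Fin d → ℝ} {i : Fin d} {c : ℝ}
    (hc : 0 ≤ c) (h : ∀ t, |F (Function.update x i t) - F x| ≤ c * |t - x i|) :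
    |lineDeriv ℝ F x (Pi.single i 1)| ≤ c := by
  refine norm_deriv_le_of_lip' (f := fun t : ℝ => F (x + t • Pi.single i (1 : ℝ))) hc
    (.of_forall fun t => ?_)
  simp only [add_smul_single_eq_update, add_zero, Function.update_eq_self, sub_zero]
  simpa using h (x i + t)

theorem lineDeriv_eq_zero_of_notMem_cube {F : (Fin d → ℝ) → ℝ} (hF : ∀ x, x ∉ cube d → F x = 0)
    {x : Fin d → ℝ} (hx : x ∉ cube d) (v : Fin d → ℝ) : lineDeriv ℝ F x v = 0 := by
  have ho : IsOpen (cube d)ᶜ := isClosed_Icc.isOpen_compl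
  have h : F =ᶠ[nhds x] fun _ => 0 := by
    filter_upwards [ho.mem_nhds hx] with y hy using hF y hy
  rw [h.lineDeriv_eq]
  simp [lineDeriv]

/-- A Lipschitz function on the whole space that vanishes outside of the cube belongs to the
Sobolev space with zero trace. -/
theorem isW10Gradient_lineDeriv {p : ℝ≥0∞} {F u : (Fin d → ℝ) → ℝ} {C : NNReal}
    (hF : LipschitzWith C F) (h0 : ∀ x, x ∉ cube d → F x = 0) (hu : ∀ x ∈ cube d, u x = F x) :
    IsW10Gradient p u fun i x => lineDeriv ℝ F x (Pi.single i 1) := by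
  have hae : u =ᵐ[volume.restrict (cube d)] F := ae_restrict_of_forall_mem (measurableSet_cube d) hu
  have htr : HasZeroTrace u fun i x => lineDeriv ℝ F x (Pi.single i 1) := by
    intro i φ hφ hφc
    obtain ⟨D, hD⟩ := hφ.lipschitzWith_of_hasCompactSupport hφc (by simp)
    -- Integration by parts over the whole space. No boundary term arises, although φ need not
    -- vanish near the boundary, because F is zero outside of the cube.
    have hparts := LipschitzWith.integral_lineDeriv_mul_eq (μ := volume) hF hD hφc
      (Pi.single i (1 : ℝ))
    have e1 : ∫ x in cube d, u x * fderiv ℝ φ x (Pi.single i 1)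
        = ∫ x, F x * fderiv ℝ φ x (Pi.single i 1) := by
      rw [← setIntegral_eq_integral_of_forall_compl_eq_zero (s := cube d)
        (f := fun x => F x * fderiv ℝ φ x (Pi.single i 1)) fun x hx => by rw [h0 x hx, zero_mul]]
      exact setIntegral_congr_fun (measurableSet_cube d) fun x hx => by simp only [hu x hx]
    have e2 : ∫ x in cube d, lineDeriv ℝ F x (Pi.single i 1) * φ x
        = ∫ x, lineDeriv ℝ F x (Pi.single i 1) * φ x :=
      setIntegral_eq_integral_of_forall_compl_eq_zero fun x hx => by
        rw [lineDeriv_eq_zero_of_notMem_cube h0 hx, zero_mul]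
    have e3 : ∀ x, lineDeriv ℝ φ x (-Pi.single i (1 : ℝ)) * F x
        = -(F x * fderiv ℝ φ x (Pi.single i 1)) := fun x => by
      rw [(hφ.differentiable (by simp)).differentiableAt.lineDeriv_eq_fderiv, map_neg]; ring
    rw [e1, e2, hparts, integral_congr_ae (.of_forall e3), integral_neg, add_neg_cancel]
  refine ⟨?_, fun i => ?_, fun i φ hφ hφc _ => ?_, htr⟩
  · rw [memLp_congr_ae hae]
    obtain ⟨K, hK⟩ := (isCompact_Icc (a := (0 : Fin d → ℝ)) (b := 1)).exists_bound_of_continuousOn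
      hF.continuous.continuousOn
    exact MemLp.of_bound hF.continuous.aestronglyMeasurable K
      (ae_restrict_of_forall_mem (measurableSet_cube d) hK)
  · exact MemLp.of_bound (aestronglyMeasurable_lineDeriv hF.continuous _)
      (C * ‖(Pi.single i 1 : Fin d → ℝ)‖) (.of_forall fun x =>
        norm_lineDeriv_le_of_lipschitz ℝ hF)
  · exact eq_neg_of_add_eq_zero_left (htr i φ hφ hφc)

/-- The factor d^(1/p) is estimated by d; the d² in the choice of m and M pays for it. -/
theorem gradNorm_le {p : ℝ≥0∞} (hp : 1 ≤ p) (hd : 1 ≤ d) {g : Fin d → (Fin d → ℝ) → ℝ} {E : ℝ≥0∞}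
    (hg : ∀ i, eLpNorm (g i) p (volume.restrict (cube d)) ≤ E) : gradNorm p g ≤ d * E := by
  have hd' : (1 : ℝ≥0∞) ≤ d := by exact_mod_cast hd
  unfold gradNorm
  split_ifs with hpt
  · subst hpt
    refine iSup_le fun i => ?_
    have h1 := hg i
    rw [eLpNorm_exponent_top] at h1
    exact h1.trans (le_mul_of_one_le_left' hd')
  · have hp0 : p ≠ 0 := (zero_lt_one.trans_le hp).ne'
    have hpr : 0 < p.toReal := ENNReal.toReal_pos hp0 hpt
    have hp1 : 1 ≤ p.toReal := by
      rw [← ENNReal.toReal_one]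
      exact ENNReal.toReal_mono hpt hp
    have h1 : ∀ i, ∫⁻ x in cube d, ‖g i x‖ₑ ^ p.toReal ≤ E ^ p.toReal := fun i => by
      have h1 := hg i
      rw [eLpNorm_eq_lintegral_rpow_enorm_toReal hp0 hpt, one_div, ENNReal.rpow_inv_le_iff hpr] at h1
      exact h1
    calc _ ≤ (∑ _i : Fin d, E ^ p.toReal) ^ (1 / p.toReal) := by
          gcongr with i
          exact h1 i
      _ = (d : ℝ≥0∞) ^ (1 / p.toReal) * E := by
          rw [Finset.sum_const, Finset.card_univ, Fintype.card_fin, nsmul_eq_mul,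
            ENNReal.mul_rpow_of_nonneg _ _ (by positivity), ← ENNReal.rpow_mul,
            mul_one_div_cancel hpr.ne', ENNReal.rpow_one]
      _ ≤ (d : ℝ≥0∞) ^ (1 : ℝ) * E := by
          gcongr
          rw [div_le_one hpr]; exact hp1
      _ = d * E := by rw [ENNReal.rpow_one]

/-! ### Estimates for a single level -/

theorem sum_positions_mul (k : Fin d → ℕ) (i : Fin d) (w : ℕ → ℝ) (v : Fin d → ℕ → ℝ) :
    ∑ s ∈ positions k, w (s i) * ∏ j ∈ Finset.univ.erase i, v j (s j)
      = (∑ a ∈ Finset.range (2 ^ k i), w a)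
        * ∏ j ∈ Finset.univ.erase i, ∑ a ∈ Finset.range (2 ^ k j), v j a := by
  have h := Finset.prod_univ_sum (fun j => Finset.range (2 ^ k j))
    (fun j a => if j = i then w a else v j a)
  rw [← Finset.mul_prod_erase _ _ (Finset.mem_univ i)] at h
  simp only [if_true] at h
  rw [Finset.prod_congr rfl fun j hj => Finset.sum_congr rfl fun a _ =>
    if_neg (Finset.ne_of_mem_erase hj)] at h
  rw [h]
  refine Finset.sum_congr rfl fun s _ => ?_
  rw [← Finset.mul_prod_erase _ (fun j => if j = i then w (s j) else v j (s j)) (Finset.mem_univ i)]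
  simp only [if_true]
  congr 1
  exact Finset.prod_congr rfl fun j hj => (if_neg (Finset.ne_of_mem_erase hj)).symm

theorem prod_hat_update (k s : Fin d → ℕ) (x : Fin d → ℝ) (i : Fin d) (t : ℝ) :
    ∏ j, hat (k j) (s j) (Function.update x i t j)
      = hat (k i) (s i) t * ∏ j ∈ Finset.univ.erase i, hat (k j) (s j) (x j) := by
  rw [← Finset.mul_prod_erase _ _ (Finset.mem_univ i), Function.update_self]
  congr 1
  exact Finset.prod_congr rfl fun j hj => by
    rw [Function.update_of_ne (Finset.ne_of_mem_erase hj)]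

theorem abs_level_le {f : (Fin d → ℝ) → ℝ} {k : Fin d → ℕ} {c : ℝ}
    (hc : ∀ s ∈ positions k, |coef f k s| ≤ c) (x : Fin d → ℝ) (hc0 : 0 ≤ c) :
    |level f k x| ≤ c := by
  have h0 : ∀ s : Fin d → ℕ, 0 ≤ ∏ j, hat (k j) (s j) (x j) := fun s =>
    Finset.prod_nonneg fun j _ => (hat_mem _ _ _).1
  calc |level f k x| ≤ ∑ s ∈ positions k, c * ∏ j, hat (k j) (s j) (x j) := by
        refine (Finset.abs_sum_le_sum_abs _ _).trans (Finset.sum_le_sum fun s hs => ?_)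
        rw [abs_mul, abs_of_nonneg (h0 s)]
        exact mul_le_mul_of_nonneg_right (hc s hs) (h0 s)
    _ = c * ∏ j, sawtooth (k j) (x j) := by
        rw [← Finset.mul_sum, positions, ← Finset.prod_univ_sum (fun j => Finset.range (2 ^ k j))
          fun j a => hat (k j) a (x j)]
        rfl
    _ ≤ c := mul_le_of_le_one_right hc0 (prod_sawtooth_mem k _ x).2

/-- In direction i the hats vary with total slope 2^(k_i+1), while the other factors sum up to
sawtooths. These are kept rather than bounded by 1, for the sake of their L_p norm. -/
theorem abs_level_update_sub_le {f : (Fin d → ℝ) → ℝ} {k : Fin d → ℕ} {c : ℝ}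
    (hc : ∀ s ∈ positions k, |coef f k s| ≤ c) (hc0 : 0 ≤ c) (x : Fin d → ℝ) (i : Fin d) (t : ℝ) :
    |level f k (Function.update x i t) - level f k x|
      ≤ c * 2 ^ (k i + 1) * (∏ j ∈ Finset.univ.erase i, sawtooth (k j) (x j)) * |t - x i| := by
  have h0 : ∀ s : Fin d → ℕ, 0 ≤ ∏ j ∈ Finset.univ.erase i, hat (k j) (s j) (x j) := fun s =>
    Finset.prod_nonneg fun j _ => (hat_mem _ _ _).1
  calc |level f k (Function.update x i t) - level f k x|
      ≤ ∑ s ∈ positions k, c * (|hat (k i) (s i) t - hat (k i) (s i) (x i)|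
        * ∏ j ∈ Finset.univ.erase i, hat (k j) (s j) (x j)) := by
        rw [level, level, ← Finset.sum_sub_distrib]
        refine (Finset.abs_sum_le_sum_abs _ _).trans (Finset.sum_le_sum fun s hs => ?_)
        rw [prod_hat_update, ← Finset.mul_prod_erase _ (fun j => hat (k j) (s j) (x j))
          (Finset.mem_univ i), ← mul_sub, ← sub_mul, abs_mul, abs_mul, abs_of_nonneg (h0 s)]
        exact mul_le_mul_of_nonneg_right (hc s hs) (mul_nonneg (abs_nonneg _) (h0 s))
    _ = c * ((∑ a ∈ Finset.range (2 ^ k i), |hat (k i) a t - hat (k i) a (x i)|)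
        * ∏ j ∈ Finset.univ.erase i, sawtooth (k j) (x j)) := by
        rw [← Finset.mul_sum, sum_positions_mul k i (fun a => |hat (k i) a t - hat (k i) a (x i)|)
          fun j a => hat (k j) a (x j)]
        rfl
    _ ≤ c * ((2 ^ (k i + 1) * |t - x i|) * ∏ j ∈ Finset.univ.erase i, sawtooth (k j) (x j)) := by
        refine mul_le_mul_of_nonneg_left (mul_le_mul_of_nonneg_right (sum_abs_hat_sub_le _ _ _)
          (prod_sawtooth_mem k _ x).1) hc0
    _ = _ := by ring

/-- The network approximation of the term of level `k`. -/
def levelApprox (M : ℕ) (f : (Fin d → ℝ) → ℝ) (k : Fin d → ℕ) (x : Fin d → ℝ) : ℝ :=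
  ∑ s ∈ positions k, coef f k s * prodApprox M (hatSeq k s x) d

theorem prod_hatSeq (k s : Fin d → ℕ) (x : Fin d → ℝ) :
    ∏ j ∈ Finset.range d, hatSeq k s x j = ∏ j, hat (k j) (s j) (x j) := by
  rw [Finset.prod_range]
  exact Finset.prod_congr rfl fun j _ => by rw [hatSeq, dif_pos j.2]

theorem prodApprox_hatSeq_eq_zero (M : ℕ) {k s : Fin d → ℕ} {x : Fin d → ℝ} {i : Fin d}
    (h : hat (k i) (s i) (x i) = 0) : prodApprox M (hatSeq k s x) d = 0 :=
  prodApprox_eq_zero M (hatSeq_mem k s x) i.2 (by rw [hatSeq, dif_pos i.2]; exact h)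

theorem sum_indicator_hat_le (k : ℕ) (t : ℝ) :
    ∑ s ∈ Finset.range (2 ^ k), (if hat k s t = 0 then 0 else 1 : ℝ) ≤ 1 := by
  by_cases h : ⌊2 ^ k * t⌋₊ ∈ Finset.range (2 ^ k)
  · rw [Finset.sum_eq_single_of_mem _ h fun s _ hs => if_pos (hat_eq_zero_of_ne_floor hs)]
    split_ifs <;> norm_num
  · rw [Finset.sum_eq_zero fun s hs => if_pos (hat_eq_zero_of_ne_floor fun e => h (e ▸ hs))]
    exact zero_le_one

/-- If another hat vanishes at x, then so do the product and its approximation, before and after the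
update. The indicators record this, so that summing over the positions does not cost a factor 2^|k|.
-/
theorem abs_prodApprox_hatSeq_error_le {M : ℕ} (hM : 2 * d * (1 / 2 : ℝ) ^ M ≤ 1)
    (k s : Fin d → ℕ) (x : Fin d → ℝ) (i : Fin d) (t : ℝ) :
    |(∏ j, hat (k j) (s j) (Function.update x i t j)
        - prodApprox M (hatSeq k s (Function.update x i t)) d)
      - (∏ j, hat (k j) (s j) (x j) - prodApprox M (hatSeq k s x) d)|
      ≤ 2 * d * (1 / 2) ^ M * (|hat (k i) (s i) t - hat (k i) (s i) (x i)|
        * ∏ j ∈ Finset.univ.erase i, (if hat (k j) (s j) (x j) = 0 then 0 else 1 : ℝ)) := by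
  by_cases h : ∃ j ∈ Finset.univ.erase i, hat (k j) (s j) (x j) = 0
  · obtain ⟨j, hj, hz⟩ := h
    have hz' : hat (k j) (s j) (Function.update x i t j) = 0 := by
      rwa [Function.update_of_ne (Finset.ne_of_mem_erase hj)]
    have hz'' : ∏ j ∈ Finset.univ.erase i, (if hat (k j) (s j) (x j) = 0 then 0 else 1 : ℝ) = 0 :=
      Finset.prod_eq_zero hj (if_pos hz)
    rw [Finset.prod_eq_zero (Finset.mem_univ j) hz', Finset.prod_eq_zero (Finset.mem_univ j) hz,
      prodApprox_hatSeq_eq_zero M hz, prodApprox_hatSeq_eq_zero M hz', hz'']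
    simp
  · push Not at h
    rw [Finset.prod_congr rfl fun j hj => if_neg (h j hj), Finset.prod_const_one, mul_one,
      ← prod_hatSeq, ← prod_hatSeq]
    have h1 := abs_prodApprox_error_sub_le M (hatSeq_mem k s (Function.update x i t))
      (hatSeq_mem k s x) (i := i) (fun j hj => ?_) d hM
    · have e1 : hatSeq k s (Function.update x i t) i = hat (k i) (s i) t := by
        rw [hatSeq, dif_pos i.2]; simp
      have e2 : hatSeq k s x i = hat (k i) (s i) (x i) := by
        rw [hatSeq, dif_pos i.2]
      rw [e1, e2, ← abs_neg] at h1
      refine le_trans (le_of_eq ?_) h1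
      congr 1
      ring
    · unfold hatSeq
      split_ifs with hjd
      · rw [Function.update_of_ne (fun e => hj (by rw [← e]))]
      · rfl

theorem abs_levelError_update_sub_le {f : (Fin d → ℝ) → ℝ} {k : Fin d → ℕ} {c : ℝ}
    (hc : ∀ s ∈ positions k, |coef f k s| ≤ c) (hc0 : 0 ≤ c) {M : ℕ}
    (hM : 2 * d * (1 / 2 : ℝ) ^ M ≤ 1) (x : Fin d → ℝ) (i : Fin d) (t : ℝ) :
    |(level f k (Function.update x i t) - levelApprox M f k (Function.update x i t))
      - (level f k x - levelApprox M f k x)|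
      ≤ c * 2 ^ (k i + 1) * (2 * d * (1 / 2) ^ M) * |t - x i| := by
  set δ : ℝ := 2 * d * (1 / 2) ^ M with hδ
  have hδ0 : 0 ≤ δ := by positivity
  calc _ ≤ ∑ s ∈ positions k, c * (δ * (|hat (k i) (s i) t - hat (k i) (s i) (x i)|
        * ∏ j ∈ Finset.univ.erase i, (if hat (k j) (s j) (x j) = 0 then 0 else 1 : ℝ))) := by
        rw [level, level, levelApprox, levelApprox, ← Finset.sum_sub_distrib,
          ← Finset.sum_sub_distrib, ← Finset.sum_sub_distrib]
        refine (Finset.abs_sum_le_sum_abs _ _).trans (Finset.sum_le_sum fun s hs => ?_)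
        rw [← mul_sub, ← mul_sub, ← mul_sub, abs_mul]
        exact mul_le_mul (hc s hs) (abs_prodApprox_hatSeq_error_le hM k s x i t) (abs_nonneg _) hc0
    _ = c * (δ * ((∑ a ∈ Finset.range (2 ^ k i), |hat (k i) a t - hat (k i) a (x i)|)
        * ∏ j ∈ Finset.univ.erase i, ∑ a ∈ Finset.range (2 ^ k j),
          (if hat (k j) a (x j) = 0 then 0 else 1 : ℝ))) := by
        rw [← Finset.mul_sum, ← Finset.mul_sum,
          sum_positions_mul k i (fun a => |hat (k i) a t - hat (k i) a (x i)|)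
          fun j a => if hat (k j) a (x j) = 0 then 0 else 1]
    _ ≤ c * (δ * ((2 ^ (k i + 1) * |t - x i|) * 1)) := by
        gcongr
        · exact sum_abs_hat_sub_le _ _ _
        · exact Finset.prod_le_one
            (fun j _ => Finset.sum_nonneg fun a _ => by split_ifs <;> norm_num)
            fun j _ => sum_indicator_hat_le _ _
    _ = _ := by ring

end

noncomputable section

variable {d : ℕ}

/-! ### The coefficients of functions in the unit ball -/

/-- The projection onto the cube. -/
def clamp (x : Fin d → ℝ) : Fin d → ℝ := fun i => max 0 (min 1 (x i))

theorem clamp_mem (x : Fin d → ℝ) : clamp x ∈ cube d :=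
  ⟨fun _ => le_max_left _ _, fun _ => max_le zero_le_one (min_le_left _ _)⟩

theorem clamp_eq_self {x : Fin d → ℝ} (hx : x ∈ cube d) : clamp x = x := by
  funext i
  rw [clamp, min_eq_right (show x i ≤ 1 from hx.2 i), max_eq_right (show 0 ≤ x i from hx.1 i)]

theorem continuous_clamp : Continuous (clamp (d := d)) := by
  unfold clamp
  fun_prop

theorem InUnitBall.continuous_comp_clamp {α : ℝ} {f : (Fin d → ℝ) → ℝ} (hf : InUnitBall α f) :
    Continuous fun x => f (clamp x) :=
  hf.continuousOn.comp_continuous continuous_clamp clamp_mem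

/-- Composition with `clamp` is thus a continuous extension of f by zero to the whole space. -/
theorem InUnitBall.comp_clamp_eq_zero {α : ℝ} {f : (Fin d → ℝ) → ℝ} (hf : InUnitBall α f)
    {x : Fin d → ℝ} (hx : ∃ i, x i ≤ 0 ∨ 1 ≤ x i) : f (clamp x) = 0 := by
  obtain ⟨i, hi⟩ := hx
  refine hf.boundary _ (clamp_mem x) ⟨i, hi.imp (fun h => ?_) fun h => ?_⟩
  · rw [clamp, min_eq_right (by linarith), max_eq_left h]
  · rw [clamp, min_eq_left h, max_eq_right zero_le_one]

theorem mixedDiff_congr {u : Finset (Fin d)} {h : Fin d → ℝ} {f g : (Fin d → ℝ) → ℝ}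
    (hfg : ∀ x ∈ cube d, f x = g x) (hh : ∀ i ∈ u, 0 ≤ h i) {x : Fin d → ℝ}
    (hx : x ∈ diffDomain u h) : mixedDiff u h f x = mixedDiff u h g x := by
  classical
  induction u using Finset.induction_on generalizing x with
  | empty => rw [mixedDiff_empty, mixedDiff_empty, hfg x hx.1]
  | insert i u hi ih =>
    have hhi := hh i (Finset.mem_insert_self i u)
    have hxi := hx.2 i (Finset.mem_insert_self i u)
    have hx0 : 0 ≤ x i := hx.1.1 i
    have key : ∀ t, 0 ≤ t → t ≤ 2 * h i → x + Pi.single i t ∈ diffDomain u h := by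
      intro t ht0 ht1
      refine ⟨⟨fun j => ?_, fun j => ?_⟩, fun j hj => ?_⟩
      · by_cases hj : j = i
        · subst hj; simp; linarith
        · simpa [hj] using hx.1.1 j
      · by_cases hj : j = i
        · subst hj; simp; linarith [hxi.2]
        · simpa [hj] using hx.1.2 j
      · have hji : j ≠ i := fun e => hi (e ▸ hj)
        simpa [hji] using hx.2 j (Finset.mem_insert_of_mem hj)
    have ih' := fun t h0 h1 => ih (fun j hj => hh j (Finset.mem_insert_of_mem hj)) (key t h0 h1)
    have h3 := ih' 0 le_rfl (by linarith)
    rw [Pi.single_zero, add_zero] at h3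
    rw [mixedDiff_insert hi, mixedDiff_insert hi, ih' _ (by linarith) le_rfl,
      ih' _ hhi (by linarith), h3]

theorem InUnitBall.abs_mixedDiff_le {α : ℝ} {f : (Fin d → ℝ) → ℝ} (hf : InUnitBall α f)
    {u : Finset (Fin d)} {h : Fin d → ℝ} (hh : ∀ i ∈ u, 0 < h i) {x : Fin d → ℝ}
    (hx : x ∈ diffDomain u h) : |mixedDiff u h f x| ≤ ∏ i ∈ u, h i ^ α := by
  have h1 : ENNReal.ofReal ((∏ i ∈ u, h i ^ (-α)) * |mixedDiff u h f x|) ≤ 1 := by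
    refine le_trans ?_ hf.norm_le_one
    exact le_iSup_of_le u (le_iSup_of_le h (le_iSup_of_le hh (le_iSup_of_le x
      (le_iSup_of_le hx le_rfl))))
  rw [ENNReal.ofReal_le_one] at h1
  have h2 : ∏ i ∈ u, h i ^ (-α) = (∏ i ∈ u, h i ^ α)⁻¹ := by
    rw [← Finset.prod_inv_distrib]
    exact Finset.prod_congr rfl fun i hi => Real.rpow_neg (hh i hi).le α
  have h3 : 0 < ∏ i ∈ u, h i ^ α := Finset.prod_pos fun i hi => Real.rpow_pos_of_pos (hh i hi) α
  rw [h2, inv_mul_le_iff₀ h3, mul_one] at h1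
  exact h1

/-- The bound `2 ^ (-(α + 1) d - α |k|)` for the coefficients of level `k`. -/
def coefBound (α : ℝ) (k : Fin d → ℕ) : ℝ :=
  (2 : ℝ) ^ (-((α + 1) * d)) * (2 : ℝ) ^ (-(α * ∑ j, (k j : ℝ)))

theorem coefBound_nonneg (α : ℝ) (k : Fin d → ℕ) : 0 ≤ coefBound α k := by
  unfold coefBound; positivity

/-- The steps 2^(-(k_j+1)) in all d variables give 2^(-α(|k|+d)), and the prefactor of `coef` gives
2^(-d). -/
theorem InUnitBall.abs_coef_le {α : ℝ} {f : (Fin d → ℝ) → ℝ} (hf : InUnitBall α f)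
    {k s : Fin d → ℕ} (hs : s ∈ positions k) :
    |coef (fun x => f (clamp x)) k s| ≤ coefBound α k := by
  have hdom : (fun j => (s j : ℝ) / 2 ^ k j) ∈ diffDomain Finset.univ
      (fun j => (1 : ℝ) / 2 ^ (k j + 1)) := by
    have hs' : ∀ j, (s j : ℝ) + 1 ≤ 2 ^ k j := fun j => by
      have := Finset.mem_range.1 (Fintype.mem_piFinset.1 hs j)
      exact_mod_cast this
    refine ⟨⟨fun j => by simp only [Pi.zero_apply]; positivity, fun j => ?_⟩, fun j _ =>
      ⟨by positivity, ?_⟩⟩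
    · simp only [Pi.one_apply]
      rw [div_le_one (by positivity)]
      linarith [hs' j]
    · dsimp only
      rw [pow_succ, show (s j : ℝ) / 2 ^ k j + 2 * (1 / (2 ^ k j * 2)) = (s j + 1) / 2 ^ k j by
        field_simp, div_le_one (by positivity)]
      exact hs' j
  rw [coef, mixedDiff_congr (g := f) (fun x hx => by rw [clamp_eq_self hx])
    (fun i _ => by positivity) hdom, abs_mul, abs_pow, abs_neg, abs_of_pos (by norm_num)]
  have h1 := hf.abs_mixedDiff_le (fun i _ => by positivity) hdom
  have h2 : ∏ j : Fin d, ((1 : ℝ) / 2 ^ (k j + 1)) ^ α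
      = (2 : ℝ) ^ (-(α * ∑ j, (k j : ℝ)) - α * d) := by
    have : ∀ j, ((1 : ℝ) / 2 ^ (k j + 1)) ^ α = (2 : ℝ) ^ (-(α * (k j + 1))) := fun j => by
      rw [one_div, ← Real.rpow_natCast, ← Real.rpow_neg (by norm_num),
        ← Real.rpow_mul (by norm_num)]
      congr 1
      push_cast
      ring
    rw [Finset.prod_congr rfl fun j _ => this j, ← Real.rpow_sum_of_pos (by norm_num)]
    congr 1
    rw [Finset.sum_neg_distrib, ← Finset.mul_sum, Finset.sum_add_distrib]
    simp
    ring
  rw [h2] at h1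
  refine (mul_le_mul_of_nonneg_left h1 (by positivity)).trans_eq ?_
  rw [coefBound, one_div, ← Real.rpow_natCast, Real.inv_rpow (by norm_num),
    ← Real.rpow_neg (by norm_num), ← Real.rpow_add (by norm_num), ← Real.rpow_add (by norm_num)]
  congr 1
  ring

/-- Coefficient times slope of the hat: this product is what makes `weight` the quantity to be
summed over the levels. -/
theorem coefBound_mul (α : ℝ) (k : Fin d → ℕ) (i : Fin d) :
    coefBound α k * 2 ^ (k i + 1) = 2 * (2 : ℝ) ^ (-((α + 1) * d)) * weight α i k := by
  rw [coefBound, weight, sub_eq_add_neg, Real.rpow_add (by norm_num), Real.rpow_natCast, pow_succ]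
  ring

theorem weight_nonneg (α : ℝ) (i : Fin d) (k : Fin d → ℕ) : 0 ≤ weight α i k := by
  unfold weight; positivity

theorem summable_weight {α : ℝ} (hα : 1 < α) (i : Fin d) :
    Summable fun k : Fin d → ℕ => weight α i k := by
  have h := ENNReal.summable_toReal ((tsum_weight_le hα i).trans_lt ENNReal.ofReal_lt_top).ne
  simpa only [ENNReal.toReal_ofReal (weight_nonneg α i _)] using h

theorem tsum_weight_le_real {α : ℝ} (hα : 1 < α) (i : Fin d) :
    ∑' k : Fin d → ℕ, weight α i k
      ≤ (1 - (2 : ℝ) ^ (1 - α))⁻¹ * ((1 - (2 : ℝ) ^ (-α))⁻¹) ^ (d - 1) := by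
  have h1 := two_rpow_lt_one (show 1 - α < 0 by linarith)
  have h2 := two_rpow_lt_one (show -α < 0 by linarith)
  have h3 : 0 ≤ (1 - (2 : ℝ) ^ (1 - α))⁻¹ := inv_nonneg.2 (by linarith)
  have h4 : 0 ≤ (1 - (2 : ℝ) ^ (-α))⁻¹ := inv_nonneg.2 (by linarith)
  have h := tsum_weight_le hα i
  rw [← ENNReal.ofReal_tsum_of_nonneg (weight_nonneg α i) (summable_weight hα i),
    ENNReal.ofReal_le_ofReal_iff (by positivity)] at h
  exact h

theorem coefBound_le_weight (α : ℝ) (k : Fin d → ℕ) (i : Fin d) :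
    coefBound α k ≤ 2 * (2 : ℝ) ^ (-((α + 1) * d)) * weight α i k := by
  rw [← coefBound_mul]
  exact le_mul_of_one_le_right (coefBound_nonneg α k) (one_le_pow₀ (by norm_num))

/-! ### The error of the sparse grid network -/

/-- The function that the network computes on the cube. -/
def gridApprox (M : ℕ) (L : Finset (Fin d → ℕ)) (f : (Fin d → ℝ) → ℝ) (x : Fin d → ℝ) : ℝ :=
  ∑ k ∈ L, levelApprox M f k x

/-- The bound for the derivative of the error of level `k` in direction `i`, up to a constant. -/
def errorBound (α δ : ℝ) (L : Finset (Fin d → ℕ)) (i : Fin d) (k : Fin d → ℕ) (x : Fin d → ℝ) : ℝ :=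
  weight α i k * if k ∈ L then δ else ∏ j ∈ Finset.univ.erase i, sawtooth (k j) (x j)

theorem errorBound_nonneg {α δ : ℝ} (hδ : 0 ≤ δ) (L : Finset (Fin d → ℕ)) (i : Fin d)
    (k : Fin d → ℕ) (x : Fin d → ℝ) : 0 ≤ errorBound α δ L i k x := by
  refine mul_nonneg (weight_nonneg α i k) ?_
  split_ifs
  exacts [hδ, (prod_sawtooth_mem k _ x).1]

theorem errorBound_le {α δ : ℝ} (hδ : δ ≤ 1) (L : Finset (Fin d → ℕ)) (i : Fin d)
    (k : Fin d → ℕ) (x : Fin d → ℝ) : errorBound α δ L i k x ≤ weight α i k := by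
  refine mul_le_of_le_one_right (weight_nonneg α i k) ?_
  split_ifs
  exacts [hδ, (prod_sawtooth_mem k _ x).2]

theorem summable_errorBound {α δ : ℝ} (hα : 1 < α) (hδ0 : 0 ≤ δ) (hδ1 : δ ≤ 1)
    (L : Finset (Fin d → ℕ)) (i : Fin d) (x : Fin d → ℝ) :
    Summable fun k => errorBound α δ L i k x :=
  Summable.of_nonneg_of_le (fun k => errorBound_nonneg hδ0 L i k x)
    (fun k => errorBound_le hδ1 L i k x) (summable_weight hα i)

/-- The error as one series over all levels: multiplication errors on the levels in L, whole levels
elsewhere. -/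
theorem hasSum_error {α : ℝ} (hα : 1 < α) (i : Fin d) {f : (Fin d → ℝ) → ℝ} (hf : InUnitBall α f)
    (M : ℕ) (L : Finset (Fin d → ℕ)) (x : Fin d → ℝ) :
    HasSum (fun k => level (fun x => f (clamp x)) k x
        - if k ∈ L then levelApprox M (fun x => f (clamp x)) k x else 0)
      (f (clamp x) - gridApprox M L (fun x => f (clamp x)) x) := by
  refine HasSum.sub ?_ ?_
  · refine hasSum_level hf.continuous_comp_clamp (fun p hp => hf.comp_clamp_eq_zero hp) ?_
    refine Summable.of_norm_bounded ((summable_weight hα i).mul_left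
      (2 * (2 : ℝ) ^ (-((α + 1) * d)))) fun k => ?_
    exact (abs_level_le (fun s hs => hf.abs_coef_le hs) x (coefBound_nonneg α k)).trans
      (coefBound_le_weight α k i)
  · have h := hasSum_sum_of_ne_finset_zero (L := .unconditional _) (s := L) (f := fun k =>
      if k ∈ L then levelApprox M (fun x => f (clamp x)) k x else 0) fun k hk => if_neg hk
    rwa [Finset.sum_congr rfl fun k hk => if_pos hk] at h

theorem abs_error_update_sub_le {α : ℝ} (hα : 1 < α) {f : (Fin d → ℝ) → ℝ} (hf : InUnitBall α f)
    {M : ℕ} (hM : 2 * d * (1 / 2 : ℝ) ^ M ≤ 1) (L : Finset (Fin d → ℕ)) (x : Fin d → ℝ)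
    (i : Fin d) (t : ℝ) :
    |(f (clamp (Function.update x i t))
        - gridApprox M L (fun x => f (clamp x)) (Function.update x i t))
      - (f (clamp x) - gridApprox M L (fun x => f (clamp x)) x)|
      ≤ 2 * (2 : ℝ) ^ (-((α + 1) * d))
        * (∑' k, errorBound α (2 * d * (1 / 2) ^ M) L i k x) * |t - x i| := by
  have h1 := (hasSum_error hα i hf M L (Function.update x i t)).sub (hasSum_error hα i hf M L x)
  have h2 := (((summable_errorBound hα (by positivity) hM L i x).hasSum).mul_left
    (2 * (2 : ℝ) ^ (-((α + 1) * d)))).mul_right |t - x i|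
  refine h1.norm_le_of_bounded h2 fun k => ?_
  rw [Real.norm_eq_abs, errorBound, ← mul_assoc, ← coefBound_mul]
  by_cases hk : k ∈ L
  · simp only [if_pos hk]
    exact abs_levelError_update_sub_le (fun s hs => hf.abs_coef_le hs) (coefBound_nonneg α k) hM x i t
  · simp only [if_neg hk, sub_zero]
    exact abs_level_update_sub_le (fun s hs => hf.abs_coef_le hs) (coefBound_nonneg α k) x i t

theorem gridApprox_eq_zero {f : (Fin d → ℝ) → ℝ} {M : ℕ} {L : Finset (Fin d → ℕ)} {x : Fin d → ℝ}
    (hx : x ∉ cube d) : gridApprox M L f x = 0 := by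
  have : ∃ i, x i ≤ 0 ∨ 1 ≤ x i := by
    by_contra! h
    exact hx ⟨fun i => (h i).1.le, fun i => (h i).2.le⟩
  obtain ⟨i, hi⟩ := this
  refine Finset.sum_eq_zero fun k _ => Finset.sum_eq_zero fun s hs => ?_
  rw [prodApprox_hatSeq_eq_zero M (hat_eq_zero (Finset.mem_range.1 (Fintype.mem_piFinset.1 hs i)) hi),
    mul_zero]

theorem continuous_errorBound (α δ : ℝ) (L : Finset (Fin d → ℕ)) (i : Fin d) (k : Fin d → ℕ) :
    Continuous (errorBound α δ L i k) := by
  unfold errorBound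
  split_ifs
  · fun_prop
  · exact continuous_const.mul (continuous_prod_sawtooth k _)

/-- Both contributions are added for every level; extending the small term with δ to all levels is
harmless since all weights are summable. -/
theorem eLpNorm_errorBound_le {α δ : ℝ} (hδ : 0 ≤ δ) {p : ℝ≥0∞} (hp : 1 ≤ p)
    (L : Finset (Fin d → ℕ)) (i : Fin d) (k : Fin d → ℕ) :
    eLpNorm (errorBound α δ L i k) p (volume.restrict (cube d))
      ≤ ENNReal.ofReal (weight α i k) * ENNReal.ofReal δ
        + (if k ∈ L then 0 else ENNReal.ofReal (weight α i k))
          * ENNReal.ofReal (((pPow p 1)⁻¹) ^ (d - 1)) := by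
  have hw := weight_nonneg α i k
  by_cases hk : k ∈ L
  · have : errorBound α δ L i k = fun _ => weight α i k * δ := by
      funext x; rw [errorBound, if_pos hk]
    rw [this, if_pos hk, zero_mul, add_zero, ← ENNReal.ofReal_mul hw]
    exact eLpNorm_le_of_bound fun x => by rw [abs_of_nonneg (by positivity)]
  · have : errorBound α δ L i k
        = weight α i k • fun x => ∏ j ∈ Finset.univ.erase i, sawtooth (k j) (x j) := by
      funext x; rw [errorBound, if_neg hk]; rfl
    rw [this, if_neg hk, eLpNorm_const_smul, Real.enorm_of_nonneg hw]
    refine le_add_left ?_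
    gcongr
    exact eLpNorm_prod_sawtooth_le hp k i

/-- The error of the sparse grid network. -/
theorem memW10_and_w10Norm_le {α β : ℝ} (hα : 1 < α) (hβ : α < β) {p : ℝ≥0∞} (hp : 1 ≤ p)
    (hd : 1 ≤ d) (m : ℝ) {M : ℕ} (hM : 2 * d * (1 / 2 : ℝ) ^ M ≤ 1) {f u : (Fin d → ℝ) → ℝ}
    (hf : InUnitBall α f) (hu : ∀ x ∈ cube d, u x = f x - gridApprox M
      (finite_sparse d (hα.trans hβ) m).toFinset (fun x => f (clamp x)) x) :
    MemW10 p u ∧ w10Norm p u ≤ ENNReal.ofReal (d * (2 * (2 : ℝ) ^ (-((α + 1) * d))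
      * ((1 - (2 : ℝ) ^ (1 - α))⁻¹ * ((1 - (2 : ℝ) ^ (-α))⁻¹) ^ (d - 1) * (2 * d * (1 / 2) ^ M)
        + (2 : ℝ) ^ ((1 - α) * m) * (1 - (2 : ℝ) ^ (1 - α))⁻¹ * ((gap α β)⁻¹) ^ (d - 1)
          * ((pPow p 1)⁻¹) ^ (d - 1)))) := by
  classical
  set L := (finite_sparse d (hα.trans hβ) m).toFinset with hL
  set c₀ : ℝ := 2 * (2 : ℝ) ^ (-((α + 1) * d)) with hc₀
  have hc₀' : 0 ≤ c₀ := by positivity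
  set δ : ℝ := 2 * d * (1 / 2) ^ M with hδ
  have hδ0 : 0 ≤ δ := by positivity
  have h1 := two_rpow_lt_one (show 1 - α < 0 by linarith)
  have h2 := two_rpow_lt_one (show -α < 0 by linarith)
  have h3 : 0 ≤ (1 - (2 : ℝ) ^ (1 - α))⁻¹ := inv_nonneg.2 (by linarith)
  have h4 : 0 ≤ (1 - (2 : ℝ) ^ (-α))⁻¹ := inv_nonneg.2 (by linarith)
  have h5 : 0 ≤ (gap α β)⁻¹ := by
    have hb : 0 < β - 1 := by linarith
    have := two_rpow_lt_one (neg_neg_of_pos (div_pos (show 0 < β - α by linarith) hb))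
    exact inv_nonneg.2 (by rw [gap]; linarith)
  have h6 : 0 ≤ (pPow p 1)⁻¹ := by
    rw [pPow]
    split_ifs <;> positivity
  set W : ℝ := (1 - (2 : ℝ) ^ (1 - α))⁻¹ * ((1 - (2 : ℝ) ^ (-α))⁻¹) ^ (d - 1) with hW
  have hW0 : 0 ≤ W := by positivity
  set F : (Fin d → ℝ) → ℝ := fun x => f (clamp x) - gridApprox M L (fun x => f (clamp x)) x with hF
  have hupd : ∀ x i t, |F (Function.update x i t) - F x|
      ≤ c₀ * (∑' k, errorBound α δ L i k x) * |t - x i| := fun x i t =>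
    abs_error_update_sub_le hα hf hM L x i t
  have htsum : ∀ i x, ∑' k, errorBound α δ L i k x ≤ W := fun i x =>
    ((summable_errorBound hα hδ0 hM L i x).tsum_le_tsum (fun k => errorBound_le hM L i k x)
      (summable_weight hα i)).trans (tsum_weight_le_real hα i)
  -- A crude global constant, used only for membership in the Sobolev space; the norm bound rests on
  -- the pointwise `hb` below.
  have hlip : LipschitzWith (d * (c₀ * W).toNNReal) F := by
    refine lipschitzWith_of_update fun x i t => (hupd x i t).trans ?_
    rw [Real.coe_toNNReal _ (by positivity)]
    gcongr
    exact htsum i x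
  have h0 : ∀ x, x ∉ cube d → F x = 0 := fun x hx => by
    simp only [hF]
    rw [gridApprox_eq_zero hx, sub_zero]
    refine hf.comp_clamp_eq_zero ?_
    by_contra! h
    exact hx ⟨fun i => (h i).1.le, fun i => (h i).2.le⟩
  have hgrad : IsW10Gradient p u fun i x => lineDeriv ℝ F x (Pi.single i 1) :=
    isW10Gradient_lineDeriv hlip h0 fun x hx => by
      simp only [hF]
      rw [hu x hx, clamp_eq_self hx]
  refine ⟨⟨_, hgrad⟩, (iInf₂_le _ hgrad).trans ?_⟩
  rw [ENNReal.ofReal_mul (Nat.cast_nonneg d), ENNReal.ofReal_natCast]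
  refine gradNorm_le hp hd fun i => ?_
  have hb : ∀ x, |lineDeriv ℝ F x (Pi.single i 1)| ≤ c₀ * ∑' k, errorBound α δ L i k x := fun x =>
    abs_lineDeriv_le_of_update
      (mul_nonneg hc₀' (tsum_nonneg fun k => errorBound_nonneg hδ0 L i k x)) (hupd x i)
  calc _ ≤ eLpNorm (c₀ • fun x => ∑' k, errorBound α δ L i k x) p (volume.restrict (cube d)) :=
        eLpNorm_mono_real hb
    _ ≤ ENNReal.ofReal c₀ * ∑' k, (ENNReal.ofReal (weight α i k) * ENNReal.ofReal δ
        + (if k ∈ L then 0 else ENNReal.ofReal (weight α i k))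
          * ENNReal.ofReal (((pPow p 1)⁻¹) ^ (d - 1))) := by
        rw [eLpNorm_const_smul, Real.enorm_of_nonneg hc₀']
        gcongr
        refine (eLpNorm_tsum_le hp (fun k => (continuous_errorBound α δ L i k).aestronglyMeasurable)
          fun x => summable_errorBound hα hδ0 hM L i x).trans ?_
        exact ENNReal.tsum_le_tsum fun k => eLpNorm_errorBound_le hδ0 hp L i k
    _ ≤ ENNReal.ofReal c₀ * (ENNReal.ofReal W * ENNReal.ofReal δ
        + ENNReal.ofReal ((2 : ℝ) ^ ((1 - α) * m) * (1 - (2 : ℝ) ^ (1 - α))⁻¹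
          * ((gap α β)⁻¹) ^ (d - 1)) * ENNReal.ofReal (((pPow p 1)⁻¹) ^ (d - 1))) := by
        rw [ENNReal.tsum_add, ENNReal.tsum_mul_right, ENNReal.tsum_mul_right]
        gcongr
        · exact tsum_weight_le hα i
        · have := tsum_weight_compl_sparse_le hα hβ m i
          simp only [hL, Set.Finite.mem_toFinset]
          convert this
    _ = _ := by
        rw [← ENNReal.ofReal_mul hW0, ← ENNReal.ofReal_mul (by positivity),
          ← ENNReal.ofReal_add (by positivity) (by positivity), ← ENNReal.ofReal_mul hc₀']

end

noncomputable section

/-! ### The choice of the parameters -/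

theorem pPow_pos (p : ℝ≥0∞) (t : ℝ) : 0 < pPow p t := by
  rw [pPow]
  split_ifs <;> positivity

theorem pPow_natCast (p : ℝ≥0∞) (d : ℕ) : pPow p d = pPow p 1 ^ d := by
  rw [pPow, pPow]
  split_ifs
  · rw [one_pow]
  · rw [← Real.rpow_mul_natCast (by positivity)]
    congr 1
    ring

theorem gap_mem {α β : ℝ} (hα : 1 < α) (hβ : α < β) : gap α β ∈ Set.Ioo (0 : ℝ) 1 := by
  have := two_rpow_lt_one (neg_neg_of_pos (div_pos (show 0 < β - α by linarith)
    (show 0 < β - 1 by linarith)))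
  have h : (0 : ℝ) < (2 : ℝ) ^ (-((β - α) / (β - 1))) := by positivity
  rw [gap]
  constructor <;> linarith

/-- The base of the exponential factor in the accuracy of sparse grids. -/
def base (α β : ℝ) (p : ℝ≥0∞) : ℝ := pPow p 1 * (2 : ℝ) ^ (α + 1) * gap α β

theorem base_pos {α β : ℝ} (hα : 1 < α) (hβ : α < β) (p : ℝ≥0∞) : 0 < base α β p := by
  have := (gap_mem hα hβ).1
  have := pPow_pos p 1
  unfold base; positivity

theorem base_pow (α β : ℝ) (p : ℝ≥0∞) (d : ℕ) :
    base α β p ^ d = pPow p d * (2 : ℝ) ^ ((α + 1) * d) * gap α β ^ d := by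
  rw [base, mul_pow, mul_pow, pPow_natCast, Real.rpow_mul_natCast (by norm_num)]

/-- The product of the constants in front of the tail of the series. -/
theorem tail_const_le {α β : ℝ} (hα : 1 < α) (hβ : α < β) (p : ℝ≥0∞) {d : ℕ} (hd : 1 ≤ d) :
    (2 : ℝ) ^ (-((α + 1) * d)) * ((gap α β)⁻¹) ^ (d - 1) * ((pPow p 1)⁻¹) ^ (d - 1)
      ≤ pPow p 1 / base α β p ^ d := by
  obtain ⟨hg0, hg1⟩ := gap_mem hα hβ
  have hP := pPow_pos p 1
  have h2 : (0 : ℝ) < (2 : ℝ) ^ ((α + 1) * d) := by positivity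
  obtain ⟨n, rfl⟩ : ∃ n, d = n + 1 := ⟨d - 1, by omega⟩
  rw [base_pow, pPow_natCast, Real.rpow_neg (by norm_num), Nat.add_sub_cancel]
  set T := (2 : ℝ) ^ ((α + 1) * ((n + 1 : ℕ) : ℝ)) with hT
  rw [pow_succ, pow_succ, inv_pow, inv_pow]
  have e : T⁻¹ * (gap α β ^ n)⁻¹ * (pPow p 1 ^ n)⁻¹
      = gap α β * (pPow p 1 / (pPow p 1 ^ n * pPow p 1 * T * (gap α β ^ n * gap α β))) := by
    field_simp
  rw [e]
  exact mul_le_of_le_one_left (by positivity) hg1.le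

/-- Since 2^(-α) ≤ 1/2, the geometric factors are at most 2 each and are absorbed by the
exponentially small coefficients. The multiplication error thus carries no exponential factor in d.
-/
theorem level_const_le {α : ℝ} (hα : 1 < α) (d : ℕ) :
    (2 : ℝ) ^ (-((α + 1) * d)) * ((1 - (2 : ℝ) ^ (-α))⁻¹) ^ (d - 1) ≤ 1 := by
  have h1 : (2 : ℝ) ^ (-α) ≤ 1 / 2 := by
    calc (2 : ℝ) ^ (-α) ≤ (2 : ℝ) ^ (-1 : ℝ) :=
          Real.rpow_le_rpow_of_exponent_le (by norm_num) (by linarith)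
      _ = 1 / 2 := by rw [Real.rpow_neg_one]; norm_num
  have h2 : (1 - (2 : ℝ) ^ (-α))⁻¹ ≤ 2 := by
    rw [inv_le_comm₀ (by linarith) (by norm_num)]; linarith
  have h3 : 0 ≤ (1 - (2 : ℝ) ^ (-α))⁻¹ := inv_nonneg.2 (by linarith)
  calc (2 : ℝ) ^ (-((α + 1) * d)) * ((1 - (2 : ℝ) ^ (-α))⁻¹) ^ (d - 1)
      ≤ (2 : ℝ) ^ (-(d : ℝ)) * 2 ^ d := by
        gcongr ?_ * ?_
        · refine Real.rpow_le_rpow_of_exponent_le (by norm_num) ?_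
          have : (0 : ℝ) ≤ d := d.cast_nonneg
          nlinarith
        · exact (pow_le_pow_left₀ h3 h2 _).trans (pow_le_pow_right₀ (by norm_num) (by omega))
    _ = 1 := by
        rw [Real.rpow_neg (by norm_num), Real.rpow_natCast, inv_mul_cancel₀ (by positivity)]

/-- The total error is at most `ε`. -/
theorem error_le {α β : ℝ} (hα : 1 < α) (hβ : α < β) (p : ℝ≥0∞) {d : ℕ} (hd : 1 ≤ d) {ε K m : ℝ}
    (hε : 0 < ε) (hK : 4 * (1 - (2 : ℝ) ^ (1 - α))⁻¹ * pPow p 1 ≤ K)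
    (hm : (2 : ℝ) ^ ((α - 1) * m) = K * d ^ 2 / base α β p ^ d / ε) {M : ℕ}
    (hM : 8 * d ^ 2 / ((1 - (2 : ℝ) ^ (1 - α)) * ε) ≤ 2 ^ M) :
    d * (2 * (2 : ℝ) ^ (-((α + 1) * d))
      * ((1 - (2 : ℝ) ^ (1 - α))⁻¹ * ((1 - (2 : ℝ) ^ (-α))⁻¹) ^ (d - 1) * (2 * d * (1 / 2) ^ M)
        + (2 : ℝ) ^ ((1 - α) * m) * (1 - (2 : ℝ) ^ (1 - α))⁻¹ * ((gap α β)⁻¹) ^ (d - 1)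
          * ((pPow p 1)⁻¹) ^ (d - 1))) ≤ ε := by
  have hr : 0 < 1 - (2 : ℝ) ^ (1 - α) := by
    linarith [two_rpow_lt_one (show 1 - α < 0 by linarith)]
  have hd1 : (1 : ℝ) ≤ d := by exact_mod_cast hd
  have hP := pPow_pos p 1
  have hX : 0 < base α β p ^ d := pow_pos (base_pos hα hβ p) d
  have hA := level_const_le hα d
  have hB := tail_const_le hα hβ p hd
  set r := 1 - (2 : ℝ) ^ (1 - α) with hrd
  set c := (2 : ℝ) ^ (-((α + 1) * d)) with hc
  set a := ((1 - (2 : ℝ) ^ (-α))⁻¹) ^ (d - 1) with ha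
  set g := ((gap α β)⁻¹) ^ (d - 1) with hg
  set v := ((pPow p 1)⁻¹) ^ (d - 1) with hv
  have hK0 : 0 < K := lt_of_lt_of_le (by positivity) hK
  have hm' : (2 : ℝ) ^ ((1 - α) * m) = ε * base α β p ^ d / (K * d ^ 2) := by
    rw [show (1 - α) * m = -((α - 1) * m) by ring, Real.rpow_neg (by norm_num), hm]
    field_simp
  -- Half of ε goes to the approximate multiplications, the other half (`h2`) to the discarded
  -- levels.
  have h1 : 4 * d ^ 2 * r⁻¹ * (1 / 2) ^ M ≤ ε / 2 := by
    rw [div_le_iff₀ (by positivity)] at hM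
    rw [one_div, inv_pow, ← div_eq_mul_inv, ← div_eq_mul_inv, div_div, div_le_iff₀ (by positivity)]
    linarith
  have h2 : 2 * d * ((2 : ℝ) ^ ((1 - α) * m) * r⁻¹ * (c * g * v)) ≤ ε / 2 := by
    have e1 : 2 * d * ((2 : ℝ) ^ ((1 - α) * m) * r⁻¹ * (pPow p 1 / base α β p ^ d))
        = (4 * r⁻¹ * pPow p 1) * (ε / 2) / (K * d) := by
      rw [hm']; field_simp; ring
    calc _ ≤ 2 * d * ((2 : ℝ) ^ ((1 - α) * m) * r⁻¹ * (pPow p 1 / base α β p ^ d)) := by gcongr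
      _ = (4 * r⁻¹ * pPow p 1) * (ε / 2) / (K * d) := e1
      _ ≤ ε / 2 := by
          rw [div_le_iff₀ (by positivity)]
          calc _ ≤ K * (ε / 2) := by gcongr
            _ ≤ K * (ε / 2) * d := le_mul_of_one_le_right (by positivity) hd1
            _ = _ := by ring
  have h3 : d * (2 * c * (r⁻¹ * a * (2 * d * (1 / 2) ^ M))) ≤ 4 * d ^ 2 * r⁻¹ * (1 / 2) ^ M := by
    calc _ = (c * a) * (4 * d ^ 2 * r⁻¹ * (1 / 2) ^ M) := by ring
      _ ≤ _ := mul_le_of_le_one_left (by positivity) hA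
  calc _ = d * (2 * c * (r⁻¹ * a * (2 * d * (1 / 2) ^ M)))
        + 2 * d * ((2 : ℝ) ^ ((1 - α) * m) * r⁻¹ * (c * g * v)) := by ring
    _ ≤ ε := by linarith

/-- Since 2α/(α-1) = 2 + 2/(α-1), the power d^(2α/d) inside `B` yields d² · (d²)^(1/(α-1)). The
first d² pays for d directions times d factors per term, the second for the d² in 2^((α-1)m). -/
theorem B_rpow {α β : ℝ} (hα : 1 < α) (hβ : α < β) (p : ℝ≥0∞) {d : ℕ} (hd : 1 ≤ d) {ε K : ℝ}
    (hε : 0 < ε) (hK : 0 < K) :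
    K ^ (1 / (α - 1)) * (B d α β p ^ (-(d : ℝ)) * ε⁻¹ ^ (1 / (α - 1)))
      = d ^ 2 * (K * d ^ 2 / base α β p ^ d / ε) ^ (1 / (α - 1))
        * ((1 - (2 : ℝ) ^ (-(1 / (β - 1))))⁻¹) ^ d := by
  have hG : 0 < 1 - (2 : ℝ) ^ (-(1 / (β - 1))) := by
    have hb : 0 < β - 1 := by linarith
    linarith [two_rpow_lt_one (neg_neg_of_pos (show 0 < 1 / (β - 1) by positivity))]
  have hd0 : (0 : ℝ) < d := by exact_mod_cast hd
  have hX := base_pos hα hβ p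
  have ha : 0 < α - 1 := by linarith
  rw [B, ← base]
  set G := 1 - (2 : ℝ) ^ (-(1 / (β - 1)))
  set X := base α β p
  set q := 1 / (α - 1) with hq
  have hdd : (d : ℝ) ^ 2 * ((d : ℝ) ^ 2) ^ q = (d : ℝ) ^ (2 * α * q) := by
    rw [← Real.rpow_natCast, ← Real.rpow_mul hd0.le, ← Real.rpow_add hd0]
    congr 1
    rw [hq]; push_cast; field_simp; ring
  have e1 : (G * (X / (d : ℝ) ^ (2 * α / d)) ^ q) ^ (-(d : ℝ))
      = (G⁻¹) ^ d * ((X ^ d)⁻¹ ^ q * (d : ℝ) ^ (2 * α * q)) := by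
    rw [Real.mul_rpow hG.le (by positivity), Real.rpow_neg hG.le, Real.rpow_natCast, inv_pow,
      Real.div_rpow hX.le (by positivity), Real.div_rpow (by positivity) (by positivity),
      ← Real.rpow_mul hd0.le, ← Real.rpow_mul hd0.le, ← Real.rpow_mul hX.le]
    congr 1
    rw [div_eq_mul_inv, ← Real.rpow_neg hd0.le]
    congr 1
    · rw [← Real.rpow_natCast X d, ← Real.rpow_neg hX.le, ← Real.rpow_mul hX.le]
      congr 1
      ring
    · congr 1
      field_simp
  rw [e1, div_eq_mul_inv _ ε, Real.mul_rpow (by positivity) (by positivity),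
    div_eq_mul_inv _ (X ^ d), Real.mul_rpow (by positivity) (by positivity),
    Real.mul_rpow hK.le (by positivity), ← hdd]
  ring

/-- With d ≤ 2^d the hypothesis becomes 2^((α-1)d) (1 - 2^(1-α)) ε < 1; taking logarithms bounds d.
A linear term d in the number of iterations is therefore affordable. -/
theorem le_mul_max_logb {α ε : ℝ} (hα : 1 < α) {d : ℕ} (hε : 0 < ε)
    (h : ε < d / ((2 : ℝ) ^ (α * d) * (1 - (2 : ℝ) ^ (1 - α)))) :
    (d : ℝ) ≤ (1 - Real.logb 2 (1 - (2 : ℝ) ^ (1 - α))) / (α - 1)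
      * max 1 (Real.logb 2 ε⁻¹) := by
  have hr : 0 < 1 - (2 : ℝ) ^ (1 - α) := by
    linarith [two_rpow_lt_one (show 1 - α < 0 by linarith)]
  have hr1 : 1 - (2 : ℝ) ^ (1 - α) ≤ 1 := by
    linarith [show (0 : ℝ) < (2 : ℝ) ^ (1 - α) by positivity]
  set r := 1 - (2 : ℝ) ^ (1 - α)
  have ha : 0 < α - 1 := by linarith
  rw [lt_div_iff₀ (by positivity)] at h
  have hd : (d : ℝ) ≤ (2 : ℝ) ^ (d : ℝ) := by
    rw [Real.rpow_natCast]
    exact_mod_cast Nat.lt_two_pow_self.le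
  have h1 := Real.logb_lt_logb (b := 2) (by norm_num) (by positivity) (h.trans_le hd)
  rw [Real.logb_rpow (by norm_num) (by norm_num), Real.logb_mul hε.ne' (by positivity),
    Real.logb_mul (by positivity) hr.ne', Real.logb_rpow (by norm_num) (by norm_num)] at h1
  have hl : Real.logb 2 r ≤ 0 := Real.logb_nonpos (by norm_num) hr.le hr1
  have h2 : Real.logb 2 ε⁻¹ = -Real.logb 2 ε := Real.logb_inv 2 ε
  set L := max 1 (Real.logb 2 ε⁻¹)
  have h3 : 1 ≤ L := le_max_left _ _
  have h4 : Real.logb 2 ε⁻¹ ≤ L := le_max_right _ _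
  rw [div_mul_eq_mul_div, le_div_iff₀ ha]
  nlinarith

/-- M is the rounded-up logarithm of the required size; the term 2d comes from the crude bound log₂
d ≤ d. -/
theorem exists_iterations {r ε : ℝ} (hr0 : 0 < r) (hr1 : r ≤ 1) (hε0 : 0 < ε) (hε1 : ε ≤ 1) {d : ℕ}
    (hd : 1 ≤ d) : ∃ M : ℕ, 8 * d ^ 2 / (r * ε) ≤ 2 ^ M ∧
      (M : ℝ) ≤ 4 + 2 * d - Real.logb 2 r + max 1 (Real.logb 2 ε⁻¹) := by
  have hd1 : (1 : ℝ) ≤ d := by exact_mod_cast hd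
  have hlog : Real.logb 2 (8 * d ^ 2 / (r * ε))
      = 3 + 2 * Real.logb 2 d - Real.logb 2 r + Real.logb 2 ε⁻¹ := by
    rw [Real.logb_div (by positivity) (by positivity), Real.logb_mul (by positivity) (by positivity),
      Real.logb_mul hr0.ne' hε0.ne', Real.logb_pow, Real.logb_inv,
      show (8 : ℝ) = 2 ^ (3 : ℝ) by norm_num, Real.logb_rpow (by norm_num) (by norm_num)]
    push_cast
    ring
  have hld : Real.logb 2 d ≤ d := by
    rw [Real.logb_le_iff_le_rpow (by norm_num) (by positivity), Real.rpow_natCast]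
    exact_mod_cast Nat.lt_two_pow_self.le
  have hld0 : 0 ≤ Real.logb 2 d := Real.logb_nonneg (by norm_num) hd1
  have hl : Real.logb 2 r ≤ 0 := Real.logb_nonpos (by norm_num) hr0.le hr1
  have hle : 0 ≤ Real.logb 2 ε⁻¹ := Real.logb_nonneg (by norm_num) ((one_le_inv₀ hε0).2 hε1)
  refine ⟨⌈Real.logb 2 (8 * d ^ 2 / (r * ε))⌉₊, ?_, ?_⟩
  · have h := (Real.logb_le_iff_le_rpow (b := 2) (by norm_num)
      (show 0 < 8 * (d : ℝ) ^ 2 / (r * ε) by positivity)).1 (Nat.le_ceil _)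
    rwa [Real.rpow_natCast] at h
  · have := Nat.ceil_lt_add_one (show 0 ≤ Real.logb 2 (8 * d ^ 2 / (r * ε)) by rw [hlog]; linarith)
    have h2 := le_max_right 1 (Real.logb 2 ε⁻¹)
    rw [hlog] at this
    rw [hlog]
    linarith

theorem two_mul_half_pow_le_one {r ε : ℝ} (hr0 : 0 < r) (hr1 : r ≤ 1) (hε0 : 0 < ε) (hε1 : ε ≤ 1)
    {d M : ℕ} (hM : 8 * d ^ 2 / (r * ε) ≤ (2 : ℝ) ^ M) : 2 * d * (1 / 2 : ℝ) ^ M ≤ 1 := by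
  rw [div_le_iff₀ (by positivity)] at hM
  rw [one_div, inv_pow, ← div_eq_mul_inv, div_le_one (by positivity)]
  have h1 : (2 : ℝ) ^ M * (r * ε) ≤ 2 ^ M * 1 := by gcongr; nlinarith
  have h2 : (d : ℝ) ≤ d ^ 2 := by exact_mod_cast Nat.le_self_pow two_ne_zero d
  nlinarith

/-- The depth of the network, for a suitable choice of the level `m` of the sparse grid and of the
number `M` of iterations in the approximate multiplications. -/
theorem exists_parameters {α β : ℝ} (hα : 1 < α) (hβ : α < β) (p : ℝ≥0∞) :
    ∃ K₅ : ℝ, 0 < K₅ ∧ ∀ d : ℕ, 2 ≤ d → ∀ ε : ℝ, 0 < ε → ε < ε₀ d α β p → ∃ (m : ℝ) (M : ℕ),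
      2 * d * (1 / 2 : ℝ) ^ M ≤ 1 ∧
      d * (2 * (2 : ℝ) ^ (-((α + 1) * d))
      * ((1 - (2 : ℝ) ^ (1 - α))⁻¹ * ((1 - (2 : ℝ) ^ (-α))⁻¹) ^ (d - 1) * (2 * d * (1 / 2) ^ M)
        + (2 : ℝ) ^ ((1 - α) * m) * (1 - (2 : ℝ) ^ (1 - α))⁻¹ * ((gap α β)⁻¹) ^ (d - 1)
          * ((pPow p 1)⁻¹) ^ (d - 1))) ≤ ε ∧
      (((∑ k ∈ (finite_sparse d (hα.trans hβ) m).toFinset, (positions k).card)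
          * (d * (M + 3) + 1) + 2 : ℕ) : ℝ)
        ≤ K₅ * B d α β p ^ (-(d : ℝ)) * ε⁻¹ ^ (1 / (α - 1)) * max 1 (Real.logb 2 ε⁻¹) := by
  have hr : 0 < 1 - (2 : ℝ) ^ (1 - α) := by
    linarith [two_rpow_lt_one (show 1 - α < 0 by linarith)]
  have hr1 : 1 - (2 : ℝ) ^ (1 - α) ≤ 1 := by
    linarith [show (0 : ℝ) < (2 : ℝ) ^ (1 - α) by positivity]
  have ha : 0 < α - 1 := by linarith
  have hP := pPow_pos p 1
  -- The second entry makes the discarded levels contribute at most ε/2; the first gives m ≥ 0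
  -- through the bound on ε by `ε₀`.
  set K : ℝ := max (K₁ α β p) (4 * (1 - (2 : ℝ) ^ (1 - α))⁻¹ * pPow p 1) with hK
  have hK0 : 0 < K := lt_max_of_lt_right (by positivity)
  set C : ℝ := (1 - Real.logb 2 (1 - (2 : ℝ) ^ (1 - α))) / (α - 1) with hC
  have hl : Real.logb 2 (1 - (2 : ℝ) ^ (1 - α)) ≤ 0 := Real.logb_nonpos (by norm_num) hr.le hr1
  have hC0 : 0 ≤ C := div_nonneg (by linarith) ha.le
  -- With d ≤ C L and 1 ≤ L, the bound for M gives M + 5 ≤ 9 + 2d - log₂(1 - 2^(1-α)) + L ≤ E L.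
  set E : ℝ := 10 + 2 * C - Real.logb 2 (1 - (2 : ℝ) ^ (1 - α)) with hE
  have hE0 : 0 < E := by linarith
  refine ⟨2 * E * K ^ (1 / (α - 1)), by positivity, fun d hd ε hε0 hε => ?_⟩
  have hd0 : (1 : ℝ) ≤ d := by exact_mod_cast (by omega : 1 ≤ d)
  have hX : 0 < base α β p ^ d := pow_pos (base_pos hα hβ p) d
  have hε1 : ε ≤ 1 := (hε.trans_le (min_le_left _ _)).le
  have hε2 := hε.trans_le ((min_le_right _ _).trans (min_le_left _ _))
  have hε3 := hε.trans_le ((min_le_right _ _).trans (min_le_right _ _))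
  have hdL := le_mul_max_logb hα hε0 hε2
  rw [← base_pow, lt_div_iff₀ hX] at hε3
  obtain ⟨M, hM1, hM2⟩ := exists_iterations hr hr1 hε0 hε1 (d := d) (by omega)
  set L := max 1 (Real.logb 2 ε⁻¹) with hL
  have hL1 : 1 ≤ L := le_max_left _ _
  set Y : ℝ := K * d ^ 2 / base α β p ^ d / ε with hY
  have hY1 : 1 ≤ Y := by
    rw [hY, div_div, le_div_iff₀ (by positivity), one_mul]
    calc _ = ε * base α β p ^ d := mul_comm _ _
      _ ≤ K₁ α β p * d ^ 2 := hε3.le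
      _ ≤ K * d ^ 2 := by gcongr; exact le_max_left _ _
  have hY0 : 0 < Y := by linarith
  -- Chosen so that 2^((α-1)m) = Y, as `error_le` requires.
  set m : ℝ := Real.logb 2 Y * (1 / (α - 1)) with hm
  have h2Y : (2 : ℝ) ^ Real.logb 2 Y = Y := Real.rpow_logb (by norm_num) (by norm_num) hY0
  have hm1 : (2 : ℝ) ^ m = Y ^ (1 / (α - 1)) := by
    rw [hm, Real.rpow_mul (by norm_num), h2Y]
  have hm2 : (2 : ℝ) ^ ((α - 1) * m) = Y := by
    rw [hm, show (α - 1) * (Real.logb 2 Y * (1 / (α - 1))) = Real.logb 2 Y by field_simp, h2Y]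
  refine ⟨m, M, two_mul_half_pow_le_one hr hr1 hε0 hε1 hM1,
    error_le hα hβ p (by omega) hε0 (le_max_right _ _) hm2 hM1, ?_⟩
  have hN := sum_card_positions_le (d := d) (hα.trans hβ) m
  set N := ∑ k ∈ (finite_sparse d (hα.trans hβ) m).toFinset, (positions k).card
  have hG : 1 ≤ (1 - (2 : ℝ) ^ (-(1 / (β - 1))))⁻¹ := by
    have hb : 0 < β - 1 := by linarith
    have h1 := two_rpow_lt_one (neg_neg_of_pos (show 0 < 1 / (β - 1) by positivity))
    rw [one_le_inv₀ (by linarith)]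
    linarith [show (0 : ℝ) < (2 : ℝ) ^ (-(1 / (β - 1))) by positivity]
  have hB := B_rpow hα hβ p (d := d) (by omega) hε0 hK0
  rw [← hY, ← hm1] at hB
  set G := (1 - (2 : ℝ) ^ (-(1 / (β - 1))))⁻¹
  have hQ : 1 ≤ (2 : ℝ) ^ m := by rw [hm1]; exact Real.one_le_rpow hY1 (by positivity)
  have hGd : 1 ≤ G ^ d := one_le_pow₀ hG
  set Q := (2 : ℝ) ^ m * G ^ d with hQd
  have hQ1 : 1 ≤ Q := one_le_mul_of_one_le_of_one_le hQ hGd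
  have hN' : (N : ℝ) ≤ 2 * d * Q := by
    refine hN.trans ?_
    rw [hQd, ← mul_assoc]
    gcongr
    omega
  have hME : (M : ℝ) + 5 ≤ E * L := by nlinarith
  -- Each of the N terms takes M + 3 layers for each of its d factors and one for the accumulation.
  -- The summand 2 stands for the start layer and the output layer.
  calc (((N * (d * (M + 3) + 1) + 2 : ℕ)) : ℝ) = N * (d * (M + 3) + 1) + 2 := by push_cast; ring
    _ ≤ 2 * d * Q * (d * (M + 4)) + 2 * (d ^ 2 * Q) := by
        gcongr ?_ * ?_ + ?_
        · linarith
        · have : (1 : ℝ) ≤ d ^ 2 * Q := one_le_mul_of_one_le_of_one_le (one_le_pow₀ hd0) hQ1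
          linarith
    _ = 2 * (d ^ 2 * Q) * (M + 5) := by ring
    _ ≤ 2 * (d ^ 2 * Q) * (E * L) := by gcongr
    _ = 2 * E * (d ^ 2 * 2 ^ m * G ^ d) * L := by rw [hQd]; ring
    _ = _ := by rw [← hB]; ring

/-- The sparse grid network. -/
theorem exists_net_gridApprox {d : ℕ} (M : ℕ) (L : Finset (Fin d → ℕ)) (f : (Fin d → ℝ) → ℝ) :
    ∃ Φ : Net (constShape d (d + 12) ((∑ k ∈ L, (positions k).card) * (d * (M + 3) + 1))
      (by omega)), ∀ x ∈ cube d, Φ.output x = gridApprox M L f x := by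
  have h := exists_net_sum M ((L.sigma positions).map (Equiv.sigmaEquivProd _ _).toEmbedding)
    fun t => coef f t.1 t.2
  rw [Finset.card_map, Finset.card_sigma] at h
  obtain ⟨Φ, hΦ⟩ := h
  refine ⟨Φ, fun x hx => ?_⟩
  rw [hΦ x hx.1, Finset.sum_map, Finset.sum_sigma]
  rfl

end

end DeepReLU

/-! ### Assembly of the theorem -/

theorem corollary4p4 :
    ∃ K₄ : ℝ, 0 < K₄ ∧
      ∀ (α β : ℝ) (p : ENNReal), 1 < α → α ≤ 2 → α < β → 1 ≤ p →
        ∃ K₅ : ℝ, 0 < K₅ ∧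
          ∀ d : ℕ, 2 ≤ d → ∀ ε : ℝ, 0 < ε → ε < DeepReLU.ε₀ d α β p →
            ∃ (D : DeepReLU.NetShape d) (A : DeepReLU.Net D), A.IsArchitecture ∧
              (D.width : ℝ) ≤ K₄ * d ∧
              (D.depth : ℝ) ≤ K₅ * (DeepReLU.B d α β p) ^ (-(d : ℝ)) *
                (ε⁻¹) ^ (1 / (α - 1)) * max 1 (Real.logb 2 ε⁻¹) ∧
              ∀ f : (Fin d → ℝ) → ℝ, DeepReLU.InUnitBall α f →
                ∃ Φ : DeepReLU.Net D, Φ.HasArchitecture A ∧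
                  DeepReLU.MemW10 p (fun x => f x - Φ.output x) ∧
                  DeepReLU.w10Norm p (fun x => f x - Φ.output x) ≤ ENNReal.ofReal ε := by
  -- The width d + 12 is at most 7d for d ≥ 2.
  refine ⟨7, by norm_num, fun α β p hα _ hβ hp => ?_⟩
  obtain ⟨K₅, hK₅, h⟩ := DeepReLU.exists_parameters hα hβ p
  refine ⟨K₅, hK₅, fun d hd ε hε0 hε => ?_⟩
  obtain ⟨m, M, hM, herr, hdepth⟩ := h d hd ε hε0 hε
  set L := (DeepReLU.finite_sparse d (hα.trans hβ) m).toFinset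
  -- All weights of the architecture are 1, so it prescribes no zeros. Only the dimensions have to
  -- be common to all f, and they depend only on d and on the chosen grid and M.
  refine ⟨DeepReLU.constShape d (d + 12) _ (by omega), ⟨fun _ _ _ => 1, fun _ _ => 1⟩,
    fun ℓ _ => ⟨fun _ _ => Or.inr rfl, fun _ => Or.inr rfl⟩, ?_, hdepth, fun f hf => ?_⟩
  · have h1 := DeepReLU.width_constShape_le d (d + 12)
      ((∑ k ∈ L, (DeepReLU.positions k).card) * (d * (M + 3) + 1)) (by omega) (by omega)
    exact_mod_cast h1.trans (by omega)
  · obtain ⟨Φ, hΦ⟩ := DeepReLU.exists_net_gridApprox M L fun x => f (DeepReLU.clamp x)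
    have key := DeepReLU.memW10_and_w10Norm_le hα hβ hp (by omega) m hM hf
      (u := fun x => f x - Φ.output x) fun x hx => by rw [hΦ x hx]
    exact ⟨Φ, fun ℓ _ => ⟨fun _ _ h => absurd h one_ne_zero, fun _ h => absurd h one_ne_zero⟩,
      key.1, key.2.trans (ENNReal.ofReal_le_ofReal herr)⟩
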